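/- Network model. Base stations (BSs) form a homogeneous Poisson point process $\Phi_b$ on $\mathbb R^2$ with intensity $\lambda_b>0$. Multicast transmitters form a homogeneous Poisson point process $\Phi_m$ with intensity $\lambda_m>0$. Each $x\in\Phi_m$ has a point process $\Phi_{m,x}$ of receivers which, conditionally on $\Phi_m$, has intensity measure $\lambda_r\,\nu(\cdot\cap B(x,R))$, where $\nu$ is Lebesgue measure, $\lambda_r,R>0$, and the law is otherwise arbitrary. $\Phi_b$ is independent of $(\Phi_m,(\Phi_{m,x})_x)$. The path loss is $\ell(r)=Ar^\alpha$ with $A>0$, $\alpha>2$; the threshold is $T>0$; $\mathrm{SNR}^{-1}=\sigma^2/P_m$ and $\mathrm{SNR}_c^{-1}=\sigma^2/P_b$ with noise power $\sigma^2\ge 0$ and powers $P_m,P_b>0$. All fading variables $F_{y,x'}(n)$ (transmitter $x'$ to receiver $y$, $n$-th transmission) and $F_{y,z}$ (BS $z$ to receiver $y$) are i.i.d. $\mathrm{Exp}(1)$ and independent of all positions. For $x\in\Phi_m$ with nearest BS $z_x$, and $y\in\Phi_{m,x}$, put $$\mathrm{SINR}_{y,x}(n)=\frac{F_{y,x}(n)/\ell(\|x-y\|)}{\mathrm{SNR}^{-1}+\sum_{x'\in\Phi_m\setminus\{x\}}F_{y,x'}(n)/\ell(\|x'-y\|)},\qquad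 \mathrm{SINR}^{(c)}_{y}=\frac{F_{y,z_x}/\ell(\|z_x-x\|)}{\mathrm{SNR}_c^{-1}+\sum_{z\in\Phi_b\setminus\{z_x\}}F_{y,z}/\ell(\|z-x\|)}$$ (for BS links, the distance to a receiver is taken to be the distance to its transmitter). Let $g:[0,\infty)\to[0,1]$ be measurable. Transmitter $x$ is assisted by $z_x$ with probability $g(\|x-z_x\|)$, by a randomization independent of everything else (so deterministically if $g$ is $\{0,1\}$-valued). The receiver $y\in\Phi_{m,x}$ is covered if $\mathrm{SINR}_{y,x}(n)\ge T$ for some $n\in\{1,\dots,\tau_m\}$, or if $x$ is assisted and $\mathrm{SINR}^{(c)}_y\ge T$. Let $\mathbb E^o$ denote expectation under the Palm measure of $\Phi_b$, i.e. $\mathbb E^o[\varphi]=\frac1{\lambda_b|B|}\mathbb E\big[\sum_{z\in\Phi_b\cap B}\varphi(\text{network translated by }-z)\big]$ for any Borel set $B$ with $0<|B|<\infty$, and let $\mathcal C_o(\Phi_b)=\{x:\|x\|\le\|x-z\|\ \forall z\in\Phi_b\}$ be the Voronoi cell of the BS at the origin. Then $$\mathbb E^o\Big[\sum_{x\in\Phi_m\cap\mathcal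 C_o(\Phi_b)}g(\|x\|)\Big]=\frac{\lambda_m}{\lambda_b}\mathbb E_D[g(D)],\qquad \mathbb E^o\Big[\sum_{x\in\Phi_m\cap\mathcal C_o(\Phi_b)}|\Phi_{m,x}|\Big]=\frac{\lambda_m}{\lambda_b}\bar N_{\max},$$ $$\mathbb E^o\Big[\sum_{x\in\Phi_m\cap\mathcal C_o(\Phi_b)}\ \sum_{y\in\Phi_{m,x}}\mathbb I(y\text{ is covered})\Big]=\frac{\lambda_m}{\lambda_b}\mathbb E_D\big[h(D;\tau_m,g(D))\big].$$ Here $D$ is Rayleigh distributed with density $2\pi\lambda_b re^{-\lambda_b\pi r^2}$, $r\ge0$; $\bar N_{\max}=\lambda_r\pi R^2$; $h(r;\tau_m,\gamma)=\bar N(\tau_m)+\gamma\,q(r)(\bar N_{\max}-\bar N(\tau_m))$; $q(r)=e^{-T\,\mathrm{SNR}_c^{-1}Ar^\alpha-2\pi\lambda_bH(T,\alpha)r^2}$ with $H(T,\alpha)=\int_1^\infty\frac{x}{1+x^\alpha/T}\,dx$; and $$\bar N(\tau_m)=2\pi\lambda_r\sum_{n=1}^{\tau_m}(-1)^{n+1}\binom{\tau_m}{n}\int_0^R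 r\,e^{-nT\,\mathrm{SNR}^{-1}Ar^\alpha}e^{-\lambda_mK(\alpha,n)T^{2/\alpha}r^2}\,dr,\quad K(\alpha,n)=\frac{2\pi}{\alpha}\int_0^\infty t^{-\frac2\alpha-1}\Big(1-\frac1{(1+t)^n}\Big)dt,$$ which is the mean number, under the Palm measure of $\Phi_m$, of receivers in the cluster of the transmitter at the origin that are covered without network assistance. -/

import Mathlib

open MeasureTheory ProbabilityTheory
open scoped ENNReal

noncomputable section

namespace MulticastD2D

/-- The Euclidean plane, with Lebesgue measure as `volume`. -/
abbrev Plane : Type := EuclideanSpace ℝ (Fin 2)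

/-- The system parameters. -/
structure Params where
  /-- intensity of the base stations -/
  lamB : ℝ
  /-- intensity of the multicast transmitters -/
  lamM : ℝ
  /-- intensity of the receivers inside a cluster -/
  lamR : ℝ
  /-- cluster radius -/
  R : ℝ
  /-- path loss constant: the path loss is `A * r ^ α` -/
  A : ℝ
  /-- path loss exponent -/
  α : ℝ
  /-- detection threshold -/
  T : ℝ
  /-- transmit power of the D2D transmitters -/
  Pm : ℝ
  /-- transmit power of the base stations -/
  Pb : ℝ
  /-- noise power -/
  noise : ℝ
  /-- number of times each D2D transmitter sends its message -/
  τ : ℕ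
  lamB_pos : 0 < lamB
  lamM_pos : 0 < lamM
  lamR_pos : 0 < lamR
  R_pos : 0 < R
  A_pos : 0 < A
  two_lt_α : 2 < α
  T_pos : 0 < T
  Pm_pos : 0 < Pm
  Pb_pos : 0 < Pb
  noise_nonneg : 0 ≤ noise

/-- A realization of the network. The points of each process are enumerated (a Poisson process of
positive intensity on the plane almost surely has infinitely many points); nothing below depends
on the enumeration. -/
structure Config where
  /-- base station positions -/
  bs : ℕ → Plane
  /-- multicast D2D transmitter positions -/
  tx : ℕ → Plane
  /-- `num i`: the number of receivers of transmitter `i` -/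
  num : ℕ → ℕ
  /-- `rx i k` for `k < num i`: the position of the `k`-th receiver of transmitter `i` -/
  rx : ℕ → ℕ → Plane
  /-- `coin i`: the randomization used when transmitter `i` is assisted with a probability in
  `[0,1]` -/
  coin : ℕ → ℝ
  /-- `fadeD i k l n`: fading power from transmitter `l` to the `k`-th receiver of transmitter `i`
  in the `n`-th transmission -/
  fadeD : ℕ → ℕ → ℕ → ℕ → ℝ
  /-- `fadeC i k j`: fading power from base station `j` to the `k`-th receiver of
  transmitter `i` -/
  fadeC : ℕ → ℕ → ℕ → ℝ

namespace Config

/-- All coordinates of a realization, as a tuple. -/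
def coords (c : Config) : (ℕ → Plane) × (ℕ → Plane) × (ℕ → ℕ) × (ℕ → ℕ → Plane) × (ℕ → ℝ) ×
    (ℕ → ℕ → ℕ → ℕ → ℝ) × (ℕ → ℕ → ℕ → ℝ) :=
  (c.bs, c.tx, c.num, c.rx, c.coin, c.fadeD, c.fadeC)

/-- The product sigma-algebra of all coordinates. -/
instance : MeasurableSpace Config := MeasurableSpace.comap coords inferInstance

/-- The cluster of transmitter `i`, as a counting measure. -/
def cluster (c : Config) (i : ℕ) : Measure Plane :=
  ∑ k ∈ Finset.range (c.num i), Measure.dirac (c.rx i k)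

/-- The realization seen from the point `v`: all positions are translated by `-v`. -/
def shift (v : Plane) (c : Config) : Config where
  bs j := c.bs j - v
  tx i := c.tx i - v
  num := c.num
  rx i k := c.rx i k - v
  coin := c.coin
  fadeD := c.fadeD
  fadeC := c.fadeC

end Config

/-- The counting measure `∑ i, δ_{p i}` of an enumerated point configuration. -/
def pointMeasure (p : ℕ → Plane) : Measure Plane := Measure.sum fun i => Measure.dirac (p i)

/-- The random points `p` form, under `P`, a homogeneous Poisson point process of intensity `lam`
on the plane: the number of points in a Borel set of finite area is Poisson distributed with mean
`lam` times the area, and the numbers of points in disjoint Borel sets are independent. -/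
structure IsPoissonProcess (P : Measure Config) (p : Config → ℕ → Plane) (lam : ℝ) : Prop where
  count_law : ∀ S : Set Plane, MeasurableSet S → volume S ≠ ∞ → ∀ n : ℕ,
    P {c | pointMeasure (p c) S = (n : ℝ≥0∞)} =
      ENNReal.ofReal (Real.exp (-(lam * (volume S).toReal)) * (lam * (volume S).toReal) ^ n /
        (n.factorial : ℝ))
  indep : ∀ (m : ℕ) (S : Fin m → Set Plane), (∀ a, MeasurableSet (S a)) →
    Pairwise (fun a b => Disjoint (S a) (S b)) →
    iIndepFun (fun a c => pointMeasure (p c) (S a)) P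

/-- `P` is the law of a network with parameters `p`. The condition `cluster_mean` says that,
conditionally on the transmitter positions, the receivers of transmitter `i` form a point process
with intensity measure `lamR` times Lebesgue measure on the ball of radius `R` around it; nothing
else is assumed about the law of the clusters, individually or jointly. -/
structure IsNetworkLaw (p : Params) (P : Measure Config) : Prop where
  bs_poisson : IsPoissonProcess P Config.bs p.lamB
  tx_poisson : IsPoissonProcess P Config.tx p.lamM
  cluster_mean : ∀ (i : ℕ) (S : Set Plane) (E : Set (ℕ → Plane)), MeasurableSet S →
    MeasurableSet E →
    ∫⁻ c in {c | c.tx ∈ E}, c.cluster i S ∂P =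
      ∫⁻ c in {c | c.tx ∈ E},
        ENNReal.ofReal p.lamR * volume (S ∩ Metric.closedBall (c.tx i) p.R) ∂P
  coin_law : ∀ i, P.map (fun c => c.coin i) = volume.restrict (Set.Icc (0 : ℝ) 1)
  fadeD_law : ∀ i k l n, P.map (fun c => c.fadeD i k l n) = expMeasure 1
  fadeC_law : ∀ i k j, P.map (fun c => c.fadeC i k j) = expMeasure 1
  coin_indep : iIndepFun (fun (i : ℕ) (c : Config) => c.coin i) P
  fadeD_indep : iIndepFun
    (fun (s : ℕ × ℕ × ℕ × ℕ) (c : Config) => c.fadeD s.1 s.2.1 s.2.2.1 s.2.2.2) P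
  fadeC_indep : iIndepFun (fun (s : ℕ × ℕ × ℕ) (c : Config) => c.fadeC s.1 s.2.1 s.2.2) P
  indep_bs : IndepFun Config.bs (fun c => (c.tx, c.num, c.rx)) P
  indep_positions : IndepFun (fun c => (c.bs, c.tx, c.num, c.rx))
    (fun c => (c.coin, c.fadeD, c.fadeC)) P
  indep_coin : IndepFun Config.coin (fun c => (c.fadeD, c.fadeC)) P
  indep_fade : IndepFun Config.fadeD Config.fadeC P

/-- The Palm measure of the law `P` with respect to the point process `pts` of intensity `lam`,
computed with the window `B`: the average, over the points in `B`, of the law of the network seen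
from the point. (`MulticastD2D.measurable_shift_bs` and `MulticastD2D.measurable_shift_tx` show
that the push-forwards are the honest ones for `pts = bs, tx`.) -/
def palm (P : Measure Config) (pts : Config → ℕ → Plane) (lam : ℝ) (B : Set Plane) :
    Measure Config :=
  (ENNReal.ofReal lam * volume B)⁻¹ •
    Measure.sum fun j =>
      (P.restrict {c | pts c j ∈ B}).map (fun c => c.shift (pts c j))

/-- The Voronoi cell of `z` with respect to the points `w j`. -/
def voronoiCell (w : ℕ → Plane) (z : Plane) : Set Plane := {x | ∀ j, ‖x - z‖ ≤ ‖x - w j‖}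

/-- The path loss `ℓ(r) = A r ^ α`. -/
def pathLoss (p : Params) (r : ℝ) : ℝ := p.A * r ^ p.α

/-- Received power `F / ℓ(r)`. -/
def rxPower (p : Params) (F r : ℝ) : ℝ≥0∞ := ENNReal.ofReal F / ENNReal.ofReal (pathLoss p r)

/-- SINR of the link from transmitter `i` to its `k`-th receiver in the `n`-th transmission. -/
def sinrD (p : Params) (c : Config) (i k n : ℕ) : ℝ≥0∞ :=
  rxPower p (c.fadeD i k i n) ‖c.rx i k - c.tx i‖ /
    (ENNReal.ofReal (p.noise / p.Pm) +
      ∑' l : ℕ, if l = i then 0 else rxPower p (c.fadeD i k l n) ‖c.tx l - c.rx i k‖)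

/-- SINR of the link from base station `j` to the `k`-th receiver of transmitter `i`, all other
base stations interfering. As everywhere in the analysis of network assistance, the distance of a
base station to a receiver is taken to be its distance to the transmitter of that receiver. -/
def sinrC (p : Params) (c : Config) (i k j : ℕ) : ℝ≥0∞ :=
  rxPower p (c.fadeC i k j) ‖c.bs j - c.tx i‖ /
    (ENNReal.ofReal (p.noise / p.Pb) +
      ∑' l : ℕ, if l = j then 0 else rxPower p (c.fadeC i k l) ‖c.bs l - c.tx i‖)

/-- The `k`-th receiver of transmitter `i` is covered by its transmitter. -/
def CoveredD (p : Params) (c : Config) (i k : ℕ) : Prop :=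
  ∃ n ∈ Finset.Icc 1 p.τ, ENNReal.ofReal p.T ≤ sinrD p c i k n

/-- Base station `j` serves transmitter `i` (it is a nearest one) and assists it under the rule
`g`: this happens with probability `g (distance)`, and exactly if `g (distance) = 1` (almost
surely) when `g` takes only the values `0` and `1`. -/
def Assists (g : ℝ → ℝ) (c : Config) (j i : ℕ) : Prop :=
  c.tx i ∈ voronoiCell c.bs (c.bs j) ∧ c.coin i < g ‖c.tx i - c.bs j‖

/-- The `k`-th receiver of transmitter `i` is covered by its transmitter or by an assisting
serving base station. -/
def Covered (p : Params) (g : ℝ → ℝ) (c : Config) (i k : ℕ) : Prop :=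
  CoveredD p c i k ∨ ∃ j, Assists g c j i ∧ ENNReal.ofReal p.T ≤ sinrC p c i k j

/-- Sum of `f i` over the transmitters `i` in the Voronoi cell of the origin. -/
def cellSum (c : Config) (f : ℕ → ℝ≥0∞) : ℝ≥0∞ := by
  classical exact ∑' i : ℕ, if c.tx i ∈ voronoiCell c.bs 0 then f i else 0

/-- Number of receivers `k` of transmitter `i` that satisfy `Q k`. -/
def countRx (c : Config) (i : ℕ) (Q : ℕ → Prop) : ℝ≥0∞ := by
  classical exact ∑ k ∈ Finset.range (c.num i), if Q k then 1 else 0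

/-- Number of receivers, of a transmitter at the origin, covered without network assistance. -/
def typicalClusterCovered (p : Params) (c : Config) : ℝ≥0∞ := by
  classical exact ∑' i : ℕ, if c.tx i = 0 then countRx c i (fun k => CoveredD p c i k) else 0

/-- Law of the Rayleigh variable `D` with density `2 π lam r exp(-lam π r²)`, `r ≥ 0`. -/
def rayleighLaw (lam : ℝ) : Measure ℝ :=
  (volume.restrict (Set.Ici (0 : ℝ))).withDensity fun r =>
    ENNReal.ofReal (2 * Real.pi * lam * r * Real.exp (-(lam * Real.pi * r ^ 2)))

/-- `K(α, n)`. -/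
def Kfun (α : ℝ) (n : ℕ) : ℝ :=
  2 * Real.pi / α * ∫ t in Set.Ioi (0 : ℝ), t ^ (-(2 / α) - 1) * (1 - 1 / (1 + t) ^ n)

/-- `H(T, α)`. -/
def Hfun (T α : ℝ) : ℝ := ∫ x in Set.Ioi (1 : ℝ), x / (1 + x ^ α / T)

/-- `N̄_max = λ_r π R²`. -/
def Nmax (p : Params) : ℝ := p.lamR * Real.pi * p.R ^ 2

/-- `N̄(τ)`. -/
def Nbar (p : Params) : ℝ :=
  2 * Real.pi * p.lamR * ∑ n ∈ Finset.Icc 1 p.τ, (-1 : ℝ) ^ (n + 1) * (p.τ.choose n : ℝ) *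
    ∫ r in (0 : ℝ)..p.R, r * Real.exp (-(n * p.T * (p.noise / p.Pm) * p.A * r ^ p.α)) *
      Real.exp (-(p.lamM * Kfun p.α n * p.T ^ (2 / p.α) * r ^ 2))

/-- `q(r)`. -/
def qfun (p : Params) (r : ℝ) : ℝ :=
  Real.exp (-(p.T * (p.noise / p.Pb) * p.A * r ^ p.α) -
    2 * Real.pi * p.lamB * Hfun p.T p.α * r ^ 2)

/-- `h(r; τ, γ)`. -/
def hfun (p : Params) (r γ : ℝ) : ℝ := Nbar p + γ * qfun p r * (Nmax p - Nbar p)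

theorem measurable_coords : Measurable Config.coords := comap_measurable _

theorem measurable_shift {v : Config → Plane} (hv : Measurable v) :
    Measurable fun c : Config => c.shift (v c) := by
  have hc := measurable_coords
  have h1 : Measurable fun c : Config => c.bs := hc.fst
  have h2 : Measurable fun c : Config => c.tx := hc.snd.fst
  have h3 : Measurable fun c : Config => c.num := hc.snd.snd.fst
  have h4 : Measurable fun c : Config => c.rx := hc.snd.snd.snd.fst
  have h5 : Measurable fun c : Config =>
    (c.coin, c.fadeD, c.fadeC) := hc.snd.snd.snd.snd
  refine measurable_comap_iff.2 ?_
  refine Measurable.prodMk (measurable_pi_lambda _ fun j => ?_) (Measurable.prodMk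
    (measurable_pi_lambda _ fun i => ?_) (Measurable.prodMk h3 (Measurable.prodMk
    (measurable_pi_lambda _ fun i => measurable_pi_lambda _ fun k => ?_) h5)))
  · exact ((measurable_pi_apply j).comp h1).sub hv
  · exact ((measurable_pi_apply i).comp h2).sub hv
  · exact ((measurable_pi_apply k).comp ((measurable_pi_apply i).comp h4)).sub hv

theorem measurable_shift_bs (j : ℕ) : Measurable fun c : Config => c.shift (c.bs j) :=
  measurable_shift ((measurable_pi_apply j).comp measurable_coords.fst)

theorem measurable_shift_tx (i : ℕ) : Measurable fun c : Config => c.shift (c.tx i) :=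
  measurable_shift ((measurable_pi_apply i).comp measurable_coords.snd.fst)

end MulticastD2D

end

/-! Unfold the Palm measure with the window `B`: each left side over stations becomes `(λ_b |B|)⁻¹`
times the mean of a double sum over stations `z` in `B` and transmitters `x` in the cell of `z`.
Coverage is translation invariant, so the shift disappears, and the two sums may be exchanged: for
each transmitter `x`, sum over the stations in `B` that serve it. Stations, coins and cellular
fading are independent of transmitters, receivers and D2D fading, so the station side can be
averaged first with `x` frozen.

Station side. A station at distance `r` from `x` serves `x` when no other station is nearer, which
costs `exp (-λ_b π r²)`. Given this, assistance has probability `g r`, and a receiver is reached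
with probability `q r`: noise and interference enter through the tail of the exponential signal, and
the interference beyond `r` contributes `exp (-2π λ_b H r²)`. The station side thus equals a weight
`W_f x = λ_b ∫_{z ∈ B} f |z - x| exp (-λ_b π |z - x|²) dz`, with `f = 1` or `f = g q`
(`lintegral_served`, `lintegral_served_reached`). Integrating over `x` and using translation
invariance gives `|B| E f(D)` (`lintegral_servedMass`). With `f = g` and Campbell's formula for the
transmitters this is already the first identity.

Transmitter side. A receiver counts with weight `W_1` if its transmitter covers it and with weight
`W_{gq}` otherwise. Given the transmitters, one transmission over a displacement `w` succeeds with
some probability `S`, and the `τ` attempts are conditionally independent, so coverage has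
probability `1 - (1 - S)^τ`. Expanding in powers of `S` and computing each moment by a
Slivnyak–Mecke formula gives `N̄`; the uncovered receivers have mean `N̄_max - N̄`
(`lintegral_tsum_coveredD`). Only means of sums are needed, which is why the cluster intensity alone
enters. Adding both contributions gives `h`.

The engine is the Slivnyak–Mecke formula for functionals `∑_i φ(x_i) ∏_{l ≠ i} u(x_i, x_l)` with `u
≤ 1`. It is derived from the Poisson counts: for step functions the functional depends only on
counts in finitely many disjoint sets, where it reduces to the identity `E [N x^(N-1)] = m exp (-m
(1 - x))`. General kernels are reached by decreasing limits, under which infinite products of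
numbers in `[0, 1]` are continuous (`campbell_simple`, `campbell_const`, `campbell_antitone`). -/

namespace MulticastD2D

open Filter Topology

/-! ### The exponential and infinite products on `[0, ∞]` -/

/-- The function `t ↦ exp (-t)` on `[0, ∞]`. -/
noncomputable def expNeg (t : ℝ≥0∞) : ℝ≥0∞ := EReal.exp (-(t : EReal))

theorem continuous_expNeg : Continuous expNeg :=
  ENNReal.continuous_exp.comp (continuous_neg.comp continuous_coe_ennreal_ereal)

@[fun_prop]
theorem measurable_expNeg : Measurable expNeg := continuous_expNeg.measurable

theorem expNeg_zero : expNeg 0 = 1 := by simp [expNeg]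

theorem expNeg_top : expNeg ∞ = 0 := by simp [expNeg]

theorem expNeg_ofReal {x : ℝ} (hx : 0 ≤ x) :
    expNeg (ENNReal.ofReal x) = ENNReal.ofReal (Real.exp (-x)) := by
  rw [expNeg, EReal.coe_ennreal_ofReal, max_eq_left hx, ← EReal.coe_neg, EReal.exp_coe]

theorem expNeg_add (s t : ℝ≥0∞) : expNeg (s + t) = expNeg s * expNeg t := by
  rw [expNeg, EReal.coe_ennreal_add, EReal.neg_add, sub_eq_add_neg, EReal.exp_add]
  · rfl
  · exact Or.inl (EReal.coe_ennreal_ne_bot s)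
  · exact Or.inr (EReal.coe_ennreal_ne_bot t)

theorem antitone_expNeg : Antitone expNeg := fun _ _ h =>
  EReal.exp_monotone (EReal.neg_le_neg_iff.2 (EReal.coe_ennreal_le_coe_ennreal_iff.2 h))

theorem expNeg_le_one (t : ℝ≥0∞) : expNeg t ≤ 1 := by
  rw [← expNeg_zero]; exact antitone_expNeg zero_le

theorem expNeg_sum {ι : Type*} (s : Finset ι) (f : ι → ℝ≥0∞) :
    expNeg (∑ i ∈ s, f i) = ∏ i ∈ s, expNeg (f i) := by
  classical
  induction s using Finset.induction_on with
  | empty => simp [expNeg_zero]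
  | insert a s ha ih => rw [Finset.sum_insert ha, Finset.prod_insert ha, expNeg_add, ih]

theorem expNeg_iSup {f : ℕ → ℝ≥0∞} (hf : Monotone f) : expNeg (⨆ n, f n) = ⨅ n, expNeg (f n) :=
  tendsto_nhds_unique ((continuous_expNeg.tendsto _).comp (tendsto_atTop_iSup hf))
    (tendsto_atTop_iInf (antitone_expNeg.comp_monotone hf))

/-- The infinite product of numbers in `[0, 1]`. -/
noncomputable def infProd (f : ℕ → ℝ≥0∞) : ℝ≥0∞ := ⨅ N, ∏ l ∈ Finset.range N, f l

theorem antitone_prod_range {f : ℕ → ℝ≥0∞} (hf : ∀ l, f l ≤ 1) :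
    Antitone fun N => ∏ l ∈ Finset.range N, f l :=
  antitone_nat_of_succ_le fun n => by
    rw [Finset.prod_range_succ]
    exact mul_le_of_le_one_right' (hf n)

theorem tendsto_infProd {f : ℕ → ℝ≥0∞} (hf : ∀ l, f l ≤ 1) :
    Tendsto (fun N => ∏ l ∈ Finset.range N, f l) atTop (𝓝 (infProd f)) :=
  tendsto_atTop_iInf (antitone_prod_range hf)

theorem infProd_le_one (f : ℕ → ℝ≥0∞) : infProd f ≤ 1 := by
  exact (iInf_le (fun N => ∏ l ∈ Finset.range N, f l) 0).trans (by simp)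

theorem infProd_ne_top (f : ℕ → ℝ≥0∞) : infProd f ≠ ∞ :=
  ((infProd_le_one f).trans_lt ENNReal.one_lt_top).ne

theorem infProd_mono {f g : ℕ → ℝ≥0∞} (h : ∀ l, f l ≤ g l) : infProd f ≤ infProd g :=
  iInf_mono fun _ => Finset.prod_le_prod' fun l _ => h l

theorem infProd_mul {f g : ℕ → ℝ≥0∞} (hf : ∀ l, f l ≤ 1) (hg : ∀ l, g l ≤ 1) :
    infProd (fun l => f l * g l) = infProd f * infProd g := by
  refine tendsto_nhds_unique (tendsto_infProd fun l => mul_le_one' (hf l) (hg l)) ?_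
  simp_rw [Finset.prod_mul_distrib]
  exact ENNReal.Tendsto.mul (tendsto_infProd hf) (Or.inr (infProd_ne_top g)) (tendsto_infProd hg)
    (Or.inr (infProd_ne_top f))

theorem infProd_one : infProd (fun _ => 1) = 1 := by simp [infProd]

theorem infProd_finset_prod {ι : Type*} (s : Finset ι) {f : ι → ℕ → ℝ≥0∞}
    (hf : ∀ a l, f a l ≤ 1) :
    infProd (fun l => ∏ a ∈ s, f a l) = ∏ a ∈ s, infProd (f a) := by
  classical
  induction s using Finset.induction_on with
  | empty => simp [infProd_one]
  | insert a s ha ih =>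
    simp_rw [Finset.prod_insert ha]
    rw [infProd_mul (hf a) fun l => Finset.prod_le_one' fun b _ => hf b l, ih]

theorem infProd_pow {f : ℕ → ℝ≥0∞} (hf : ∀ l, f l ≤ 1) (n : ℕ) :
    infProd (fun l => f l ^ n) = infProd f ^ n := by
  have := infProd_finset_prod (Finset.range n) (f := fun _ => f) fun _ => hf
  simpa using this

/-- An infinite product is itself an infimum of finite products and infima commute, so only finite
products have to pass to the limit. This continuity holds along decreasing sequences, which is why
every later approximation of a kernel is from above. -/
theorem infProd_iInf {f : ℕ → ℕ → ℝ≥0∞} (hf : ∀ n l, f n l ≤ 1) (ha : ∀ l, Antitone fun n => f n l) :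
    infProd (fun l => ⨅ n, f n l) = ⨅ n, infProd (f n) := by
  unfold infProd
  rw [iInf_comm]
  refine iInf_congr fun N => ?_
  refine tendsto_nhds_unique (f := fun n => ∏ l ∈ Finset.range N, f n l) (l := atTop) ?_ ?_
  · induction N with
    | zero => simp
    | succ N ih =>
      simp_rw [Finset.prod_range_succ]
      have h1 : ∏ l ∈ Finset.range N, ⨅ n, f n l ≤ 1 :=
        Finset.prod_le_one' fun l _ => (iInf_le _ 0).trans (hf 0 l)
      exact ENNReal.Tendsto.mul ih
        (Or.inr ((iInf_le _ 0).trans_lt ((hf 0 N).trans_lt ENNReal.one_lt_top)).ne)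
        (tendsto_atTop_iInf (ha N)) (Or.inr (h1.trans_lt ENNReal.one_lt_top).ne)
  · exact tendsto_atTop_iInf fun m n h => Finset.prod_le_prod' fun l _ => ha l h

theorem infProd_ite_mem {L : Set ℕ} (hL : L.Finite) {x : ℝ≥0∞} (hx : x ≤ 1)
    [DecidablePred (· ∈ L)] :
    infProd (fun l => if l ∈ L then x else 1) = x ^ L.ncard := by
  obtain ⟨M, hM⟩ := hL.bddAbove
  refine tendsto_nhds_unique (tendsto_infProd fun l => by split_ifs <;> simp [hx]) ?_
  refine tendsto_const_nhds.congr' ?_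
  filter_upwards [eventually_gt_atTop M] with N hN
  rw [Finset.prod_ite, Finset.prod_const_one, mul_one, Finset.prod_const]
  congr 1
  rw [← Set.ncard_coe_finset]
  congr 1
  ext l
  simp only [Finset.coe_filter, Finset.mem_range, Set.mem_ofPred_eq]
  exact ⟨fun h => ⟨(hM h).trans_lt hN, h⟩, fun h => h.2⟩

theorem measurable_infProd {Ω : Type*} [MeasurableSpace Ω] {f : ℕ → Ω → ℝ≥0∞}
    (hf : ∀ l, Measurable (f l)) : Measurable fun ω => infProd fun l => f l ω :=
  Measurable.iInf fun _ => Finset.measurable_prod _ fun l _ => hf l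

theorem expNeg_ne_top (t : ℝ≥0∞) : expNeg t ≠ ∞ :=
  ((expNeg_le_one t).trans_lt ENNReal.one_lt_top).ne

/-! ### Poisson weights and counting measures -/

/-- The Poisson weights with mean `m`. -/
noncomputable def poissonWeight (m : ℝ) (n : ℕ) : ℝ≥0∞ :=
  ENNReal.ofReal (Real.exp (-m) * m ^ n / (n.factorial : ℝ))

theorem tsum_pow_mul_poissonWeight {m : ℝ} (hm : 0 ≤ m) {x : ℝ≥0∞} (hx : x ≤ 1) :
    ∑' n, x ^ n * poissonWeight m n = expNeg (ENNReal.ofReal m * (1 - x)) := by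
  have hxt : x ≠ ∞ := (hx.trans_lt ENNReal.one_lt_top).ne
  obtain ⟨y, hy, rfl⟩ : ∃ y : ℝ, 0 ≤ y ∧ x = ENNReal.ofReal y :=
    ⟨x.toReal, ENNReal.toReal_nonneg, (ENNReal.ofReal_toReal hxt).symm⟩
  have hy1 : y ≤ 1 := by simpa using hx
  have hs : HasSum (fun n : ℕ => Real.exp (-m) * ((y * m) ^ n / (n.factorial : ℝ)))
      (Real.exp (-m) * Real.exp (y * m)) := by
    rw [Real.exp_eq_exp_ℝ]
    exact (NormedSpace.expSeries_div_hasSum_exp (y * m)).mul_left _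
  have h1 : ∀ n, ENNReal.ofReal y ^ n * poissonWeight m n =
      ENNReal.ofReal (Real.exp (-m) * ((y * m) ^ n / (n.factorial : ℝ))) := fun n => by
    rw [poissonWeight, ← ENNReal.ofReal_pow hy, ← ENNReal.ofReal_mul (by positivity), mul_pow]
    congr 1; ring
  simp_rw [h1]
  rw [← ENNReal.ofReal_tsum_of_nonneg (fun n => by positivity) hs.summable, hs.tsum_eq,
    ← Real.exp_add, ← ENNReal.ofReal_one, ← ENNReal.ofReal_sub _ hy, ← ENNReal.ofReal_mul hm,
    expNeg_ofReal (mul_nonneg hm (by linarith))]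
  congr 2; ring

theorem tsum_poissonWeight {m : ℝ} (hm : 0 ≤ m) : ∑' n, poissonWeight m n = 1 := by
  simpa [expNeg_zero] using tsum_pow_mul_poissonWeight hm le_rfl

/-- The size-biased Poisson law is the Poisson law shifted by one: `n · weight n = m · weight (n -
1)`. The term `n = 0` vanishes, so the truncated exponent `0 - 1` does no harm. -/
theorem tsum_mul_pow_pred_mul_poissonWeight {m : ℝ} (hm : 0 ≤ m) {x : ℝ≥0∞} (hx : x ≤ 1) :
    ∑' n : ℕ, (n : ℝ≥0∞) * x ^ (n - 1) * poissonWeight m n =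
      ENNReal.ofReal m * expNeg (ENNReal.ofReal m * (1 - x)) := by
  rw [← tsum_pow_mul_poissonWeight hm hx, ← ENNReal.tsum_mul_left, tsum_eq_zero_add' (by simp)]
  simp only [Nat.cast_zero, zero_mul, zero_add, Nat.add_sub_cancel]
  refine tsum_congr fun n => ?_
  have : ((n + 1 : ℕ) : ℝ≥0∞) * poissonWeight m (n + 1) =
      ENNReal.ofReal m * poissonWeight m n := by
    rw [poissonWeight, poissonWeight, ← ENNReal.ofReal_natCast, ← ENNReal.ofReal_mul (by positivity),
      ← ENNReal.ofReal_mul hm, Nat.factorial_succ]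
    congr 1
    push_cast
    field_simp
    ring
  calc _ = x ^ n * (((n + 1 : ℕ) : ℝ≥0∞) * poissonWeight m (n + 1)) := by ring
    _ = _ := by rw [this]; ring

theorem pointMeasure_apply (w : ℕ → Plane) {S : Set Plane} (hS : MeasurableSet S) :
    pointMeasure w S = ∑' i, S.indicator 1 (w i) := by
  rw [pointMeasure, Measure.sum_apply _ hS]
  exact tsum_congr fun i => Measure.dirac_apply' _ hS

theorem pointMeasure_eq_encard (w : ℕ → Plane) {S : Set Plane} (hS : MeasurableSet S) :
    pointMeasure w S = {i | w i ∈ S}.encard := by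
  rw [pointMeasure_apply w hS, ← ENNReal.tsum_set_one,
    tsum_subtype {i | w i ∈ S} fun _ => (1 : ℝ≥0∞)]
  rfl

theorem measurable_pointMeasure {p : Config → ℕ → Plane} (hp : ∀ i, Measurable fun c => p c i)
    {S : Set Plane} (hS : MeasurableSet S) : Measurable fun c => pointMeasure (p c) S := by
  simp_rw [pointMeasure_apply _ hS]
  exact Measurable.tsum fun i => (measurable_one.indicator hS).comp (hp i)

theorem lintegral_finset_prod_of_iIndepFun {Ω ι : Type*} [MeasurableSpace Ω] {P : Measure Ω}
    [IsProbabilityMeasure P] {f : ι → Ω → ℝ≥0∞} (hf : ∀ i, Measurable (f i)) (h : iIndepFun f P)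
    (s : Finset ι) : ∫⁻ ω, ∏ i ∈ s, f i ω ∂P = ∏ i ∈ s, ∫⁻ ω, f i ω ∂P := by
  classical
  induction s using Finset.induction_on with
  | empty => simp
  | insert a s ha ih =>
    simp_rw [Finset.prod_insert ha]
    rw [← ih]
    have hi := (h.indepFun_finsetProd_of_notMem hf ha).symm
    have := lintegral_mul_eq_lintegral_mul_lintegral_of_indepFun (hf a)
      (Finset.measurable_prod s fun i _ => hf i) (by convert hi using 1; ext; simp)
    simpa using this

/-! ### The Slivnyak–Mecke formula for step functions -/

section Poisson

variable {P : Measure Config} [IsProbabilityMeasure P] {p : Config → ℕ → Plane} {lam : ℝ}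

/-- The Poisson weights sum to `1`, so no mass is left for an infinite count. -/
theorem IsPoissonProcess.ae_count (h : IsPoissonProcess P p lam)
    (hp : ∀ i, Measurable fun c => p c i) (hl : 0 ≤ lam) {S : Set Plane} (hS : MeasurableSet S)
    (hv : volume S ≠ ∞) : ∀ᵐ c ∂P, ∃ n : ℕ, pointMeasure (p c) S = n := by
  have hm := measurable_pointMeasure hp hS
  have hset : ∀ n : ℕ, MeasurableSet {c | pointMeasure (p c) S = (n : ℝ≥0∞)} := fun n =>
    hm (measurableSet_singleton _)
  have : {c | ∃ n : ℕ, pointMeasure (p c) S = n} = ⋃ n : ℕ, {c | pointMeasure (p c) S = n} := by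
    ext; simp
  have hms : MeasurableSet {c | ∃ n : ℕ, pointMeasure (p c) S = n} := by
    rw [this]; exact MeasurableSet.iUnion hset
  refine (mem_ae_iff_prob_eq_one hms).2 ?_
  rw [this, measure_iUnion _ hset]
  · simp_rw [h.count_law S hS hv]
    exact tsum_poissonWeight (mul_nonneg hl ENNReal.toReal_nonneg)
  · intro m n hmn
    refine Set.disjoint_left.2 fun c h1 h2 => hmn ?_
    have h3 : pointMeasure (p c) S = m := h1
    have h4 : pointMeasure (p c) S = n := h2
    exact_mod_cast h3.symm.trans h4

theorem IsPoissonProcess.lintegral_count (h : IsPoissonProcess P p lam)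
    (hp : ∀ i, Measurable fun c => p c i) (hl : 0 ≤ lam) {S : Set Plane} (hS : MeasurableSet S)
    (hv : volume S ≠ ∞) (f : ℝ≥0∞ → ℝ≥0∞) :
    ∫⁻ c, f (pointMeasure (p c) S) ∂P =
      ∑' n : ℕ, f n * poissonWeight (lam * (volume S).toReal) n := by
  have hm := measurable_pointMeasure hp hS
  have hset : ∀ n : ℕ, MeasurableSet {c | pointMeasure (p c) S = (n : ℝ≥0∞)} := fun n =>
    hm (measurableSet_singleton _)
  have h1 : ∀ᵐ c ∂P, f (pointMeasure (p c) S) =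
      ∑' n : ℕ, {c | pointMeasure (p c) S = (n : ℝ≥0∞)}.indicator (fun _ => f n) c := by
    filter_upwards [h.ae_count hp hl hS hv] with c ⟨n, hn⟩
    rw [tsum_eq_single n]
    · simp [hn]
    · intro m hmn
      refine Set.indicator_of_notMem (fun hc => hmn ?_) _
      have h3 : pointMeasure (p c) S = m := hc
      exact_mod_cast h3.symm.trans hn
  rw [lintegral_congr_ae h1, lintegral_tsum fun n =>
    (measurable_const.indicator (hset n)).aemeasurable]
  refine tsum_congr fun n => ?_
  rw [lintegral_indicator (hset n), setLIntegral_const, h.count_law S hS hv]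
  rfl

theorem IsPoissonProcess.lintegral_prod_count (h : IsPoissonProcess P p lam)
    (hp : ∀ i, Measurable fun c => p c i) {κ : Type*} [Fintype κ]
    {S : κ → Set Plane} (hS : ∀ a, MeasurableSet (S a))
    (hd : Pairwise fun a b => Disjoint (S a) (S b)) {f : κ → ℝ≥0∞ → ℝ≥0∞}
    (hf : ∀ a, Measurable (f a)) :
    ∫⁻ c, ∏ a, f a (pointMeasure (p c) (S a)) ∂P =
      ∏ a, ∫⁻ c, f a (pointMeasure (p c) (S a)) ∂P := by
  have h1 := h.indep _ (fun k => S ((Fintype.equivFin κ).symm k)) (fun k => hS _)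
    (fun a b hab => hd ((Fintype.equivFin κ).symm.injective.ne hab))
  have h2 := h1.precomp (Fintype.equivFin κ).injective
  simp only [Equiv.symm_apply_apply] at h2
  exact lintegral_finset_prod_of_iIndepFun
    (fun a => (hf a).comp (measurable_pointMeasure hp (hS a))) (h2.comp f hf) _

/-- Removing a point of `S a₀` lowers the count of `S a₀` by one and changes no other count, since
the sets are disjoint. The sum over `i` is therefore `N x^(N-1)` for the set `S a₀` times the
product of `x a ^ N a` over the other sets. The counts are independent, and the two Poisson
generating identities evaluate the factors. -/
theorem IsPoissonProcess.campbell_simple (h : IsPoissonProcess P p lam)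
    (hp : ∀ i, Measurable fun c => p c i) (hl : 0 ≤ lam) {κ : Type*} [Fintype κ] [DecidableEq κ]
    {S : κ → Set Plane} [∀ a, DecidablePred (· ∈ S a)] (hS : ∀ a, MeasurableSet (S a))
    (hv : ∀ a, volume (S a) ≠ ∞)
    (hd : Pairwise fun a b => Disjoint (S a) (S b)) {x : κ → ℝ≥0∞} (hx : ∀ a, x a ≤ 1) (a₀ : κ) :
    ∫⁻ c, ∑' i, (S a₀).indicator 1 (p c i) *
        infProd (fun l => if l = i then 1 else ∏ a, if p c l ∈ S a then x a else 1) ∂P =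
      ENNReal.ofReal lam * volume (S a₀) *
        expNeg (ENNReal.ofReal lam * ∑ a, volume (S a) * (1 - x a)) := by
  -- Counts take values in `[0, ∞]`; the floor recovers the exponent when the count is a natural
  -- number, which is almost surely the case. For count `0` the factor `t` makes the truncated
  -- exponent irrelevant.
  let f : κ → ℝ≥0∞ → ℝ≥0∞ := fun a t =>
    if a = a₀ then t * x a ^ (⌊t.toReal⌋₊ - 1) else x a ^ ⌊t.toReal⌋₊
  have hfm : ∀ a, Measurable (f a) := fun a => by
    have h1 : Measurable fun t : ℝ≥0∞ => ⌊t.toReal⌋₊ := Nat.measurable_floor.comp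
      ENNReal.measurable_toReal
    by_cases ha : a = a₀
    · simp only [f, ha, if_true]
      exact measurable_id.mul ((measurable_from_top (f := fun n : ℕ => x a₀ ^ (n - 1))).comp h1)
    · simp only [f, ha, if_false]
      exact (measurable_from_top (f := fun n : ℕ => x a ^ n)).comp h1
  have key : ∀ᵐ c ∂P, ∑' i, (S a₀).indicator 1 (p c i) *
      infProd (fun l => if l = i then 1 else ∏ a, if p c l ∈ S a then x a else 1) =
      ∏ a, f a (pointMeasure (p c) (S a)) := by
    have h1 : ∀ᵐ c ∂P, ∀ a, ∃ n : ℕ, pointMeasure (p c) (S a) = n :=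
      ae_all_iff.2 fun a => h.ae_count hp hl (hS a) (hv a)
    filter_upwards [h1] with c hc
    have hfin : ∀ a, {i | p c i ∈ S a}.Finite := fun a => by
      obtain ⟨n, hn⟩ := hc a
      rw [pointMeasure_eq_encard _ (hS a)] at hn
      exact Set.finite_of_encard_eq_coe (k := n) (by exact_mod_cast hn)
    have hcard : ∀ a, pointMeasure (p c) (S a) = ({i | p c i ∈ S a}.ncard : ℝ≥0∞) := fun a => by
      rw [pointMeasure_eq_encard _ (hS a), ← (hfin a).cast_ncard_eq]
      simp
    have hf : ∀ a, f a (pointMeasure (p c) (S a)) = (if a = a₀ then pointMeasure (p c) (S a)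
        else 1) * x a ^ ({i | p c i ∈ S a}.ncard - if a = a₀ then 1 else 0) := fun a => by
      rw [hcard]
      by_cases ha : a = a₀ <;> simp [f, ha]
    have hterm : ∀ i, (S a₀).indicator (1 : Plane → ℝ≥0∞) (p c i) *
        infProd (fun l => if l = i then 1 else ∏ a, if p c l ∈ S a then x a else 1) =
        (S a₀).indicator (1 : Plane → ℝ≥0∞) (p c i) *
          ∏ a, x a ^ ({i | p c i ∈ S a}.ncard - if a = a₀ then 1 else 0) := fun i => by
      by_cases hi : p c i ∈ S a₀
      · congr 1
        have e1 : (fun l => if l = i then 1 else ∏ a, if p c l ∈ S a then x a else 1) =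
            fun l => ∏ a, if l ∈ {l | p c l ∈ S a} \ {i} then x a else 1 := by
          ext l
          by_cases hl : l = i <;> simp [hl]
        rw [e1, infProd_finset_prod _ fun a l => by split_ifs <;> simp [hx a]]
        refine Finset.prod_congr rfl fun a _ => ?_
        rw [infProd_ite_mem ((hfin a).sdiff) (hx a)]
        congr 1
        by_cases ha : a = a₀
        · subst ha
          rw [if_pos rfl]
          exact Set.ncard_sdiff_singleton_of_mem hi
        · rw [if_neg ha, Nat.sub_zero, Set.sdiff_singleton_eq_self]
          exact fun hia => Set.disjoint_left.1 (hd ha) hia hi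
      · simp [hi]
    simp_rw [hterm]
    rw [ENNReal.tsum_mul_right, ← pointMeasure_apply _ (hS a₀)]
    simp_rw [hf]
    rw [Finset.prod_mul_distrib, Finset.prod_ite_eq' ]
    simp
  rw [lintegral_congr_ae key, h.lintegral_prod_count hp hS hd hfm]
  have hval : ∀ a, ∫⁻ c, f a (pointMeasure (p c) (S a)) ∂P =
      (if a = a₀ then ENNReal.ofReal lam * volume (S a) else 1) *
        expNeg (ENNReal.ofReal lam * (volume (S a) * (1 - x a))) := fun a => by
    have hm : 0 ≤ lam * (volume (S a)).toReal := mul_nonneg hl ENNReal.toReal_nonneg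
    have hm' : ENNReal.ofReal (lam * (volume (S a)).toReal) = ENNReal.ofReal lam * volume (S a) := by
      rw [ENNReal.ofReal_mul hl, ENNReal.ofReal_toReal (hv a)]
    rw [h.lintegral_count hp hl (hS a) (hv a)]
    by_cases ha : a = a₀
    · simp only [f, ha, if_true, ENNReal.toReal_natCast, Nat.floor_natCast]
      rw [ha] at hm hm'
      rw [tsum_mul_pow_pred_mul_poissonWeight hm (hx a₀), hm', mul_assoc (ENNReal.ofReal lam)]
      simp only [mul_assoc]
    · simp only [f, ha, if_false, ENNReal.toReal_natCast, Nat.floor_natCast, one_mul]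
      rw [tsum_pow_mul_poissonWeight hm (hx a), hm', mul_assoc]
  simp_rw [hval]
  rw [Finset.prod_mul_distrib, Finset.prod_ite_eq', Finset.mul_sum, expNeg_sum]
  simp

end Poisson

/-! ### The Slivnyak–Mecke formula for general kernels -/

/-- Reading the sum as an integral against counting measure turns this into monotone convergence for
decreasing sequences on a product space; the finiteness of the first term is what that theorem
requires. -/
theorem lintegral_tsum_iInf {Ω : Type*} [MeasurableSpace Ω] {P : Measure Ω} [SFinite P]
    {F : ℕ → ℕ → Ω → ℝ≥0∞} (hF : ∀ n i, Measurable (F n i)) (ha : ∀ i c, Antitone fun n => F n i c)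
    (h0 : ∫⁻ c, ∑' i, F 0 i c ∂P ≠ ∞) :
    ∫⁻ c, ∑' i, ⨅ n, F n i c ∂P = ⨅ n, ∫⁻ c, ∑' i, F n i c ∂P := by
  have key : ∀ G : ℕ → Ω → ℝ≥0∞, (∀ i, Measurable (G i)) → Measurable (fun z : Ω × ℕ => G z.2 z.1) ∧
      ∫⁻ c, ∑' i, G i c ∂P = ∫⁻ z, G z.2 z.1 ∂(P.prod Measure.count) := fun G hG => by
    have hm : Measurable fun z : Ω × ℕ => G z.2 z.1 := measurable_from_prod_countable_left hG
    refine ⟨hm, ?_⟩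
    rw [lintegral_prod _ hm.aemeasurable]
    simp_rw [lintegral_count]
  rw [(key _ fun i => Measurable.iInf fun n => hF n i).2]
  simp_rw [fun n => (key _ (hF n)).2] at h0 ⊢
  exact lintegral_iInf (fun n => (key _ (hF n)).1) (fun m n h z => ha z.2 z.1 h) h0

/-- The product of the values of `v` over all points but the `i`-th one. -/
noncomputable def prodOthers (v : Plane → ℝ≥0∞) (w : ℕ → Plane) (i : ℕ) : ℝ≥0∞ :=
  infProd fun l => if l = i then 1 else v (w l)

theorem prodOthers_le_one (v : Plane → ℝ≥0∞) (w : ℕ → Plane) (i : ℕ) : prodOthers v w i ≤ 1 :=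
  infProd_le_one _

theorem prodOthers_mono {u v : Plane → ℝ≥0∞} (h : ∀ y, u y ≤ v y) (w : ℕ → Plane) (i : ℕ) :
    prodOthers u w i ≤ prodOthers v w i :=
  infProd_mono fun l => by split_ifs; exacts [le_rfl, h _]

theorem prodOthers_pow {v : Plane → ℝ≥0∞} (hv : ∀ y, v y ≤ 1) (w : ℕ → Plane) (i n : ℕ) :
    prodOthers (fun y => v y ^ n) w i = prodOthers v w i ^ n := by
  rw [prodOthers, prodOthers, ← infProd_pow fun l => by split_ifs; exacts [le_rfl, hv _]]
  congr 1 with l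
  split_ifs <;> simp

theorem prodOthers_iInf {v : ℕ → Plane → ℝ≥0∞} (hv : ∀ n y, v n y ≤ 1)
    (ha : ∀ y, Antitone fun n => v n y) (w : ℕ → Plane) (i : ℕ) :
    prodOthers (fun y => ⨅ n, v n y) w i = ⨅ n, prodOthers (v n) w i := by
  unfold prodOthers
  rw [← infProd_iInf]
  · congr 1 with l
    split_ifs <;> simp
  · intro n l
    split_ifs; exacts [le_rfl, hv n _]
  · intro l m n h
    dsimp only
    split_ifs; exacts [le_rfl, ha _ h]

section Poisson

variable {P : Measure Config} [IsProbabilityMeasure P] {p : Config → ℕ → Plane} {lam : ℝ}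

theorem measurable_prodOthers (hp : ∀ i, Measurable fun c => p c i) {v : Plane → ℝ≥0∞}
    (hv : Measurable v) (i : ℕ) : Measurable fun c => prodOthers v (p c) i :=
  measurable_infProd fun l => by
    split_ifs
    exacts [measurable_const, hv.comp (hp l)]

/-- Since `v` is constant on `A`, the set `A` and the level sets of `v` cut by the complement of `A`
form a finite disjoint family to which `campbell_simple` applies. -/
theorem IsPoissonProcess.campbell_const_on (h : IsPoissonProcess P p lam)
    (hp : ∀ i, Measurable fun c => p c i) (hl : 0 ≤ lam) (v : SimpleFunc Plane ℝ≥0∞)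
    (hv : ∀ y, v y ≤ 1) (hfin : volume (v ⁻¹' {1}ᶜ) ≠ ∞) {A : Set Plane} (hA : MeasurableSet A)
    (hAv : volume A ≠ ∞) {w : ℝ≥0∞} (hw : w ≤ 1) (hAw : ∀ y ∈ A, v y = w) :
    ∫⁻ c, ∑' i, A.indicator 1 (p c i) * prodOthers v (p c) i ∂P =
      ENNReal.ofReal lam * volume A * expNeg (ENNReal.ofReal lam * ∫⁻ y, 1 - v y) := by
  classical
  -- The level `1` is left out: its level set may have infinite area, and it changes neither the
  -- product nor the integral of `1 - v`.
  let κ := {x // x ∈ v.range.erase 1}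
  let S : Option κ → Set Plane := fun a => a.elim A fun x => v ⁻¹' {x.1} \ A
  let x : Option κ → ℝ≥0∞ := fun a => a.elim w fun x => x.1
  have hS : ∀ a, MeasurableSet (S a) := by
    rintro (_ | a)
    · exact hA
    · exact (v.measurableSet_preimage _).diff hA
  have hvol : ∀ a, volume (S a) ≠ ∞ := by
    rintro (_ | a)
    · exact hAv
    · refine measure_ne_top_of_subset (Set.sdiff_subset.trans ?_) hfin
      intro y hy
      have h1 : v y = a.1 := hy
      have h2 := (Finset.mem_erase.1 a.2).1
      simpa [h1] using h2
  have hd : Pairwise fun a b => Disjoint (S a) (S b) := by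
    rintro (_ | a) (_ | b) hab
    · exact absurd rfl hab
    · exact Set.disjoint_left.2 fun y h1 h2 => h2.2 h1
    · exact Set.disjoint_left.2 fun y h1 h2 => h1.2 h2
    · refine Set.disjoint_left.2 fun y h1 h2 => hab ?_
      have e1 : v y = a.1 := h1.1
      have e2 : v y = b.1 := h2.1
      rw [Subtype.ext (e1.symm.trans e2)]
  have hx : ∀ a, x a ≤ 1 := by
    rintro (_ | a)
    · exact hw
    · obtain ⟨y, hy⟩ := SimpleFunc.mem_range.1 (Finset.mem_of_mem_erase a.2)
      exact (hy ▸ hv y : a.1 ≤ 1)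
  have hmem : ∀ y, v y ≠ 1 → v y ∈ v.range.erase 1 := fun y hy =>
    Finset.mem_erase.2 ⟨hy, v.mem_range_self y⟩
  have hprod : ∀ y, v y = ∏ a, if y ∈ S a then x a else 1 := by
    intro y
    rw [Fintype.prod_option]
    by_cases hy : y ∈ A
    · simp [S, x, hy, hAw y hy]
    · simp only [S, x, Option.elim, hy, if_false, one_mul, Set.mem_sdiff, not_false_eq_true,
        and_true, Set.mem_preimage, Set.mem_singleton_iff]
      by_cases h1 : v y = 1
      · rw [Finset.prod_eq_one, h1]
        intro a _
        split_ifs with h2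
        · exact h2.symm.trans h1
        · rfl
      · rw [Finset.prod_eq_single (⟨v y, hmem y h1⟩ : κ)]
        · simp
        · intro b _ hb
          rw [if_neg]
          exact fun h2 => hb (Subtype.ext h2.symm)
        · simp
  have hsum : ∫⁻ y, 1 - v y = ∑ a, volume (S a) * (1 - x a) := by
    have : ∀ y, 1 - v y = ∑ a, (S a).indicator (fun _ => 1 - x a) y := by
      intro y
      rw [Fintype.sum_option]
      by_cases hy : y ∈ A
      · simp [S, x, hy, hAw y hy]
      · simp only [S, x, Option.elim, hy, not_false_eq_true, Set.indicator_of_notMem, zero_add]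
        by_cases h1 : v y = 1
        · rw [Finset.sum_eq_zero, h1, tsub_self]
          intro a _
          by_cases h2 : v y = a.1
          · exact absurd (h2.symm.trans h1) (Finset.mem_erase.1 a.2).1
          · exact Set.indicator_of_notMem (fun h3 => h2 h3.1) _
        · rw [Finset.sum_eq_single (⟨v y, hmem y h1⟩ : κ)]
          · rw [Set.indicator_of_mem]
            exact ⟨rfl, hy⟩
          · intro b _ hb
            refine Set.indicator_of_notMem (fun h3 => hb (Subtype.ext ?_)) _
            exact (h3.1 : v y = b.1).symm
          · simp
    simp_rw [this]
    rw [lintegral_finsetSum _ fun a _ => measurable_const.indicator (hS a)]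
    refine Finset.sum_congr rfl fun a _ => ?_
    rw [lintegral_indicator (hS a), setLIntegral_const, mul_comm]
  have := h.campbell_simple hp hl hS hvol hd hx none
  rw [hsum, ← show S none = A from rfl, ← this]
  unfold prodOthers
  simp_rw [← hprod]

/-- Both sides are additive in `A`, and `A` splits into its intersections with the level sets of
`v`. -/
theorem IsPoissonProcess.campbell_simpleFunc (h : IsPoissonProcess P p lam)
    (hp : ∀ i, Measurable fun c => p c i) (hl : 0 ≤ lam) (v : SimpleFunc Plane ℝ≥0∞)
    (hv : ∀ y, v y ≤ 1) (hfin : volume (v ⁻¹' {1}ᶜ) ≠ ∞) {A : Set Plane} (hA : MeasurableSet A)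
    (hAv : volume A ≠ ∞) :
    ∫⁻ c, ∑' i, A.indicator 1 (p c i) * prodOthers v (p c) i ∂P =
      ENNReal.ofReal lam * volume A * expNeg (ENNReal.ofReal lam * ∫⁻ y, 1 - v y) := by
  classical
  have hm : ∀ w, MeasurableSet (A ∩ v ⁻¹' {w}) := fun w => hA.inter (v.measurableSet_preimage _)
  have hi : ∀ y, A.indicator (1 : Plane → ℝ≥0∞) y =
      ∑ w ∈ v.range, (A ∩ v ⁻¹' {w}).indicator 1 y := by
    intro y
    rw [Finset.sum_eq_single_of_mem (v y) (v.mem_range_self y)]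
    · by_cases hy : y ∈ A <;> simp [hy]
    · intro b _ hb
      exact Set.indicator_of_notMem (fun h3 => hb (h3.2 : v y = b).symm) _
  have hvolA : volume A = ∑ w ∈ v.range, volume (A ∩ v ⁻¹' {w}) := by
    rw [← lintegral_indicator_one hA]
    simp_rw [hi]
    rw [lintegral_finsetSum _ fun w _ => measurable_one.indicator (hm w)]
    simp_rw [lintegral_indicator_one (hm _)]
  have hs : ∀ c, ∑' i, A.indicator 1 (p c i) * prodOthers v (p c) i =
      ∑ w ∈ v.range, ∑' i, (A ∩ v ⁻¹' {w}).indicator 1 (p c i) * prodOthers v (p c) i := by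
    intro c
    simp_rw [hi, Finset.sum_mul]
    exact Summable.tsum_finsetSum fun _ _ => ENNReal.summable
  simp_rw [hs]
  rw [lintegral_finsetSum]
  · rw [hvolA, Finset.mul_sum, Finset.sum_mul]
    refine Finset.sum_congr rfl fun w hw => ?_
    obtain ⟨y, hy⟩ := SimpleFunc.mem_range.1 hw
    exact h.campbell_const_on hp hl v hv hfin (hm w)
      (measure_ne_top_of_subset Set.inter_subset_left hAv) (hy ▸ hv y) fun y hy => hy.2
  · intro w _
    exact Measurable.tsum fun i => ((measurable_one.indicator (hm w)).comp (hp i)).mul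
      (measurable_prodOthers hp v.measurable i)

theorem IsPoissonProcess.campbell_set (h : IsPoissonProcess P p lam)
    (hp : ∀ i, Measurable fun c => p c i) (hl : 0 ≤ lam) {v : Plane → ℝ≥0∞} (hvm : Measurable v)
    (hv : ∀ y, v y ≤ 1) {A : Set Plane} (hA : MeasurableSet A) (hAv : volume A ≠ ∞) :
    ∫⁻ c, ∑' i, A.indicator 1 (p c i) * prodOthers v (p c) i ∂P =
      ENNReal.ofReal lam * volume A * expNeg (ENNReal.ofReal lam * ∫⁻ y, 1 - v y) := by
  have hfm : Measurable fun y => 1 - v y := measurable_const.sub hvm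
  have hb : ∀ n : ℕ, MeasurableSet (Metric.ball (0 : Plane) n) := fun n => measurableSet_ball
  -- Simple approximations of `1 - v` from below, cut off outside growing balls. Their complements
  -- `u n` to `1` decrease to `v` and equal `1` off a ball, as the formula for simple functions
  -- demands.
  let f : ℕ → SimpleFunc Plane ℝ≥0∞ := fun n =>
    (SimpleFunc.eapprox (fun y => 1 - v y) n).restrict (Metric.ball 0 n)
  have hf : ∀ n y, f n y = (Metric.ball (0 : Plane) n).indicator
      (SimpleFunc.eapprox (fun y => 1 - v y) n) y := fun n y => SimpleFunc.restrict_apply _ (hb n) y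
  have hfmono : ∀ y, Monotone fun n => f n y := by
    intro y m n hmn
    simp only [hf]
    refine (Set.indicator_le_indicator_of_subset (Metric.ball_subset_ball (by exact_mod_cast hmn))
      (fun _ => zero_le) y).trans (Set.indicator_le_indicator ?_)
    exact SimpleFunc.monotone_eapprox _ hmn y
  have hfsup : ∀ y, ⨆ n, f n y = 1 - v y := by
    intro y
    refine tendsto_nhds_unique (tendsto_atTop_iSup (hfmono y)) ?_
    refine (SimpleFunc.tendsto_eapprox hfm y).congr' ?_
    obtain ⟨N, hN⟩ := exists_nat_gt ‖y‖
    filter_upwards [eventually_ge_atTop N] with n hn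
    rw [hf, Set.indicator_of_mem]
    rw [mem_ball_zero_iff]
    exact hN.trans_le (by exact_mod_cast hn)
  have hfle : ∀ n y, f n y ≤ 1 - v y := fun n y => hfsup y ▸ le_iSup (fun n => f n y) n
  let u : ℕ → SimpleFunc Plane ℝ≥0∞ := fun n => (f n).map fun t => 1 - t
  have hu : ∀ n y, u n y = 1 - f n y := fun n y => rfl
  have hu1 : ∀ n y, u n y ≤ 1 := fun n y => tsub_le_self
  have huanti : ∀ y, Antitone fun n => u n y := fun y m n hmn => tsub_le_tsub_left (hfmono y hmn) 1
  have huinf : ∀ y, v y = ⨅ n, u n y := by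
    intro y
    simp_rw [hu]
    rw [← ENNReal.sub_iSup ENNReal.one_ne_top, hfsup, ENNReal.sub_sub_cancel ENNReal.one_ne_top (hv y)]
  have hcomp : ∀ n, ∫⁻ c, ∑' i, A.indicator 1 (p c i) * prodOthers (u n) (p c) i ∂P =
      ENNReal.ofReal lam * volume A * expNeg (ENNReal.ofReal lam * ∫⁻ y, f n y) := by
    intro n
    rw [h.campbell_simpleFunc hp hl (u n) (hu1 n) _ hA hAv]
    · congr 3
      refine lintegral_congr fun y => ?_
      rw [hu, ENNReal.sub_sub_cancel ENNReal.one_ne_top ((hfle n y).trans tsub_le_self)]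
    · refine measure_ne_top_of_subset (s := Metric.ball (0 : Plane) n) ?_
        (measure_ball_lt_top (μ := volume)).ne
      intro y hy
      by_contra hyn
      refine hy ?_
      simp only [Set.mem_singleton_iff]
      rw [hu, hf, Set.indicator_of_notMem hyn, tsub_zero]
  have hfin := ENNReal.mul_ne_top (ENNReal.ofReal_ne_top (r := lam)) hAv
  have hind : ∀ y, A.indicator (1 : Plane → ℝ≥0∞) y ≠ ∞ := fun y => by
    by_cases hy : y ∈ A <;> simp [hy]
  have hpo : ∀ c i, A.indicator 1 (p c i) * prodOthers v (p c) i =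
      ⨅ n, A.indicator 1 (p c i) * prodOthers (u n) (p c) i := by
    intro c i
    rw [← ENNReal.mul_iInf fun ht => absurd ht (hind _), ← prodOthers_iInf hu1 huanti]
    congr 2
    exact funext huinf
  simp_rw [hpo]
  rw [lintegral_tsum_iInf]
  · simp_rw [hcomp]
    simp_rw [← hfsup]
    rw [lintegral_iSup (fun n => (f n).measurable) fun m n hmn y => hfmono y hmn, ENNReal.mul_iSup,
      expNeg_iSup, ENNReal.mul_iInf fun ht => absurd ht hfin]
    exact fun m n hmn => mul_le_mul_right (lintegral_mono fun y => hfmono y hmn) _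
  · exact fun n i => ((measurable_one.indicator hA).comp (hp i)).mul
      (measurable_prodOthers hp (u n).measurable i)
  · exact fun i c m n hmn => mul_le_mul_right (prodOthers_mono (fun y => huanti y hmn) _ _) _
  · rw [hcomp]
    exact ENNReal.mul_ne_top hfin (expNeg_ne_top _)

/-- As functions of `φ`, both sides are integrals against measures on the plane. The measure `ρ` on
the left is a constant multiple of area on sets of finite area by `campbell_set`, hence everywhere.
-/
theorem IsPoissonProcess.campbell_const (h : IsPoissonProcess P p lam)
    (hp : ∀ i, Measurable fun c => p c i) (hl : 0 ≤ lam) {v : Plane → ℝ≥0∞} (hvm : Measurable v)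
    (hv : ∀ y, v y ≤ 1) {φ : Plane → ℝ≥0∞} (hφ : Measurable φ) :
    ∫⁻ c, ∑' i, φ (p c i) * prodOthers v (p c) i ∂P =
      ENNReal.ofReal lam * (∫⁻ x, φ x) * expNeg (ENNReal.ofReal lam * ∫⁻ y, 1 - v y) := by
  have hpm := fun i => measurable_prodOthers hp hvm i
  let ρ : Measure Plane := Measure.sum fun i =>
    (P.withDensity fun c => prodOthers v (p c) i).map fun c => p c i
  have hρ : ∀ ψ : Plane → ℝ≥0∞, Measurable ψ →
      ∫⁻ x, ψ x ∂ρ = ∫⁻ c, ∑' i, ψ (p c i) * prodOthers v (p c) i ∂P := by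
    intro ψ hψ
    have hm : ∀ i, Measurable fun c => ψ (p c i) * prodOthers v (p c) i := fun i =>
      (hψ.comp (hp i)).mul (hpm i)
    rw [lintegral_sum_measure, lintegral_tsum fun i => (hm i).aemeasurable]
    refine tsum_congr fun i => ?_
    rw [lintegral_map hψ (hp i), lintegral_withDensity_eq_lintegral_mul _ (hpm i)
      (g := fun c => ψ (p c i)) (hψ.comp (hp i))]
    exact lintegral_congr fun c => mul_comm _ _
  have hρA : ∀ A, MeasurableSet A → volume A ≠ ∞ → ρ A =
      ENNReal.ofReal lam * volume A * expNeg (ENNReal.ofReal lam * ∫⁻ y, 1 - v y) := by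
    intro A hA hAv
    rw [← lintegral_indicator_one hA, hρ _ (measurable_one.indicator hA),
      h.campbell_set hp hl hvm hv hA hAv]
  have hρv : ρ = (ENNReal.ofReal lam * expNeg (ENNReal.ofReal lam * ∫⁻ y, 1 - v y)) • volume := by
    refine (Measure.ext_iff_of_iUnion_eq_univ (s := fun n : ℕ => Metric.ball (0 : Plane) n)
      (Metric.iUnion_ball_nat 0)).2 fun n => Measure.ext fun A hA => ?_
    rw [Measure.restrict_apply hA, Measure.restrict_apply hA,
      hρA _ (hA.inter measurableSet_ball) (measure_ne_top_of_subset Set.inter_subset_right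
        (measure_ball_lt_top (μ := volume)).ne), Measure.smul_apply, smul_eq_mul]
    ring
  rw [← hρ φ hφ, hρv, lintegral_smul_measure, smul_eq_mul]
  ring

/-- Splitting the sum according to the value of `d` at the distinguished point leaves, in each
piece, a kernel that no longer depends on that point. -/
theorem IsPoissonProcess.campbell_countable (h : IsPoissonProcess P p lam)
    (hp : ∀ i, Measurable fun c => p c i) (hl : 0 ≤ lam) {ι : Type*} [Countable ι]
    [MeasurableSpace ι] [MeasurableSingletonClass ι] {d : Plane → ι} (hd : Measurable d)
    {U : ι → Plane → ℝ≥0∞} (hUm : ∀ b, Measurable (U b)) (hU : ∀ b y, U b y ≤ 1)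
    {φ : Plane → ℝ≥0∞} (hφ : Measurable φ) :
    ∫⁻ c, ∑' i, φ (p c i) * prodOthers (U (d (p c i))) (p c) i ∂P =
      ENNReal.ofReal lam *
        ∫⁻ x, φ x * expNeg (ENNReal.ofReal lam * ∫⁻ y, 1 - U (d x) y) := by
  have hs : ∀ b, MeasurableSet (d ⁻¹' {b}) := fun b => hd (measurableSet_singleton b)
  have key : ∀ (G : ι → ℝ≥0∞) (x : Plane), φ x * G (d x) =
      ∑' b, (d ⁻¹' {b}).indicator φ x * G b := by
    intro G x
    rw [tsum_eq_single (d x)]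
    · simp
    · intro b hb
      rw [Set.indicator_of_notMem, zero_mul]
      exact fun h2 => hb (h2 : d x = b).symm
  have h1 : ∀ c, ∑' i, φ (p c i) * prodOthers (U (d (p c i))) (p c) i =
      ∑' b, ∑' i, (d ⁻¹' {b}).indicator φ (p c i) * prodOthers (U b) (p c) i := by
    intro c
    rw [ENNReal.tsum_comm]
    exact tsum_congr fun i => key (fun b => prodOthers (U b) (p c) i) (p c i)
  simp_rw [h1]
  have hm : ∀ b, Measurable fun c =>
      ∑' i, (d ⁻¹' {b}).indicator φ (p c i) * prodOthers (U b) (p c) i := fun b =>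
    Measurable.tsum fun i => ((hφ.indicator (hs b)).comp (hp i)).mul
      (measurable_prodOthers hp (hUm b) i)
  rw [lintegral_tsum fun b => (hm b).aemeasurable]
  simp_rw [fun x => key (fun b => expNeg (ENNReal.ofReal lam * ∫⁻ y, 1 - U b y)) x]
  rw [lintegral_tsum fun b => ((hφ.indicator (hs b)).mul_const _).aemeasurable,
    ← ENNReal.tsum_mul_left]
  refine tsum_congr fun b => ?_
  rw [h.campbell_const hp hl (hUm b) (hU b) (hφ.indicator (hs b)),
    lintegral_mul_const _ (hφ.indicator (hs b)), mul_assoc]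

/-- A Slivnyak–Mecke formula for functionals of product form, whose factors are decreasing limits
of functions that depend on their first argument through a countably valued map. -/
theorem IsPoissonProcess.campbell_antitone (h : IsPoissonProcess P p lam)
    (hp : ∀ i, Measurable fun c => p c i) (hl : 0 ≤ lam) {ι : Type*} [Countable ι]
    [MeasurableSpace ι] [MeasurableSingletonClass ι] {d : ℕ → Plane → ι}
    (hd : ∀ n, Measurable (d n)) {U : ℕ → ι → Plane → ℝ≥0∞} (hUm : ∀ n b, Measurable (U n b))
    (hU : ∀ n b y, U n b y ≤ 1) (ha : ∀ x y, Antitone fun n => U n (d n x) y)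
    {u : Plane → Plane → ℝ≥0∞} (hu : ∀ x y, u x y = ⨅ n, U n (d n x) y)
    {φ : Plane → ℝ≥0∞} (hφ : Measurable φ) (hφi : ∫⁻ x, φ x ≠ ∞) (hφt : ∀ x, φ x ≠ ∞) :
    ∫⁻ c, ∑' i, φ (p c i) * prodOthers (u (p c i)) (p c) i ∂P =
      ENNReal.ofReal lam * ∫⁻ x, φ x * expNeg (ENNReal.ofReal lam * ∫⁻ y, 1 - u x y) := by
  have h1 : ∀ c i, φ (p c i) * prodOthers (u (p c i)) (p c) i =
      ⨅ n, φ (p c i) * prodOthers (U n (d n (p c i))) (p c) i := by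
    intro c i
    rw [← ENNReal.mul_iInf fun ht => absurd ht (hφt _),
      ← prodOthers_iInf (fun n y => hU n _ y) (fun y => ha _ y)]
    congr 2
    exact funext fun y => hu _ y
  have hcomp := fun n => h.campbell_countable hp hl (hd n) (hUm n) (hU n) hφ
  have hE : ∀ n, Measurable fun x => expNeg (ENNReal.ofReal lam * ∫⁻ y, 1 - U n (d n x) y) :=
    fun n => (measurable_of_countable
      fun b => expNeg (ENNReal.ofReal lam * ∫⁻ y, 1 - U n b y)).comp (hd n)
  have hbd : ∀ n, ENNReal.ofReal lam *
      ∫⁻ x, φ x * expNeg (ENNReal.ofReal lam * ∫⁻ y, 1 - U n (d n x) y) ≠ ∞ := fun n =>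
    ENNReal.mul_ne_top ENNReal.ofReal_ne_top (ne_top_of_le_ne_top hφi
      (lintegral_mono fun x => mul_le_of_le_one_right' (expNeg_le_one _)))
  simp_rw [h1]
  rw [lintegral_tsum_iInf]
  · simp_rw [hcomp]
    -- Decreasing kernels make `1 - U` increase, so the inner integral passes to its supremum by
    -- monotone convergence and `expNeg` turns it into an infimum; the outer integral decreases and
    -- is dominated by that of `φ`.
    rw [← ENNReal.mul_iInf fun ht => absurd ht ENNReal.ofReal_ne_top, ← lintegral_iInf]
    · congr 1
      refine lintegral_congr fun x => ?_
      rw [← ENNReal.mul_iInf fun ht => absurd ht (hφt _), ← expNeg_iSup, ← ENNReal.mul_iSup,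
        ← lintegral_iSup]
      · simp_rw [hu, ENNReal.sub_iInf]
      · exact fun n => measurable_const.sub (hUm n _)
      · exact fun m n hmn y => tsub_le_tsub_left (ha x y hmn) 1
      · exact fun m n hmn => mul_le_mul_right
          (lintegral_mono fun y => tsub_le_tsub_left (ha x y hmn) 1) _
    · exact fun n => hφ.mul (hE n)
    · exact fun m n hmn x => mul_le_mul_right (antitone_expNeg (mul_le_mul_right
          (lintegral_mono fun y => tsub_le_tsub_left (ha x y hmn) 1) _)) _
    · exact ne_top_of_le_ne_top hφi
        (lintegral_mono fun x => mul_le_of_le_one_right' (expNeg_le_one _))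
  · intro n i
    refine (hφ.comp (hp i)).mul (measurable_infProd fun l => ?_)
    split_ifs
    · exact measurable_const
    · exact (measurable_from_prod_countable_right (f := fun z : ι × Plane => U n z.1 z.2)
        (hUm n)).comp (((hd n).comp (hp i)).prodMk (hp l))
  · exact fun i c m n hmn => mul_le_mul_right (prodOthers_mono (fun y => ha _ y hmn) _ _) _
  · rw [hcomp]
    exact hbd 0

end Poisson

/-! ### Dyadic rounding of distances -/

theorem tendsto_two_pow_inv : Tendsto (fun n : ℕ => ((2 : ℝ) ^ n)⁻¹) atTop (𝓝 0) :=
  tendsto_inv_atTop_zero.comp (tendsto_pow_atTop_atTop_of_one_lt one_lt_two)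

/-- The largest multiple of `2⁻ⁿ` below `r` is `dyadic n r / 2 ^ n`. -/
noncomputable def dyadic (n : ℕ) (r : ℝ) : ℤ := ⌊2 ^ n * r⌋

theorem measurable_dyadic (n : ℕ) : Measurable (dyadic n) :=
  Int.measurable_floor.comp (measurable_const_mul _)

theorem dyadic_div_le (n : ℕ) (r : ℝ) : (dyadic n r : ℝ) / 2 ^ n ≤ r := by
  rw [div_le_iff₀ (by positivity), mul_comm]; exact Int.floor_le _

theorem dyadic_div_nonneg (n : ℕ) {r : ℝ} (hr : 0 ≤ r) : 0 ≤ (dyadic n r : ℝ) / 2 ^ n :=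
  div_nonneg (by exact_mod_cast Int.floor_nonneg.2 (by positivity)) (by positivity)

theorem monotone_dyadic_div (r : ℝ) : Monotone fun n => (dyadic n r : ℝ) / 2 ^ n := by
  refine monotone_nat_of_le_succ fun n => ?_
  rw [div_le_div_iff₀ (by positivity) (by positivity), pow_succ]
  have : 2 * dyadic n r ≤ dyadic (n + 1) r := by
    refine Int.le_floor.2 ?_
    push_cast
    rw [pow_succ]
    linarith [Int.floor_le (2 ^ n * r), show (dyadic n r : ℝ) = ⌊2 ^ n * r⌋ from rfl]
  have h2 : 2 * (dyadic n r : ℝ) ≤ dyadic (n + 1) r := by exact_mod_cast this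
  nlinarith [show (0 : ℝ) < 2 ^ n by positivity]

theorem tendsto_dyadic_div (r : ℝ) : Tendsto (fun n => (dyadic n r : ℝ) / 2 ^ n) atTop (𝓝 r) := by
  have h1 : Tendsto (fun n : ℕ => r - ((2 : ℝ) ^ n)⁻¹) atTop (𝓝 r) := by
    simpa using tendsto_const_nhds.sub tendsto_two_pow_inv
  refine tendsto_of_tendsto_of_tendsto_of_le_of_le h1 tendsto_const_nhds (fun n => ?_)
    (dyadic_div_le · r)
  have := Int.lt_floor_add_one (2 ^ n * r)
  dsimp only
  rw [le_div_iff₀ (by positivity), sub_mul, inv_mul_cancel₀ (by positivity)]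
  linarith [show (dyadic n r : ℝ) = ⌊2 ^ n * r⌋ from rfl]

theorem eventually_dyadic_ne {a b : ℝ} (h : a ≠ b) : ∀ᶠ n in atTop, dyadic n a ≠ dyadic n b := by
  have := tendsto_two_pow_inv.eventually_lt_const (abs_pos.2 (sub_ne_zero.2 h))
  filter_upwards [this] with n hn heq
  have h1 := Int.abs_sub_lt_one_of_floor_eq_floor (heq : ⌊2 ^ n * a⌋ = ⌊2 ^ n * b⌋)
  rw [← mul_sub, abs_mul, abs_of_pos (by positivity : (0 : ℝ) < 2 ^ n)] at h1
  rw [inv_lt_iff_one_lt_mul₀ (by positivity)] at hn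
  linarith

/-! ### Kernels depending on distances; absence of ties -/

section Poisson

variable {P : Measure Config} [IsProbabilityMeasure P] {p : Config → ℕ → Plane} {lam : ℝ}

/-- The Slivnyak–Mecke formula for factors that depend on the distances to a fixed point. -/
theorem IsPoissonProcess.campbell_radial (h : IsPoissonProcess P p lam)
    (hp : ∀ i, Measurable fun c => p c i) (hl : 0 ≤ lam) (x₀ : Plane) {k : ℝ → ℝ → ℝ≥0∞}
    (hkm : ∀ r, Measurable (k r)) (hk1 : ∀ r s, k r s ≤ 1)
    (hka : ∀ r r' s, 0 ≤ r → r ≤ r' → k r' s ≤ k r s)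
    (hkc : ∀ (a : ℕ → ℝ) r s, (∀ n, 0 ≤ a n) → (∀ n, a n ≤ r) → 0 ≤ s → Tendsto a atTop (𝓝 r) →
      Tendsto (fun n => k (a n) s) atTop (𝓝 (k r s)))
    {φ : Plane → ℝ≥0∞} (hφ : Measurable φ) (hφi : ∫⁻ x, φ x ≠ ∞) (hφt : ∀ x, φ x ≠ ∞) :
    ∫⁻ c, ∑' i, φ (p c i) * prodOthers (fun y => k ‖p c i - x₀‖ ‖y - x₀‖) (p c) i ∂P =
      ENNReal.ofReal lam * ∫⁻ x, φ x * expNeg (ENNReal.ofReal lam *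
        ∫⁻ y, 1 - k ‖x - x₀‖ ‖y - x₀‖) := by
  -- Rounding the radius down makes the approximations increase to `‖x - x₀‖`, so a kernel
  -- decreasing in the radius decreases to its limit. Continuity from below suffices, which admits
  -- kernels that jump at `s = r`.
  have ha : ∀ x y : Plane, Antitone fun n =>
      k ((dyadic n ‖x - x₀‖ : ℝ) / 2 ^ n) ‖y - x₀‖ := fun x y m n hmn =>
    hka _ _ _ (dyadic_div_nonneg m (norm_nonneg _)) (monotone_dyadic_div _ hmn)
  refine h.campbell_antitone hp hl (ι := ℤ) (d := fun n x => dyadic n ‖x - x₀‖)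
    (U := fun n b y => k ((b : ℝ) / 2 ^ n) ‖y - x₀‖) (u := fun x y => k ‖x - x₀‖ ‖y - x₀‖)
    (fun n => (measurable_dyadic n).comp (by fun_prop))
    (fun n b => (hkm _).comp (by fun_prop)) (fun n b y => hk1 _ _) ha (fun x y => ?_) hφ hφi hφt
  exact tendsto_nhds_unique (hkc _ _ _ (fun n => dyadic_div_nonneg n (norm_nonneg _))
    (fun n => dyadic_div_le n _) (norm_nonneg _) (tendsto_dyadic_div _)) (tendsto_atTop_iInf (ha x y))

theorem IsPoissonProcess.campbell (h : IsPoissonProcess P p lam)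
    (hp : ∀ i, Measurable fun c => p c i) (hl : 0 ≤ lam)
    {φ : Plane → ℝ≥0∞} (hφ : Measurable φ) :
    ∫⁻ c, ∑' i, φ (p c i) ∂P = ENNReal.ofReal lam * ∫⁻ x, φ x := by
  have := h.campbell_const hp hl (v := fun _ => 1) measurable_const (fun _ => le_rfl) hφ
  have h1 : ∀ w i, prodOthers (fun _ => 1) w i = 1 := fun w i => by simp [prodOthers, infProd]
  simpa [h1, expNeg_zero] using this

theorem volume_norm_sub_eq (x₀ : Plane) (r : ℝ) : volume {y : Plane | ‖y - x₀‖ = r} = 0 := by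
  have : {y : Plane | ‖y - x₀‖ = r} = Metric.sphere x₀ r := by
    ext y; simp
  rw [this]
  exact Measure.addHaar_sphere _ _ _

/-- These sets are thin shells around the sphere through `x`. Their indicators converge to that of
the sphere, which is null, and all shells lie in one ball, so dominated convergence applies. -/
theorem tendsto_volume_dyadic_eq (x₀ x : Plane) :
    Tendsto (fun n => volume {y : Plane | dyadic n ‖y - x₀‖ = dyadic n ‖x - x₀‖}) atTop (𝓝 0) := by
  have hm : ∀ n, MeasurableSet {y : Plane | dyadic n ‖y - x₀‖ = dyadic n ‖x - x₀‖} := fun n =>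
    ((measurable_dyadic n).comp (by fun_prop : Measurable fun y : Plane => ‖y - x₀‖))
      (measurableSet_singleton (dyadic n ‖x - x₀‖))
  simp_rw [fun n => (lintegral_indicator_one (μ := (volume : Measure Plane)) (hm n)).symm]
  rw [show (0 : ℝ≥0∞) = ∫⁻ y : Plane, {y : Plane | ‖y - x₀‖ = ‖x - x₀‖}.indicator 1 y by
    rw [lintegral_indicator_one, volume_norm_sub_eq]
    exact (by fun_prop : Measurable fun y : Plane => ‖y - x₀‖) (measurableSet_singleton _)]
  refine tendsto_lintegral_of_dominated_convergence
    ((Metric.closedBall x₀ (‖x - x₀‖ + 1)).indicator 1) (fun n => measurable_one.indicator (hm n))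
    (fun n => ae_of_all _ fun y => ?_) ?_ (ae_of_all _ fun y => ?_)
  · refine Set.indicator_le_indicator_of_subset (fun y hy => ?_) (fun _ => zero_le) y
    have h1 := Int.abs_sub_lt_one_of_floor_eq_floor
      (hy : ⌊2 ^ n * ‖y - x₀‖⌋ = ⌊2 ^ n * ‖x - x₀‖⌋)
    rw [← mul_sub, abs_mul, abs_of_pos (by positivity : (0 : ℝ) < 2 ^ n)] at h1
    have h2 : (1 : ℝ) ≤ 2 ^ n := one_le_pow₀ one_le_two
    rw [Metric.mem_closedBall, dist_eq_norm]
    nlinarith [le_abs_self (‖y - x₀‖ - ‖x - x₀‖), abs_nonneg (‖y - x₀‖ - ‖x - x₀‖)]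
  · rw [lintegral_indicator_one measurableSet_closedBall]
    exact (measure_closedBall_lt_top (μ := volume)).ne
  · refine tendsto_const_nhds.congr' ?_
    by_cases hy : ‖y - x₀‖ = ‖x - x₀‖
    · filter_upwards with n
      simp [hy]
    · filter_upwards [eventually_dyadic_ne hy] with n hn
      simp [hy, hn]

/-- Almost surely no two points of a Poisson process have the same distance to a given point. -/
theorem IsPoissonProcess.ae_norm_sub_ne (h : IsPoissonProcess P p lam)
    (hp : ∀ i, Measurable fun c => p c i) (hl : 0 ≤ lam) (x₀ : Plane) :
    ∀ᵐ c ∂P, ∀ i l, l ≠ i → ‖p c l - x₀‖ ≠ ‖p c i - x₀‖ := by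
  classical
  suffices H : ∀ N : ℕ, ∀ᵐ c ∂P, ∀ i l, l ≠ i → p c i ∈ Metric.ball (0 : Plane) N →
      ‖p c l - x₀‖ ≠ ‖p c i - x₀‖ by
    filter_upwards [ae_all_iff.2 H] with c hc i l hil
    obtain ⟨N, hN⟩ := exists_nat_gt ‖p c i‖
    exact hc N i l hil (by simpa using hN)
  intro N
  let φ : Plane → ℝ≥0∞ := (Metric.ball (0 : Plane) N).indicator 1
  have hφ : Measurable φ := measurable_one.indicator measurableSet_ball
  have hφi : ∫⁻ x, φ x ≠ ∞ := by
    rw [lintegral_indicator_one measurableSet_ball]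
    exact (measure_ball_lt_top (μ := volume)).ne
  -- `X c i` vanishes as soon as another point has the same distance to `x₀` as point `i`, and is
  -- `1` otherwise.
  let X : Config → ℕ → ℝ≥0∞ := fun c i =>
    prodOthers (fun y => if ‖y - x₀‖ = ‖p c i - x₀‖ then 0 else 1) (p c) i
  have hX1 : ∀ c i, X c i ≤ 1 := fun c i => prodOthers_le_one _ _ _
  have hXm : ∀ i, Measurable fun c => X c i := fun i => by
    refine measurable_infProd fun l => ?_
    split_ifs
    · exact measurable_const
    · refine Measurable.ite ?_ measurable_const measurable_const
      exact measurableSet_eq_fun ((hp l).sub_const x₀).norm ((hp i).sub_const x₀).norm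
  let V : ℕ → ℤ → Plane → ℝ≥0∞ := fun n b y => if dyadic n ‖y - x₀‖ = b then 0 else 1
  have hset : ∀ n b, MeasurableSet {y : Plane | dyadic n ‖y - x₀‖ = b} := fun n b =>
    ((measurable_dyadic n).comp (by fun_prop : Measurable fun y : Plane => ‖y - x₀‖))
      (measurableSet_singleton b)
  have hVm : ∀ n b, Measurable (V n b) := fun n b =>
    Measurable.ite (hset n b) measurable_const measurable_const
  -- Replacing the sphere by a dyadic shell only lowers the product and makes it depend on the point
  -- through a countably valued map. These approximations are not from above, so the limit theorem
  -- for decreasing kernels is unavailable; a lower bound is enough.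
  have hlow : ∀ n, ENNReal.ofReal lam * ∫⁻ x, φ x * expNeg (ENNReal.ofReal lam *
      volume {y : Plane | dyadic n ‖y - x₀‖ = dyadic n ‖x - x₀‖}) ≤
      ∫⁻ c, ∑' i, φ (p c i) * X c i ∂P := by
    intro n
    have h1 := h.campbell_countable hp hl (d := fun x => dyadic n ‖x - x₀‖)
      ((measurable_dyadic n).comp (by fun_prop)) (hVm n)
      (fun b y => by simp only [V]; split_ifs <;> simp) hφ
    have h2 : ∀ x : Plane, ∫⁻ y, 1 - V n (dyadic n ‖x - x₀‖) y =
        volume {y : Plane | dyadic n ‖y - x₀‖ = dyadic n ‖x - x₀‖} := by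
      intro x
      rw [← lintegral_indicator_one (hset n _)]
      refine lintegral_congr fun y => ?_
      by_cases hy : dyadic n ‖y - x₀‖ = dyadic n ‖x - x₀‖ <;> simp [V, hy]
    simp_rw [h2] at h1
    rw [← h1]
    refine lintegral_mono fun c => ENNReal.tsum_le_tsum fun i => mul_le_mul_right ?_ _
    refine prodOthers_mono (fun y => ?_) _ _
    by_cases hy : ‖y - x₀‖ = ‖p c i - x₀‖
    · simp [V, hy]
    · simp only [V, hy, if_false]; split_ifs <;> simp
  have hlim : Tendsto (fun n => ENNReal.ofReal lam * ∫⁻ x, φ x * expNeg (ENNReal.ofReal lam *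
      volume {y : Plane | dyadic n ‖y - x₀‖ = dyadic n ‖x - x₀‖})) atTop
      (𝓝 (ENNReal.ofReal lam * ∫⁻ x, φ x)) := by
    refine ENNReal.Tendsto.const_mul ?_ (Or.inr ENNReal.ofReal_ne_top)
    refine tendsto_lintegral_of_dominated_convergence φ (fun n => ?_) (fun n => ae_of_all _ fun x =>
      mul_le_of_le_one_right' (expNeg_le_one _)) hφi (ae_of_all _ fun x => ?_)
    · exact hφ.mul ((measurable_of_countable fun b : ℤ => expNeg (ENNReal.ofReal lam *
        volume {y : Plane | dyadic n ‖y - x₀‖ = b})).comp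
        ((measurable_dyadic n).comp (by fun_prop : Measurable fun x : Plane => ‖x - x₀‖)))
    · have h1 : Tendsto (fun n => expNeg (ENNReal.ofReal lam *
          volume {y : Plane | dyadic n ‖y - x₀‖ = dyadic n ‖x - x₀‖})) atTop (𝓝 1) := by
        rw [← expNeg_zero, ← mul_zero (ENNReal.ofReal lam)]
        exact (continuous_expNeg.tendsto _).comp (ENNReal.Tendsto.const_mul
          (tendsto_volume_dyadic_eq x₀ x) (Or.inr ENNReal.ofReal_ne_top))
      simpa using ENNReal.Tendsto.const_mul (a := φ x) h1 (Or.inl one_ne_zero)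
  have hm1 : Measurable fun c => ∑' i, φ (p c i) * X c i :=
    Measurable.tsum fun i => (hφ.comp (hp i)).mul (hXm i)
  have hm2 : Measurable fun c => ∑' i, φ (p c i) * (1 - X c i) :=
    Measurable.tsum fun i => (hφ.comp (hp i)).mul (measurable_const.sub (hXm i))
  have hge := le_of_tendsto' hlim hlow
  have hsum : ∫⁻ c, ∑' i, φ (p c i) ∂P =
      ∫⁻ c, ∑' i, φ (p c i) * X c i ∂P + ∫⁻ c, ∑' i, φ (p c i) * (1 - X c i) ∂P := by
    rw [← lintegral_add_left hm1]
    refine lintegral_congr fun c => ?_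
    rw [← ENNReal.tsum_add]
    refine tsum_congr fun i => ?_
    rw [← mul_add, add_tsub_cancel_of_le (hX1 c i), mul_one]
  rw [h.campbell hp hl hφ] at hsum
  have hfin : ENNReal.ofReal lam * ∫⁻ x, φ x ≠ ∞ := ENNReal.mul_ne_top ENNReal.ofReal_ne_top hφi
  -- The part with factor `X` already carries the whole finite mean `λ ∫ φ`, so nothing remains for
  -- the complementary part.
  have hzero : ∫⁻ c, ∑' i, φ (p c i) * (1 - X c i) ∂P = 0 := by
    have h1 : ∫⁻ c, ∑' i, φ (p c i) * X c i ∂P ≠ ∞ :=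
      ne_top_of_le_ne_top hfin (hsum ▸ le_self_add)
    have h2 : ∫⁻ c, ∑' i, φ (p c i) * X c i ∂P + ∫⁻ c, ∑' i, φ (p c i) * (1 - X c i) ∂P ≤
        ∫⁻ c, ∑' i, φ (p c i) * X c i ∂P + 0 := by rw [← hsum, add_zero]; exact hge
    exact le_antisymm ((ENNReal.add_le_add_iff_left h1).1 h2) zero_le
  rw [lintegral_eq_zero_iff hm2] at hzero
  filter_upwards [hzero] with c hc i l hil hi heq
  have h1 := ENNReal.tsum_eq_zero.1 hc i
  have h2 : X c i = 0 := by
    -- The partial product over the indices below `l + 1` already contains the vanishing factor of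
    -- index `l`.
    refine le_antisymm ((iInf_le _ (l + 1)).trans ?_) zero_le
    rw [Finset.prod_eq_zero (Finset.self_mem_range_succ l)]
    simp [hil, heq]
  simp [φ, hi, h2] at h1

theorem IsPoissonProcess.ae_injective (h : IsPoissonProcess P p lam)
    (hp : ∀ i, Measurable fun c => p c i) (hl : 0 ≤ lam) :
    ∀ᵐ c ∂P, ∀ i l, l ≠ i → p c l ≠ p c i := by
  filter_upwards [h.ae_norm_sub_ne hp hl 0] with c hc i l hil heq
  exact hc i l hil (by rw [heq])

theorem exists_dist_denseSeq_lt (n : ℕ) (x : Plane) :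
    ∃ m, dist x (TopologicalSpace.denseSeq Plane m) < (2 ^ n)⁻¹ :=
  (TopologicalSpace.denseRange_denseSeq Plane).exists_dist_lt x (by positivity)

open Classical in
/-- The index of the first point of a dense sequence at distance less than `2⁻ⁿ` from `x`. -/
noncomputable def nearIndex (n : ℕ) (x : Plane) : ℕ := Nat.find (exists_dist_denseSeq_lt n x)

theorem dist_nearIndex (n : ℕ) (x : Plane) :
    dist x (TopologicalSpace.denseSeq Plane (nearIndex n x)) < (2 ^ n)⁻¹ := by
  classical exact Nat.find_spec (exists_dist_denseSeq_lt n x)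

theorem measurable_nearIndex (n : ℕ) : Measurable (nearIndex n) := by
  classical exact measurable_find (exists_dist_denseSeq_lt n) fun m =>
    measurableSet_lt (by fun_prop) measurable_const

/-- The Slivnyak–Mecke formula for factors that depend on the distances to a translated point. -/
theorem IsPoissonProcess.campbell_translate (h : IsPoissonProcess P p lam)
    (hp : ∀ i, Measurable fun c => p c i) (hl : 0 ≤ lam) (w : Plane) {k : ℝ → ℝ≥0∞}
    (hk : Continuous k) (hk1 : ∀ s, k s ≤ 1) (hka : ∀ s s', 0 ≤ s → s ≤ s' → k s ≤ k s')
    {φ : Plane → ℝ≥0∞} (hφ : Measurable φ) (hφi : ∫⁻ x, φ x ≠ ∞) (hφt : ∀ x, φ x ≠ ∞) :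
    ∫⁻ c, ∑' i, φ (p c i) * prodOthers (fun y => k ‖y - (p c i + w)‖) (p c) i ∂P =
      ENNReal.ofReal lam * (∫⁻ x, φ x) * expNeg (ENNReal.ofReal lam * ∫⁻ y : Plane, 1 - k ‖y‖) := by
  let e := TopologicalSpace.denseSeq Plane
  have hd : ∀ n x, ‖x - e (nearIndex n x)‖ ≤ (2 ^ n)⁻¹ := fun n x => by
    rw [← dist_eq_norm]; exact (dist_nearIndex n x).le
  -- Passing from `n` to `n + 1` moves the approximating centre by at most `(3/2) 2⁻ⁿ`, while the
  -- correction `6 · 2⁻ⁿ` drops by `3 · 2⁻ⁿ`. The corrected distances therefore decrease, and so do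
  -- their values under the increasing `k`.
  have ha : ∀ x y : Plane, Antitone fun n =>
      k (‖y - (e (nearIndex n x) + w)‖ + 6 * (2 ^ n)⁻¹) := by
    refine fun x y => antitone_nat_of_succ_le fun n => hka _ _ (by positivity) ?_
    have h1 : ‖y - (e (nearIndex (n + 1) x) + w)‖ ≤ ‖y - (e (nearIndex n x) + w)‖ +
        (‖x - e (nearIndex (n + 1) x)‖ + ‖x - e (nearIndex n x)‖) := by
      have : y - (e (nearIndex (n + 1) x) + w) = (y - (e (nearIndex n x) + w)) +
          ((x - e (nearIndex (n + 1) x)) - (x - e (nearIndex n x))) := by abel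
      rw [this]
      exact (norm_add_le _ _).trans (add_le_add_right (norm_sub_le _ _) _)
    have h2 := hd n x
    have h3 := hd (n + 1) x
    rw [pow_succ, mul_inv] at h3 ⊢
    linarith [show (0 : ℝ) < (2 ^ n)⁻¹ by positivity]
  have hlim : ∀ x y : Plane, Tendsto (fun n => ‖y - (e (nearIndex n x) + w)‖ + 6 * ((2 : ℝ) ^ n)⁻¹)
      atTop (𝓝 ‖y - (x + w)‖) := by
    intro x y
    have h1 : Tendsto (fun n => e (nearIndex n x)) atTop (𝓝 x) := by
      rw [tendsto_iff_norm_sub_tendsto_zero]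
      refine squeeze_zero (fun _ => norm_nonneg _) (fun n => ?_) tendsto_two_pow_inv
      rw [norm_sub_rev]
      exact hd n x
    have h2 := ((h1.add_const w).const_sub y).norm.add (tendsto_two_pow_inv.const_mul 6)
    simpa using h2
  have := h.campbell_antitone hp hl (ι := ℕ) (d := nearIndex)
    (U := fun n b y => k (‖y - (e b + w)‖ + 6 * (2 ^ n)⁻¹)) (u := fun x y => k ‖y - (x + w)‖)
    measurable_nearIndex (fun n b => hk.measurable.comp (by fun_prop)) (fun n b y => hk1 _) ha
    (fun x y => tendsto_nhds_unique ((hk.tendsto _).comp (hlim x y)) (tendsto_atTop_iInf (ha x y)))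
    hφ hφi hφt
  rw [this]
  have h3 : ∀ x : Plane, ∫⁻ y, 1 - k ‖y - (x + w)‖ = ∫⁻ y : Plane, 1 - k ‖y‖ := fun x =>
    lintegral_sub_right_eq_self (μ := volume) (fun y : Plane => 1 - k ‖y‖) (x + w)
  simp_rw [h3]
  rw [lintegral_mul_const _ hφ, mul_assoc]

end Poisson

/-! ### Independent copies and independent families -/

section Independence

variable {Ω : Type*} [MeasurableSpace Ω] {Q : Measure Ω} [IsProbabilityMeasure Q]

theorem lintegral_of_indepFun {α β : Type*} [MeasurableSpace α] [MeasurableSpace β] {X : Ω → α}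
    {Y : Ω → β} (hX : Measurable X) (hY : Measurable Y) (h : IndepFun X Y Q) {Φ : α → β → ℝ≥0∞}
    (hΦ : Measurable (Function.uncurry Φ)) :
    ∫⁻ ω, Φ (X ω) (Y ω) ∂Q = ∫⁻ ω, ∫⁻ ω', Φ (X ω) (Y ω') ∂Q ∂Q := by
  have h1 := (indepFun_iff_map_prod_eq_prod_map_map hX.aemeasurable hY.aemeasurable).1 h
  have h2 : ∫⁻ ω, Φ (X ω) (Y ω) ∂Q =
      ∫⁻ z, Function.uncurry Φ z ∂(Q.map fun ω => (X ω, Y ω)) :=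
    (lintegral_map hΦ (hX.prodMk hY)).symm
  rw [h2, h1, lintegral_prod _ hΦ.aemeasurable,
    lintegral_map hΦ.lintegral_prod_right' hX]
  refine lintegral_congr fun ω => ?_
  exact lintegral_map (hΦ.comp measurable_prodMk_left) hY

/-- Independence means that the joint law is a product measure, and currying identifies a product
over pairs with a product of the products over rows. -/
theorem iIndepFun_curry {ι κ : Type*} {X : ι → κ → Ω → ℝ} (hX : ∀ i j, Measurable (X i j))
    (h : iIndepFun (fun (s : (_ : ι) × κ) ω => X s.1 s.2 ω) Q) :
    iIndepFun (fun i ω j => X i j ω) Q := by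
  have hp : ∀ i j, IsProbabilityMeasure (Q.map (X i j)) := fun i j =>
    Measure.isProbabilityMeasure_map (hX i j).aemeasurable
  have h2 : ∀ i, iIndepFun (X i) Q := fun i =>
    h.precomp (g := fun j => (⟨i, j⟩ : (_ : ι) × κ)) fun a b hab => by simpa using hab
  have hc : (MeasurableEquiv.piCurry fun (_ : ι) (_ : κ) => ℝ) ∘
      (fun ω (s : (_ : ι) × κ) => X s.1 s.2 ω) = fun ω i j => X i j ω := by
    ext; simp [Sigma.curry]
  rw [iIndepFun_iff_map_fun_eq_infinitePi_map (by fun_prop)]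
  rw [← hc, ← Measure.map_map (by fun_prop) (by fun_prop),
    (iIndepFun_iff_map_fun_eq_infinitePi_map (by fun_prop)).1 h,
    Measure.infinitePi_map_piCurry (fun i j => Q.map (X i j))]
  congr 1
  ext1 i
  rw [(iIndepFun_iff_map_fun_eq_infinitePi_map (by fun_prop)).1 (h2 i)]

end Independence

/-! ### Exponential fading and success probabilities -/

theorem lintegral_expMeasure {f : ℝ → ℝ≥0∞} (hf : Measurable f) :
    ∫⁻ x, f x ∂expMeasure 1 = ∫⁻ x in Set.Ioi 0, f x * ENNReal.ofReal (Real.exp (-x)) := by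
  have hm : Measurable (exponentialPDF 1) := (measurable_exponentialPDFReal 1).ennreal_ofReal
  have h1 : expMeasure 1 = volume.withDensity (exponentialPDF 1) := rfl
  rw [h1, lintegral_withDensity_eq_lintegral_mul _ hm hf, ← lintegral_indicator measurableSet_Ioi]
  have h0 : ∀ᵐ x : ℝ, x ≠ 0 := by simp [ae_iff]
  refine lintegral_congr_ae ?_
  filter_upwards [h0] with x hx
  rcases lt_or_gt_of_ne hx with h | h
  · simp [exponentialPDF_of_neg h, h.le]
  · rw [Set.indicator_of_mem (Set.mem_Ioi.2 h), Pi.mul_apply, exponentialPDF_of_nonneg h.le,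
      mul_comm]
    simp

theorem lintegral_exp_neg_mul_Ioi {a : ℝ} (ha : 0 < a) (y : ℝ) :
    ∫⁻ x in Set.Ioi y, ENNReal.ofReal (Real.exp (-a * x)) =
      ENNReal.ofReal (Real.exp (-a * y) / a) := by
  rw [← ofReal_integral_eq_lintegral_ofReal (integrableOn_exp_mul_Ioi (by linarith) y)
    (ae_of_all _ fun x => (Real.exp_pos _).le), integral_exp_mul_Ioi (by linarith)]
  congr 1
  field_simp

theorem expMeasure_tail (t : ℝ≥0∞) : expMeasure 1 {x | t ≤ ENNReal.ofReal x} = expNeg t := by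
  have hset : MeasurableSet {x | t ≤ ENNReal.ofReal x} :=
    measurableSet_le measurable_const (by fun_prop)
  by_cases ht : t = ∞
  · subst ht
    simp [expNeg_top]
  obtain ⟨y, hy, rfl⟩ : ∃ y : ℝ, 0 ≤ y ∧ t = ENNReal.ofReal y :=
    ⟨t.toReal, ENNReal.toReal_nonneg, (ENNReal.ofReal_toReal ht).symm⟩
  rw [← lintegral_indicator_one hset, lintegral_expMeasure (measurable_one.indicator hset),
    expNeg_ofReal hy]
  have h1 := lintegral_exp_neg_mul_Ioi one_pos y
  rw [neg_one_mul, div_one] at h1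
  rw [← h1, ← lintegral_indicator measurableSet_Ioi, ← lintegral_indicator measurableSet_Ioi]
  have h0 : ∀ᵐ x : ℝ, x ≠ y := by simp [ae_iff]
  refine lintegral_congr_ae ?_
  filter_upwards [h0] with x hx
  by_cases hx0 : 0 < x
  · rw [Set.indicator_of_mem (Set.mem_Ioi.2 hx0)]
    by_cases hxy : y < x
    · rw [Set.indicator_of_mem (Set.mem_Ioi.2 hxy), Set.indicator_of_mem]
      · simp
      · exact ENNReal.ofReal_le_ofReal hxy.le
    · rw [Set.indicator_of_notMem (s := Set.Ioi y) hxy, Set.indicator_of_notMem, zero_mul]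
      exact fun h => hxy (lt_of_le_of_ne ((ENNReal.ofReal_le_ofReal_iff hx0.le).1 h) hx.symm)
  · rw [Set.indicator_of_notMem (s := Set.Ioi 0) hx0, Set.indicator_of_notMem]
    exact fun h => hx0 (hy.trans_lt h)

theorem lintegral_expNeg_expMeasure (a : ℝ≥0∞) :
    ∫⁻ x, expNeg (a * ENNReal.ofReal x) ∂expMeasure 1 = (1 + a)⁻¹ := by
  rw [lintegral_expMeasure (by fun_prop)]
  by_cases ha : a = ∞
  · subst ha
    rw [setLIntegral_congr_fun (g := fun _ => 0) measurableSet_Ioi]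
    · simp
    · intro x hx
      have : ENNReal.ofReal x ≠ 0 := (ENNReal.ofReal_pos.2 hx).ne'
      simp [ENNReal.top_mul this, expNeg_top]
  obtain ⟨y, hy, rfl⟩ : ∃ y : ℝ, 0 ≤ y ∧ a = ENNReal.ofReal y :=
    ⟨a.toReal, ENNReal.toReal_nonneg, (ENNReal.ofReal_toReal ha).symm⟩
  have h1 := lintegral_exp_neg_mul_Ioi (by linarith : 0 < 1 + y) 0
  rw [mul_zero, Real.exp_zero, one_div, ENNReal.ofReal_inv_of_pos (by linarith),
    ENNReal.ofReal_add zero_le_one hy, ENNReal.ofReal_one] at h1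
  rw [← h1]
  refine setLIntegral_congr_fun measurableSet_Ioi fun x hx => ?_
  have hx0 : 0 ≤ x := (Set.mem_Ioi.1 hx).le
  rw [← ENNReal.ofReal_mul hy, expNeg_ofReal (mul_nonneg hy hx0),
    ← ENNReal.ofReal_mul (Real.exp_pos _).le, ← Real.exp_add]
  congr 2; ring

section Fading

variable {Ω : Type*} [MeasurableSpace Ω] {Q : Measure Ω} [IsProbabilityMeasure Q]

/-- Given the interference `I`, the exponential tail of the signal gives `exp (-(b + I))`. Its mean
factorizes over the interferers into their Laplace transforms `(1 + a l)⁻¹`. -/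
theorem measure_add_sum_le_fading {F : ℕ → Ω → ℝ} (hF : ∀ l, Measurable (F l))
    (hlaw : ∀ l, Q.map (F l) = expMeasure 1) (hind : iIndepFun F Q) (b : ℝ≥0∞) (a : ℕ → ℝ≥0∞)
    (i : ℕ) (s : Finset ℕ) (hi : i ∉ s) :
    Q {ω | b + ∑ l ∈ s, a l * ENNReal.ofReal (F l ω) ≤ ENNReal.ofReal (F i ω)} =
      expNeg b * ∏ l ∈ s, (1 + a l)⁻¹ := by
  classical
  -- Signal and weighted interferers are put into one independent family, so that the sum over `s`
  -- is independent of the member `i`.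
  let g : ℕ → ℝ → ℝ≥0∞ := fun l x => if l = i then ENNReal.ofReal x else a l * ENNReal.ofReal x
  have hg : ∀ l, Measurable (g l) := fun l => by
    by_cases hl : l = i
    · simp only [g, hl, if_true]; fun_prop
    · simp only [g, hl, if_false]; fun_prop
  have hindg : iIndepFun (fun l => g l ∘ F l) Q := hind.comp g hg
  have hsum : ∀ ω, ∑ l ∈ s, a l * ENNReal.ofReal (F l ω) = (∑ l ∈ s, g l ∘ F l) ω := fun ω => by
    rw [Finset.sum_apply]
    refine Finset.sum_congr rfl fun l hl => ?_
    simp [g, ne_of_mem_of_not_mem hl hi]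
  have hYm : Measurable (∑ l ∈ s, g l ∘ F l) := by
    have : Measurable fun ω => ∑ l ∈ s, (g l ∘ F l) ω :=
      Finset.measurable_sum _ fun l _ => (hg l).comp (hF l)
    convert this using 1
    ext ω
    rw [Finset.sum_apply]
  have hYF : IndepFun (∑ l ∈ s, g l ∘ F l) (g i ∘ F i) Q :=
    hindg.indepFun_finsetSum_of_notMem (fun l => (hg l).comp (hF l)) hi
  have hset : MeasurableSet {z : ℝ≥0∞ × ℝ≥0∞ | b + z.1 ≤ z.2} :=
    measurableSet_le (by fun_prop) (by fun_prop)
  have h1 := lintegral_of_indepFun hYm ((hg i).comp (hF i)) hYF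
    (Φ := fun y z => {z : ℝ≥0∞ × ℝ≥0∞ | b + z.1 ≤ z.2}.indicator 1 (y, z))
    (measurable_one.indicator hset)
  have hmeas : MeasurableSet
      {ω | b + ∑ l ∈ s, a l * ENNReal.ofReal (F l ω) ≤ ENNReal.ofReal (F i ω)} :=
    measurableSet_le (by fun_prop) (by fun_prop)
  have h2 : Q {ω | b + ∑ l ∈ s, a l * ENNReal.ofReal (F l ω) ≤ ENNReal.ofReal (F i ω)} =
      ∫⁻ ω, {z : ℝ≥0∞ × ℝ≥0∞ | b + z.1 ≤ z.2}.indicator 1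
        ((∑ l ∈ s, g l ∘ F l) ω, (g i ∘ F i) ω) ∂Q := by
    rw [← lintegral_indicator_one hmeas]
    refine lintegral_congr fun ω => ?_
    simp [Set.indicator, ← hsum, g]
  have h3 : ∀ y, ∫⁻ ω, {z : ℝ≥0∞ × ℝ≥0∞ | b + z.1 ≤ z.2}.indicator 1 (y, (g i ∘ F i) ω) ∂Q =
      expNeg (b + y) := fun y => by
    rw [← expMeasure_tail, ← hlaw i, Measure.map_apply (hF i)
      (measurableSet_le measurable_const (by fun_prop)), ← lintegral_indicator_one
      ((hF i) (measurableSet_le measurable_const (by fun_prop)))]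
    refine lintegral_congr fun ω => ?_
    simp [Set.indicator, g]
  rw [h2, h1]
  simp_rw [h3, ← hsum, expNeg_add, expNeg_sum]
  have hm : Measurable fun ω => ∏ l ∈ s, expNeg (a l * ENNReal.ofReal (F l ω)) :=
    Finset.measurable_prod _ fun l _ => by fun_prop
  rw [lintegral_const_mul _ hm]
  have h4 := lintegral_finset_prod_of_iIndepFun (f := fun l ω => expNeg (a l * ENNReal.ofReal (F l ω)))
    (fun l => by fun_prop)
    (hind.comp (fun l x => expNeg (a l * ENNReal.ofReal x))
      (fun l => by fun_prop)) s
  rw [h4]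
  congr 1
  refine Finset.prod_congr rfl fun l _ => ?_
  rw [← lintegral_expNeg_expMeasure, ← hlaw l, lintegral_map
    (by fun_prop) (hF l)]

/-- The event that the signal `F i` exceeds noise plus interference. -/
def fadingEvent (b : ℝ≥0∞) (a : ℕ → ℝ≥0∞) (i : ℕ) : Set (ℕ → ℝ) :=
  {F | b + ∑' l, (if l = i then 0 else a l * ENNReal.ofReal (F l)) ≤ ENNReal.ofReal (F i)}

/-- The probability of `fadingEvent` under independent exponential fading. -/
noncomputable def fadingProb (b : ℝ≥0∞) (a : ℕ → ℝ≥0∞) (i : ℕ) : ℝ≥0∞ :=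
  expNeg b * infProd fun l => if l = i then 1 else (1 + a l)⁻¹

theorem measurableSet_fadingEvent (b : ℝ≥0∞) (a : ℕ → ℝ≥0∞) (i : ℕ) :
    MeasurableSet (fadingEvent b a i) := by
  refine measurableSet_le (measurable_const.add (Measurable.tsum fun l => ?_)) (by fun_prop)
  split_ifs <;> fun_prop

/-- The event with all interferers is the decreasing intersection of the events with finitely many,
so its probability is the limit of the finite products. -/
theorem measure_fadingEvent {F : ℕ → Ω → ℝ} (hF : ∀ l, Measurable (F l))
    (hlaw : ∀ l, Q.map (F l) = expMeasure 1) (hind : iIndepFun F Q) (b : ℝ≥0∞) (a : ℕ → ℝ≥0∞)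
    (i : ℕ) : Q {ω | (fun l => F l ω) ∈ fadingEvent b a i} = fadingProb b a i := by
  classical
  have hs : ∀ N (f : ℕ → ℝ≥0∞), ∑ l ∈ Finset.range N, (if l = i then 0 else f l) =
      ∑ l ∈ (Finset.range N).erase i, f l := fun N f => by
    rw [← Finset.filter_ne', Finset.sum_filter]
    exact Finset.sum_congr rfl fun l _ => by by_cases hl : l = i <;> simp [hl]
  have hpr : ∀ N (f : ℕ → ℝ≥0∞), ∏ l ∈ Finset.range N, (if l = i then 1 else f l) =
      ∏ l ∈ (Finset.range N).erase i, f l := fun N f => by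
    rw [← Finset.filter_ne', Finset.prod_filter]
    exact Finset.prod_congr rfl fun l _ => by by_cases hl : l = i <;> simp [hl]
  let S : ℕ → Set Ω := fun N => {ω | b + ∑ l ∈ (Finset.range N).erase i,
    a l * ENNReal.ofReal (F l ω) ≤ ENNReal.ofReal (F i ω)}
  have hSm : ∀ N, MeasurableSet (S N) := fun N => measurableSet_le (by fun_prop) (by fun_prop)
  have hSa : Antitone S := fun m n hmn ω hω => by
    refine le_trans (add_le_add_right (Finset.sum_le_sum_of_subset ?_) b) hω
    exact Finset.erase_subset_erase _ (Finset.range_mono hmn)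
  have hSi : {ω | (fun l => F l ω) ∈ fadingEvent b a i} = ⋂ N, S N := by
    ext ω
    simp only [fadingEvent, S, Set.mem_ofPred_eq, Set.mem_iInter]
    rw [ENNReal.tsum_eq_iSup_nat, ENNReal.add_iSup, iSup_le_iff]
    simp_rw [hs]
  rw [hSi]
  refine tendsto_nhds_unique (tendsto_measure_iInter_atTop (fun N => (hSm N).nullMeasurableSet) hSa
    ⟨0, measure_ne_top _ _⟩) ?_
  have h1 : ∀ N, Q (S N) = expNeg b * ∏ l ∈ Finset.range N, (if l = i then 1 else (1 + a l)⁻¹) :=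
    fun N => by
      rw [hpr]
      exact measure_add_sum_le_fading hF hlaw hind b a i _ (Finset.notMem_erase _ _)
  simp only [Function.comp_def, h1]
  refine ENNReal.Tendsto.const_mul (tendsto_infProd fun l => ?_) (Or.inr (expNeg_ne_top b))
  split_ifs
  · exact le_rfl
  · simp

/-- The probability that one of several independent attempts succeeds. -/
theorem measure_exists_fadingEvent {F : ℕ → ℕ → Ω → ℝ} (hF : ∀ n l, Measurable (F n l))
    (hlaw : ∀ n l, Q.map (F n l) = expMeasure 1)
    (hind : iIndepFun (fun (s : (_ : ℕ) × ℕ) ω => F s.1 s.2 ω) Q) (b : ℝ≥0∞) (a : ℕ → ℝ≥0∞)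
    (i τ : ℕ) :
    Q {ω | ∃ n ∈ Finset.Icc 1 τ, (fun l => F n l ω) ∈ fadingEvent b a i} =
      1 - (1 - fadingProb b a i) ^ τ := by
  have hc := iIndepFun_curry hF hind
  have hm : ∀ n, MeasurableSet {ω | (fun l => F n l ω) ∈ fadingEvent b a i} := fun n =>
    (measurable_pi_lambda _ (hF n)) (measurableSet_fadingEvent b a i)
  have hQ : ∀ n, Q {ω | (fun l => F n l ω) ∈ fadingEvent b a i} = fadingProb b a i := fun n =>
    measure_fadingEvent (hF n) (hlaw n) (hind.precomp (g := fun l => (⟨n, l⟩ : (_ : ℕ) × ℕ))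
      fun a b hab => by simpa using hab) b a i
  have hcompl : {ω | ∃ n ∈ Finset.Icc 1 τ, (fun l => F n l ω) ∈ fadingEvent b a i} =
      (⋂ n ∈ Finset.Icc 1 τ, {ω | (fun l => F n l ω) ∈ fadingEvent b a i}ᶜ)ᶜ := by
    ext ω; simp
  rw [hcompl, prob_compl_eq_one_sub (Finset.measurableSet_biInter _ fun n _ => (hm n).compl),
    hc.meas_biInter (s := fun n => {ω | (fun l => F n l ω) ∈ fadingEvent b a i}ᶜ) fun n _ =>
      ⟨(fadingEvent b a i)ᶜ, (measurableSet_fadingEvent b a i).compl, rfl⟩]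
  simp_rw [prob_compl_eq_one_sub (hm _), hQ]
  simp

end Fading

/-! ### Polar coordinates and the integrals `K`, `H` and Rayleigh -/

/-- A measure on the line is determined by its values on half-open intervals, and here these are the
areas `π (b² - a²)` of annuli. -/
theorem map_norm_volume_plane :
    (volume : Measure Plane).map (fun y => ‖y‖) =
      (volume.restrict (Set.Ioi (0 : ℝ))).withDensity fun r => ENNReal.ofReal (2 * Real.pi * r) := by
  have hpre : ∀ a b : ℝ, (fun y : Plane => ‖y‖) ⁻¹' Set.Ioc a b =
      Metric.closedBall 0 b \ Metric.closedBall 0 a := fun a b => by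
    ext y; simp [and_comm]
  have hmap : ∀ a b : ℝ, (volume : Measure Plane).map (fun y => ‖y‖) (Set.Ioc a b) =
      volume (Metric.closedBall (0 : Plane) b \ Metric.closedBall 0 a) := fun a b => by
    rw [Measure.map_apply measurable_norm measurableSet_Ioc, hpre]
  refine Measure.ext_of_Ioc' _ _ (fun a b _ => ?_) fun a b hab => ?_
  · rw [hmap]
    exact measure_ne_top_of_subset Set.sdiff_subset (measure_closedBall_lt_top (μ := volume)).ne
  · rw [hmap, measure_sdiff (Metric.closedBall_subset_closedBall hab.le)
      measurableSet_closedBall.nullMeasurableSet (measure_closedBall_lt_top (μ := volume)).ne,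
      EuclideanSpace.volume_closedBall_fin_two, EuclideanSpace.volume_closedBall_fin_two,
      withDensity_apply _ measurableSet_Ioc, Measure.restrict_restrict measurableSet_Ioc,
      Set.Ioc_inter_Ioi]
    rcases le_or_gt b 0 with hb | hb
    · rw [Set.Ioc_eq_empty (by simp [hb]), ENNReal.ofReal_of_nonpos hb]
      simp
    · have hm : max a 0 ≤ b := max_le hab.le hb.le
      have hm0 : 0 ≤ max a 0 := le_max_right _ _
      -- A negative inner radius acts like radius `0`.
      have h1 : ENNReal.ofReal a = ENNReal.ofReal (max a 0) := by simp
      rw [h1, ← ofReal_integral_eq_lintegral_ofReal, ← intervalIntegral.integral_of_le hm,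
        intervalIntegral.integral_const_mul, integral_id, ← ENNReal.ofReal_pow hb.le,
        ← ENNReal.ofReal_pow hm0, ← ENNReal.ofReal_mul (by positivity),
        ← ENNReal.ofReal_mul (by positivity), ← ENNReal.ofReal_sub _ (by positivity)]
      · congr 1; ring
      · exact (continuous_const.mul continuous_id).integrableOn_Ioc
      · refine (ae_restrict_iff' measurableSet_Ioc).2 (ae_of_all _ fun x hx => ?_)
        have : 0 ≤ x := hm0.trans hx.1.le
        simp only [Pi.zero_apply]
        positivity

theorem lintegral_plane_norm {f : ℝ → ℝ≥0∞} (hf : Measurable f) :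
    ∫⁻ y : Plane, f ‖y‖ = ∫⁻ r in Set.Ioi 0, ENNReal.ofReal (2 * Real.pi * r) * f r := by
  rw [← lintegral_map (f := f) (g := fun y : Plane => ‖y‖) hf measurable_norm,
    map_norm_volume_plane, lintegral_withDensity_eq_lintegral_mul _ (by fun_prop) hf]
  rfl

/-- The Laplace transform, at `c`, of the power received over distance `s`. -/
noncomputable def attenuation (α c s : ℝ) : ℝ≥0∞ :=
  (1 + ENNReal.ofReal c / ENNReal.ofReal (s ^ α))⁻¹

theorem attenuation_le_one (α c s : ℝ) : attenuation α c s ≤ 1 := by simp [attenuation]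

theorem measurable_attenuation (α c : ℝ) : Measurable (attenuation α c) := by
  unfold attenuation; fun_prop

theorem attenuation_of_pos {α c s : ℝ} (hc : 0 ≤ c) (hs : 0 < s) :
    attenuation α c s = ENNReal.ofReal (1 / (1 + c * s ^ (-α))) := by
  have h1 : 0 < s ^ α := Real.rpow_pos_of_pos hs α
  rw [attenuation, ← ENNReal.ofReal_div_of_pos h1, ← ENNReal.ofReal_one,
    ← ENNReal.ofReal_add zero_le_one (by positivity), ← ENNReal.ofReal_inv_of_pos (by positivity),
    Real.rpow_neg hs.le, one_div, div_eq_mul_inv]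

theorem continuous_attenuation {α c : ℝ} (hα : 0 < α) : Continuous (attenuation α c) := by
  unfold attenuation
  have h1 : Continuous fun s : ℝ => ENNReal.ofReal (s ^ α) :=
    ENNReal.continuous_ofReal.comp (Real.continuous_rpow_const hα.le)
  have h2 : Continuous fun s : ℝ => ENNReal.ofReal c / ENNReal.ofReal (s ^ α) := by
    simp_rw [div_eq_mul_inv]
    exact (ENNReal.continuous_const_mul ENNReal.ofReal_ne_top).comp h1.inv
  exact (continuous_const.add h2).inv

theorem attenuation_mono {α c s s' : ℝ} (hα : 0 < α) (hs : 0 ≤ s) (h : s ≤ s') :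
    attenuation α c s ≤ attenuation α c s' := by
  unfold attenuation
  refine ENNReal.inv_le_inv.2 (add_le_add_right (ENNReal.div_le_div_left ?_ _) _)
  exact ENNReal.ofReal_le_ofReal (Real.rpow_le_rpow hs h hα.le)

theorem attenuation_anti {α c c' s : ℝ} (h : c ≤ c') : attenuation α c' s ≤ attenuation α c s := by
  unfold attenuation
  exact ENNReal.inv_le_inv.2 (add_le_add_right
    (ENNReal.div_le_div_right (ENNReal.ofReal_le_ofReal h) _) _)

theorem attenuation_zero (α s : ℝ) : attenuation α 0 s = 1 := by simp [attenuation]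

/-- Near `0` the bracket is at most `n t`, leaving `t ^ (-2/α)` with `2/α < 1`; at infinity it is at
most `1`, leaving the integrable `t ^ (-2/α - 1)`. -/
theorem integrableOn_Kfun {α : ℝ} (hα : 2 < α) (n : ℕ) :
    IntegrableOn (fun t : ℝ => t ^ (-(2 / α) - 1) * (1 - 1 / (1 + t) ^ n)) (Set.Ioi 0) := by
  have h2 : 0 < 2 / α := by positivity
  have h3 : 2 / α < 1 := (div_lt_one (by linarith)).2 hα
  have hm : Measurable fun t : ℝ => t ^ (-(2 / α) - 1) * (1 - 1 / (1 + t) ^ n) := by fun_prop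
  have h01 : ∀ t : ℝ, 0 < t → 0 ≤ 1 - 1 / (1 + t) ^ n ∧ 1 - 1 / (1 + t) ^ n ≤ 1 ∧
      1 - 1 / (1 + t) ^ n ≤ n * t := fun t ht => by
    have hp : 0 < (1 + t) ^ n := by positivity
    have h1 : 1 ≤ (1 + t) ^ n := one_le_pow₀ (by linarith)
    refine ⟨?_, ?_, ?_⟩
    · rw [sub_nonneg, div_le_one hp]; exact h1
    · have : 0 ≤ 1 / (1 + t) ^ n := by positivity
      linarith
    · have hb := one_add_mul_le_pow (a := -(t / (1 + t))) (by
        have : t / (1 + t) ≤ 1 := (div_le_one (by linarith)).2 (by linarith)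
        linarith) n
      have he : (1 + -(t / (1 + t))) = (1 + t)⁻¹ := by field_simp; ring
      rw [he, inv_pow, ← one_div] at hb
      have h4 : t / (1 + t) ≤ t := div_le_self ht.le (by linarith)
      nlinarith [Nat.cast_nonneg (α := ℝ) n, mul_le_mul_of_nonneg_left h4 (Nat.cast_nonneg (α := ℝ) n)]
  rw [← Set.Ioc_union_Ioi_eq_Ioi zero_le_one]
  refine IntegrableOn.union ?_ ?_
  · have hi : IntegrableOn (fun t : ℝ => n * t ^ (-(2 / α))) (Set.Ioc 0 1) := by
      refine Integrable.const_mul ?_ _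
      rw [← IntegrableOn, ← intervalIntegrable_iff_integrableOn_Ioc_of_le zero_le_one]
      exact intervalIntegral.intervalIntegrable_rpow' (by linarith)
    refine Integrable.mono' hi hm.aestronglyMeasurable ?_
    refine (ae_restrict_iff' measurableSet_Ioc).2 (ae_of_all _ fun t ht => ?_)
    have hp : 0 ≤ t ^ (-(2 / α) - 1) := Real.rpow_nonneg ht.1.le _
    obtain ⟨h4, h5, h6⟩ := h01 t ht.1
    rw [Real.norm_eq_abs, abs_of_nonneg (mul_nonneg hp h4)]
    calc _ ≤ t ^ (-(2 / α) - 1) * (n * t) := mul_le_mul_of_nonneg_left h6 hp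
      _ = n * (t ^ (-(2 / α) - 1) * t) := by ring
      _ = n * t ^ (-(2 / α)) := by
        rw [Real.rpow_sub_one ht.1.ne', div_mul_cancel₀ _ ht.1.ne']
  · refine Integrable.mono' (integrableOn_Ioi_rpow_of_lt (a := -(2 / α) - 1) (by linarith) one_pos)
      hm.aestronglyMeasurable ?_
    refine (ae_restrict_iff' measurableSet_Ioi).2 (ae_of_all _ fun t ht => ?_)
    have ht0 : 0 < t := one_pos.trans ht
    have hp : 0 ≤ t ^ (-(2 / α) - 1) := Real.rpow_nonneg ht0.le _
    obtain ⟨h4, h5, h6⟩ := h01 t ht0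
    rw [Real.norm_eq_abs, abs_of_nonneg (mul_nonneg hp h4)]
    exact mul_le_of_le_one_right hp h5

theorem Kfun_nonneg (α : ℝ) (hα : 2 < α) (n : ℕ) : 0 ≤ Kfun α n := by
  unfold Kfun
  refine mul_nonneg (by positivity) (setIntegral_nonneg measurableSet_Ioi fun t ht => ?_)
  have ht0 : 0 < t := ht
  refine mul_nonneg (Real.rpow_nonneg ht0.le _) ?_
  rw [sub_nonneg, div_le_one (by positivity)]
  exact one_le_pow₀ (by linarith)

/-- In polar coordinates, the substitution `t = c s ^ (-α)` maps the half-line onto itself and pulls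
out the factor `c ^ (2/α)`. -/
theorem lintegral_one_sub_attenuation_pow {α c : ℝ} (hα : 2 < α) (hc : 0 ≤ c) (n : ℕ) :
    ∫⁻ y : Plane, 1 - attenuation α c ‖y‖ ^ n = ENNReal.ofReal (Kfun α n * c ^ (2 / α)) := by
  have hα0 : 0 < α := by linarith
  rcases hc.eq_or_lt with rfl | hc
  · rw [Real.zero_rpow (by positivity)]
    simp [attenuation_zero]
  let G : ℝ → ℝ := fun t => t ^ (-(2 / α) - 1) * (1 - 1 / (1 + t) ^ n)
  have hG0 : ∀ t, 0 < t → 0 ≤ G t := fun t ht => by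
    refine mul_nonneg (Real.rpow_nonneg ht.le _) ?_
    rw [sub_nonneg, div_le_one (by positivity)]
    exact one_le_pow₀ (by linarith)
  have himg : (fun s : ℝ => c * s ^ (-α)) '' Set.Ioi 0 = Set.Ioi 0 := by
    ext t
    constructor
    · rintro ⟨s, hs, rfl⟩
      exact mul_pos hc (Real.rpow_pos_of_pos hs _)
    · intro ht
      have ht' : 0 < t / c := div_pos ht hc
      refine ⟨(t / c) ^ (-α)⁻¹, Real.rpow_pos_of_pos ht' _, ?_⟩
      dsimp only
      rw [← Real.rpow_mul ht'.le, inv_mul_cancel₀ (by linarith), Real.rpow_one]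
      field_simp
  have hcv := lintegral_image_eq_lintegral_abs_deriv_mul (s := Set.Ioi (0 : ℝ))
    (f := fun s : ℝ => c * s ^ (-α)) (f' := fun s => c * (-α * s ^ (-α - 1))) measurableSet_Ioi
    (fun s hs => ((Real.hasDerivAt_rpow_const (Or.inl (Set.mem_Ioi.1 hs).ne')).const_mul
      c).hasDerivWithinAt) (fun s hs s' hs' h => by
        have h1 : s ^ (-α) = s' ^ (-α) := mul_left_cancel₀ hc.ne' h
        exact (Real.rpow_left_inj (Set.mem_Ioi.1 hs).le (Set.mem_Ioi.1 hs').le (by linarith)).1 h1)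
    (fun t => ENNReal.ofReal (G t))
  rw [himg] at hcv
  have hK : ENNReal.ofReal (Kfun α n) =
      ENNReal.ofReal (2 * Real.pi / α) * ∫⁻ t in Set.Ioi (0 : ℝ), ENNReal.ofReal (G t) := by
    rw [Kfun, ENNReal.ofReal_mul (by positivity), ofReal_integral_eq_lintegral_ofReal
      (integrableOn_Kfun hα n) ((ae_restrict_iff' measurableSet_Ioi).2 (ae_of_all _ hG0))]
  rw [lintegral_plane_norm (f := fun s => 1 - attenuation α c s ^ n)
    (measurable_const.sub ((measurable_attenuation α c).pow_const n)),
    mul_comm (Kfun α n),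
    ENNReal.ofReal_mul (by positivity), hK, hcv, ← lintegral_const_mul' _ _ ENNReal.ofReal_ne_top,
    ← lintegral_const_mul' _ _ ENNReal.ofReal_ne_top]
  refine setLIntegral_congr_fun measurableSet_Ioi fun s hs => ?_
  have hs0 : 0 < s := hs
  have hsα : 0 < s ^ (-α) := Real.rpow_pos_of_pos hs0 _
  have hp1 : 1 / (1 + c * s ^ (-α)) ^ n ≤ 1 := by
    rw [div_le_one (by positivity)]
    exact one_le_pow₀ (by nlinarith)
  rw [attenuation_of_pos hc.le hs0, ← ENNReal.ofReal_pow (by positivity), ← ENNReal.ofReal_one,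
    ← ENNReal.ofReal_sub _ (by positivity), ← ENNReal.ofReal_mul (by positivity),
    ← ENNReal.ofReal_mul (by positivity), ← ENNReal.ofReal_mul (by positivity),
    ← ENNReal.ofReal_mul (by positivity)]
  congr 1
  have habs : |c * (-α * s ^ (-α - 1))| = c * (α * s ^ (-α - 1)) := by
    have := Real.rpow_pos_of_pos hs0 (-α - 1)
    rw [show c * (-α * s ^ (-α - 1)) = -(c * (α * s ^ (-α - 1))) by ring, abs_neg,
      abs_of_pos (by positivity)]
  have hG : G (c * s ^ (-α)) = c ^ (-(2 / α) - 1) * (s ^ (2 + α)) *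
      (1 - 1 / (1 + c * s ^ (-α)) ^ n) := by
    simp only [G]
    rw [Real.mul_rpow hc.le hsα.le, ← Real.rpow_mul hs0.le]
    congr 3
    field_simp
    ring
  have hcc : c ^ (2 / α) * (c * c ^ (-(2 / α) - 1)) = 1 := by
    rw [Real.rpow_sub_one hc.ne', mul_div_cancel₀ _ hc.ne', ← Real.rpow_add hc]
    simp
  have hss : s ^ (-α - 1) * s ^ (2 + α) = s := by
    rw [← Real.rpow_add hs0]; ring_nf; simp
  rw [habs, hG, div_pow, one_pow]
  calc _ = 2 * Real.pi * s * (1 - 1 / (1 + c * s ^ (-α)) ^ n) := by ring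
    _ = 2 * Real.pi * (s ^ (-α - 1) * s ^ (2 + α)) * (c ^ (2 / α) * (c * c ^ (-(2 / α) - 1))) *
        (1 - 1 / (1 + c * s ^ (-α)) ^ n) := by rw [hss, hcc]; ring
    _ = _ := by field_simp

theorem integrableOn_Hfun {T α : ℝ} (hT : 0 < T) (hα : 2 < α) :
    IntegrableOn (fun x : ℝ => x / (1 + x ^ α / T)) (Set.Ioi 1) := by
  have hm : Measurable fun x : ℝ => x / (1 + x ^ α / T) := by fun_prop
  refine Integrable.mono' ((integrableOn_Ioi_rpow_of_lt (a := 1 - α) (by linarith) one_pos).const_mul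
    T) hm.aestronglyMeasurable ?_
  refine (ae_restrict_iff' measurableSet_Ioi).2 (ae_of_all _ fun x hx => ?_)
  have hx0 : 0 < x := one_pos.trans hx
  have hp : 0 < x ^ α := Real.rpow_pos_of_pos hx0 _
  rw [Real.norm_eq_abs, abs_of_nonneg (by positivity), Real.rpow_sub hx0, Real.rpow_one]
  calc x / (1 + x ^ α / T) ≤ x / (x ^ α / T) :=
        div_le_div_of_nonneg_left hx0.le (by positivity) (by linarith)
    _ = T * (x / x ^ α) := by field_simp

theorem Hfun_nonneg {T α : ℝ} (hT : 0 < T) : 0 ≤ Hfun T α :=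
  setIntegral_nonneg measurableSet_Ioi fun x hx => by
    have hx0 : 0 < x := one_pos.trans hx
    have hp : 0 < x ^ α := Real.rpow_pos_of_pos hx0 _
    positivity

/-- The open disc of radius `r`, where the kernel vanishes, contributes `π r²`. Outside it the
scaling `s = r x` turns `T r ^ α s ^ (-α)` into `T / x ^ α`, so the integral is `r²` times a
constant, namely `2π H`. -/
theorem lintegral_one_sub_attenuation_far {T α r : ℝ} (hT : 0 < T) (hα : 2 < α) (hr : 0 ≤ r) :
    ∫⁻ y : Plane, 1 - (if r ≤ ‖y‖ then attenuation α (T * r ^ α) ‖y‖ else 0) =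
      ENNReal.ofReal (Real.pi * r ^ 2 + 2 * Real.pi * Hfun T α * r ^ 2) := by
  have hα0 : 0 < α := by linarith
  rcases hr.eq_or_lt with rfl | hr
  · simp [Real.zero_rpow hα0.ne', attenuation_zero]
  have hH := Hfun_nonneg (α := α) hT
  -- The null sphere is split off so that the exterior is the open half-line on which `H` is
  -- defined.
  have hsplit : ∀ y : Plane, 1 - (if r ≤ ‖y‖ then attenuation α (T * r ^ α) ‖y‖ else 0) =
      (Metric.ball (0 : Plane) r).indicator 1 y +
        (Set.Ioi r).indicator (fun s => 1 - attenuation α (T * r ^ α) s) ‖y‖ +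
        (Metric.sphere (0 : Plane) r).indicator
          (fun y => 1 - attenuation α (T * r ^ α) ‖y‖) y := by
    intro y
    rcases lt_trichotomy ‖y‖ r with h | h | h
    · simp [h, h.not_ge, h.le, h.ne]
    · simp [h]
    · simp [h, h.le, h.ne']
  have hm : Measurable fun s => 1 - attenuation α (T * r ^ α) s :=
    measurable_const.sub (measurable_attenuation _ _)
  have hsph : ∫⁻ y : Plane, (Metric.sphere (0 : Plane) r).indicator
      (fun y => 1 - attenuation α (T * r ^ α) ‖y‖) y = 0 := by
    rw [lintegral_indicator Metric.isClosed_sphere.measurableSet]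
    exact setLIntegral_measure_zero _ _ (Measure.addHaar_sphere _ _ _)
  simp_rw [hsplit]
  have hm1 : Measurable fun y : Plane => (Metric.ball (0 : Plane) r).indicator (1 : Plane → ℝ≥0∞) y +
      (Set.Ioi r).indicator (fun s => 1 - attenuation α (T * r ^ α) s) ‖y‖ :=
    (measurable_one.indicator measurableSet_ball).add
      ((hm.indicator measurableSet_Ioi).comp measurable_norm)
  rw [lintegral_add_left hm1, lintegral_add_left (measurable_one.indicator measurableSet_ball), hsph,
    add_zero, lintegral_indicator_one measurableSet_ball, EuclideanSpace.volume_ball_fin_two,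
    lintegral_plane_norm (hm.indicator measurableSet_Ioi), ENNReal.ofReal_add (by positivity)
    (by positivity), mul_comm Real.pi (r ^ 2), ENNReal.ofReal_mul (by positivity),
    ENNReal.ofReal_pow hr.le]
  congr 1
  have himg : (fun s : ℝ => r * s) '' Set.Ioi 1 = Set.Ioi r := by
    rw [Set.image_mul_left_Ioi hr, mul_one]
  have hcv := lintegral_image_eq_lintegral_abs_deriv_mul (s := Set.Ioi (1 : ℝ))
    (f := fun s : ℝ => r * s) (f' := fun s => r * 1) measurableSet_Ioi
    (fun s _ => ((hasDerivAt_id s).const_mul r).hasDerivWithinAt)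
    (fun s _ s' _ h => mul_left_cancel₀ hr.ne' h)
    (fun s => ENNReal.ofReal (2 * Real.pi * s) * (1 - attenuation α (T * r ^ α) s))
  rw [himg] at hcv
  have h1 : ∫⁻ s in Set.Ioi 0, ENNReal.ofReal (2 * Real.pi * s) *
      (Set.Ioi r).indicator (fun s => 1 - attenuation α (T * r ^ α) s) s =
      ∫⁻ s in Set.Ioi r, ENNReal.ofReal (2 * Real.pi * s) *
        (1 - attenuation α (T * r ^ α) s) := by
    rw [← lintegral_indicator measurableSet_Ioi, ← lintegral_indicator measurableSet_Ioi]
    refine lintegral_congr fun s => ?_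
    by_cases hs : r < s
    · have : 0 < s := hr.trans hs
      simp [hs, this]
    · by_cases hs0 : 0 < s <;> simp [hs, hs0]
  rw [h1, hcv, show 2 * Real.pi * Hfun T α * r ^ 2 = (2 * Real.pi * r ^ 2) * Hfun T α by ring,
    ENNReal.ofReal_mul (by positivity), Hfun, ofReal_integral_eq_lintegral_ofReal
      (integrableOn_Hfun hT hα) ((ae_restrict_iff' measurableSet_Ioi).2 (ae_of_all _ fun x hx => by
        have hx0 : 0 < x := one_pos.trans hx
        have hp : 0 < x ^ α := Real.rpow_pos_of_pos hx0 _
        simp only [Pi.zero_apply]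
        positivity)), ← lintegral_const_mul' _ _ ENNReal.ofReal_ne_top]
  refine setLIntegral_congr_fun measurableSet_Ioi fun x hx => ?_
  have hx0 : 0 < x := one_pos.trans hx
  have hxα : 0 < x ^ α := Real.rpow_pos_of_pos hx0 _
  have hrα : 0 < r ^ α := Real.rpow_pos_of_pos hr _
  have hq : T * r ^ α * (r * x) ^ (-α) = T / x ^ α := by
    rw [Real.mul_rpow hr.le hx0.le, Real.rpow_neg hr.le, Real.rpow_neg hx0.le]
    field_simp
  rw [attenuation_of_pos (by positivity) (mul_pos hr hx0), hq, mul_one, abs_of_pos hr,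
    ← ENNReal.ofReal_one, ← ENNReal.ofReal_sub _ (by positivity), ← ENNReal.ofReal_mul (by positivity),
    ← ENNReal.ofReal_mul (by positivity), ← ENNReal.ofReal_mul (by positivity)]
  congr 1
  field_simp
  ring

/-- The planar density `λ exp (-λ π |x|²)` of the point nearest to the origin has the Rayleigh law
as its radial part. In this form the law appears when the serving station is integrated out. -/
theorem lintegral_rayleighLaw {lam : ℝ} (hl : 0 < lam) {f : ℝ → ℝ≥0∞} (hf : Measurable f) :
    ∫⁻ r, f r ∂rayleighLaw lam = ENNReal.ofReal lam *
      ∫⁻ x : Plane, f ‖x‖ * expNeg (ENNReal.ofReal lam * ENNReal.ofReal (Real.pi * ‖x‖ ^ 2)) := by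
  rw [lintegral_plane_norm (f := fun r => f r * expNeg (ENNReal.ofReal lam *
      ENNReal.ofReal (Real.pi * r ^ 2))) (by fun_prop), rayleighLaw,
    lintegral_withDensity_eq_lintegral_mul _ (by fun_prop) hf,
    setLIntegral_congr Ioi_ae_eq_Ici.symm, ← lintegral_const_mul' _ _ ENNReal.ofReal_ne_top]
  refine setLIntegral_congr_fun measurableSet_Ioi fun r hr => ?_
  have hr0 : 0 < r := hr
  rw [Pi.mul_apply, ← ENNReal.ofReal_mul hl.le, expNeg_ofReal (by positivity)]
  rw [show 2 * Real.pi * lam * r * Real.exp (-(lam * Real.pi * r ^ 2)) =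
    lam * (2 * Real.pi * r) * Real.exp (-(lam * (Real.pi * r ^ 2))) by ring_nf,
    ENNReal.ofReal_mul (by positivity), ENNReal.ofReal_mul hl.le]
  ring

theorem isProbabilityMeasure_rayleighLaw {lam : ℝ} (hl : 0 < lam) :
    IsProbabilityMeasure (rayleighLaw lam) := by
  refine ⟨?_⟩
  have hb : 0 < lam * Real.pi := by positivity
  have h := GaussianFourier.integral_rexp_neg_mul_sq_norm (V := Plane) hb
  have hi := Integrable.of_integral_ne_zero (h ▸ (by positivity :
    (Real.pi / (lam * Real.pi)) ^ (Module.finrank ℝ Plane / 2 : ℝ) ≠ 0))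
  rw [← lintegral_one, lintegral_rayleighLaw hl measurable_const]
  have h1 : ∀ x : Plane, 1 * expNeg (ENNReal.ofReal lam * ENNReal.ofReal (Real.pi * ‖x‖ ^ 2)) =
      ENNReal.ofReal (Real.exp (-(lam * Real.pi) * ‖x‖ ^ 2)) := fun x => by
    rw [one_mul, ← ENNReal.ofReal_mul hl.le, expNeg_ofReal (by positivity)]
    congr 2; ring
  simp_rw [h1]
  rw [← ofReal_integral_eq_lintegral_ofReal hi (ae_of_all _ fun x => (Real.exp_pos _).le), h,
    ← ENNReal.ofReal_mul hl.le]
  simp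
  field_simp

/-! ### Measurability of the network functionals -/

section Measurability

@[fun_prop]
theorem measurable_bs : Measurable Config.bs := measurable_coords.fst

@[fun_prop]
theorem measurable_tx : Measurable Config.tx := measurable_coords.snd.fst

@[fun_prop]
theorem measurable_num : Measurable Config.num := measurable_coords.snd.snd.fst

@[fun_prop]
theorem measurable_rx : Measurable Config.rx := measurable_coords.snd.snd.snd.fst

@[fun_prop]
theorem measurable_coin : Measurable Config.coin := measurable_coords.snd.snd.snd.snd.fst

@[fun_prop]
theorem measurable_fadeD : Measurable Config.fadeD := measurable_coords.snd.snd.snd.snd.snd.fst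

@[fun_prop]
theorem measurable_fadeC : Measurable Config.fadeC := measurable_coords.snd.snd.snd.snd.snd.snd

theorem measurable_configMk {Ω : Type*} [MeasurableSpace Ω] {b t : Ω → ℕ → Plane} {n : Ω → ℕ → ℕ}
    {r : Ω → ℕ → ℕ → Plane} {u : Ω → ℕ → ℝ} {d : Ω → ℕ → ℕ → ℕ → ℕ → ℝ} {e : Ω → ℕ → ℕ → ℕ → ℝ}
    (hb : Measurable b) (ht : Measurable t) (hn : Measurable n) (hr : Measurable r)
    (hu : Measurable u) (hd : Measurable d) (he : Measurable e) :
    Measurable fun ω => (⟨b ω, t ω, n ω, r ω, u ω, d ω, e ω⟩ : Config) :=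
  measurable_comap_iff.2 (hb.prodMk (ht.prodMk (hn.prodMk (hr.prodMk (hu.prodMk (hd.prodMk he))))))

theorem measurable_bs_apply (j : ℕ) : Measurable fun c : Config => c.bs j := by fun_prop

theorem measurable_tx_apply (i : ℕ) : Measurable fun c : Config => c.tx i := by fun_prop

theorem measurable_sinrD (p : Params) (i k n : ℕ) : Measurable fun c => sinrD p c i k n := by
  unfold sinrD rxPower pathLoss
  refine Measurable.div (by fun_prop) (Measurable.const_add (Measurable.tsum fun l => ?_) _)
  split_ifs <;> fun_prop

theorem measurable_sinrC (p : Params) (i k j : ℕ) : Measurable fun c => sinrC p c i k j := by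
  unfold sinrC rxPower pathLoss
  refine Measurable.div (by fun_prop) (Measurable.const_add (Measurable.tsum fun l => ?_) _)
  split_ifs <;> fun_prop

theorem measurableSet_coveredD (p : Params) (i k : ℕ) : MeasurableSet {c | CoveredD p c i k} := by
  have : {c | CoveredD p c i k} =
      ⋃ n ∈ Finset.Icc 1 p.τ, {c | ENNReal.ofReal p.T ≤ sinrD p c i k n} := by
    ext c; simp [CoveredD]
  rw [this]
  exact Finset.measurableSet_biUnion _ fun n _ =>
    measurableSet_le measurable_const (measurable_sinrD p i k n)

theorem measurableSet_voronoi {v : Config → Plane} (hv : Measurable v) (i : ℕ) :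
    MeasurableSet {c : Config | c.tx i ∈ voronoiCell c.bs (v c)} := by
  have : {c : Config | c.tx i ∈ voronoiCell c.bs (v c)} =
      ⋂ j, {c | ‖c.tx i - v c‖ ≤ ‖c.tx i - c.bs j‖} := by
    ext c; simp [voronoiCell]
  rw [this]
  exact MeasurableSet.iInter fun j => measurableSet_le (by fun_prop) (by fun_prop)

theorem measurableSet_covered (p : Params) {g : ℝ → ℝ} (hg : Measurable g) (i k : ℕ) :
    MeasurableSet {c | Covered p g c i k} := by
  have : {c | Covered p g c i k} = {c | CoveredD p c i k} ∪
      ⋃ j, ({c : Config | c.tx i ∈ voronoiCell c.bs (c.bs j)} ∩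
        {c | c.coin i < g ‖c.tx i - c.bs j‖}) ∩ {c | ENNReal.ofReal p.T ≤ sinrC p c i k j} := by
    ext c; simp [Covered, Assists]
  rw [this]
  exact (measurableSet_coveredD p i k).union (MeasurableSet.iUnion fun j =>
    ((measurableSet_voronoi (measurable_bs_apply j) i).inter
      (measurableSet_lt (by fun_prop) (by fun_prop))).inter
        (measurableSet_le measurable_const (measurable_sinrC p i k j)))

theorem measurable_cellSum {f : Config → ℕ → ℝ≥0∞} (hf : ∀ i, Measurable fun c => f c i) :
    Measurable fun c => cellSum c (f c) := by
  classical
  unfold cellSum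
  exact Measurable.tsum fun i =>
    Measurable.ite (measurableSet_voronoi measurable_const i) (hf i) measurable_const

theorem sum_range_eq_tsum_ite (n : ℕ) (f : ℕ → ℝ≥0∞) :
    ∑ k ∈ Finset.range n, f k = ∑' k, if k < n then f k else 0 := by
  rw [tsum_eq_sum (s := Finset.range n) (by simp +contextual)]
  exact Finset.sum_congr rfl fun k hk => by rw [if_pos (Finset.mem_range.1 hk)]

/-- The random range of summation is traded for a fixed series with indicator factors. -/
theorem measurable_sum_num {f : Config → ℕ → ℝ≥0∞} (hf : ∀ k, Measurable fun c => f c k) (i : ℕ) :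
    Measurable fun c : Config => ∑ k ∈ Finset.range (c.num i), f c k := by
  simp_rw [sum_range_eq_tsum_ite]
  exact Measurable.tsum fun k => Measurable.ite
    (measurableSet_lt measurable_const (by fun_prop)) (hf k) measurable_const

theorem measurable_countRx {Q : Config → ℕ → Prop} (hQ : ∀ k, MeasurableSet {c | Q c k}) (i : ℕ) :
    Measurable fun c => countRx c i (Q c) := by
  classical
  unfold countRx
  exact measurable_sum_num (fun k => Measurable.ite (hQ k) measurable_const measurable_const) i

end Measurability

/-! ### Resampling independent components of the network -/

section Resampling

variable {Ω : Type*} [MeasurableSpace Ω] {Q : Measure Ω} [IsProbabilityMeasure Q]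

theorem map_prod_prod_comm {α₁ α₂ β₁ β₂ : Type*} [MeasurableSpace α₁] [MeasurableSpace α₂]
    [MeasurableSpace β₁] [MeasurableSpace β₂] (a₁ : Measure α₁) (a₂ : Measure α₂) (b₁ : Measure β₁)
    (b₂ : Measure β₂) [SFinite a₁] [SFinite a₂] [SFinite b₁] [SFinite b₂] :
    ((a₁.prod a₂).prod (b₁.prod b₂)).map (fun z => ((z.1.1, z.2.1), (z.1.2, z.2.2))) =
      (a₁.prod b₁).prod (a₂.prod b₂) := by
  refine Measure.ext_of_lintegral _ fun Φ hΦ => ?_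
  have hσ : Measurable fun z : (α₁ × α₂) × (β₁ × β₂) =>
      (((z.1.1, z.2.1), (z.1.2, z.2.2)) : (α₁ × β₁) × (α₂ × β₂)) := by fun_prop
  rw [lintegral_map hΦ hσ, lintegral_prod _ (by fun_prop), lintegral_prod _ (by fun_prop),
    lintegral_prod _ hΦ.aemeasurable, lintegral_prod _ (by fun_prop)]
  refine lintegral_congr fun x => ?_
  have h1 : ∀ y, ∫⁻ z, Φ ((x, z.1), (y, z.2)) ∂(b₁.prod b₂) =
      ∫⁻ u, ∫⁻ v, Φ ((x, u), (y, v)) ∂b₂ ∂b₁ := fun y => lintegral_prod _ (by fun_prop)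
  have h2 : ∀ u, ∫⁻ z, Φ ((x, u), z) ∂(a₂.prod b₂) =
      ∫⁻ y, ∫⁻ v, Φ ((x, u), (y, v)) ∂b₂ ∂a₂ := fun u => lintegral_prod _ (by fun_prop)
  simp_rw [h1, h2]
  exact lintegral_lintegral_swap (by fun_prop)

/-- The hypotheses make the joint law of the four blocks the product of their four laws; regrouping
the blocks is then a permutation of coordinates. -/
theorem indepFun_prodMk_prodMk {α₁ α₂ β₁ β₂ : Type*} [MeasurableSpace α₁] [MeasurableSpace α₂]
    [MeasurableSpace β₁] [MeasurableSpace β₂] {A₁ : Ω → α₁} {A₂ : Ω → α₂} {B₁ : Ω → β₁} {B₂ : Ω → β₂}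
    (hA₁ : Measurable A₁) (hA₂ : Measurable A₂) (hB₁ : Measurable B₁) (hB₂ : Measurable B₂)
    (hA : IndepFun A₁ A₂ Q) (hB : IndepFun B₁ B₂ Q)
    (hAB : IndepFun (fun ω => (A₁ ω, A₂ ω)) (fun ω => (B₁ ω, B₂ ω)) Q) :
    IndepFun (fun ω => (A₁ ω, B₁ ω)) (fun ω => (A₂ ω, B₂ ω)) Q := by
  have h1 : IndepFun A₁ B₁ Q := hAB.comp measurable_fst measurable_fst
  have h2 : IndepFun A₂ B₂ Q := hAB.comp measurable_snd measurable_snd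
  have hσ : Measurable fun z : (α₁ × α₂) × (β₁ × β₂) =>
      (((z.1.1, z.2.1), (z.1.2, z.2.2)) : (α₁ × β₁) × (α₂ × β₂)) := by fun_prop
  rw [indepFun_iff_map_prod_eq_prod_map_map (by fun_prop) (by fun_prop)] at *
  rw [h1, h2, ← map_prod_prod_comm, ← hA, ← hB, ← hAB, Measure.map_map hσ (by fun_prop)]
  rfl

end Resampling

section Network

variable {p : Params} {P : Measure Config} [IsProbabilityMeasure P]

theorem IsNetworkLaw.indep_fadeD_coin_fadeC (hP : IsNetworkLaw p P) :
    IndepFun Config.fadeD (fun c => (c.coin, c.fadeC)) P := by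
  -- A constant block fills the empty slot of the four-block lemma; it is projected away afterwards.
  have h1 := indepFun_prodMk_prodMk (A₁ := fun _ : Config => ()) (A₂ := Config.coin)
    measurable_const measurable_coin measurable_fadeD measurable_fadeC
    (indepFun_const_left _ _) hP.indep_fade (hP.indep_coin.comp
      (φ := fun x => ((), x)) (by fun_prop) measurable_id)
  exact h1.comp (φ := Prod.snd) measurable_snd measurable_id

theorem IsNetworkLaw.indep_fadeC_coin_fadeD (hP : IsNetworkLaw p P) :
    IndepFun Config.fadeC (fun c => (c.coin, c.fadeD)) P := by
  have h1 := indepFun_prodMk_prodMk (A₁ := fun _ : Config => ()) (A₂ := Config.coin)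
    measurable_const measurable_coin measurable_fadeC measurable_fadeD
    (indepFun_const_left _ _) hP.indep_fade.symm (hP.indep_coin.comp
      (φ := fun x => ((), x)) (ψ := Prod.swap) (by fun_prop) measurable_swap)
  exact h1.comp (φ := Prod.snd) measurable_snd measurable_id

/-- Resampling all marks that are attached to the base stations. -/
theorem IsNetworkLaw.lintegral_resample_bs (hP : IsNetworkLaw p P) {Φ : Config → ℝ≥0∞}
    (hΦ : Measurable Φ) :
    ∫⁻ c, Φ c ∂P = ∫⁻ c, ∫⁻ c', Φ ⟨c'.bs, c.tx, c.num, c.rx, c'.coin, c.fadeD, c'.fadeC⟩ ∂P ∂P := by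
  have h1 := indepFun_prodMk_prodMk (A₁ := fun c : Config => (c.tx, c.num, c.rx)) (A₂ := Config.bs)
    (by fun_prop) measurable_bs measurable_fadeD (by fun_prop) hP.indep_bs.symm
    hP.indep_fadeD_coin_fadeC (hP.indep_positions.comp
      (φ := fun z => ((z.2.1, z.2.2.1, z.2.2.2), z.1)) (ψ := fun z => (z.2.1, (z.1, z.2.2)))
      (by fun_prop) (by fun_prop))
  exact lintegral_of_indepFun (by fun_prop) (by fun_prop) h1
    (Φ := fun x y => Φ ⟨y.1, x.1.1, x.1.2.1, x.1.2.2, y.2.1, x.2, y.2.2⟩)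
    (hΦ.comp (measurable_configMk (by fun_prop) (by fun_prop) (by fun_prop) (by fun_prop)
      (by fun_prop) (by fun_prop) (by fun_prop)))

/-- With the D2D fading taken from an independent copy, its probabilities can be computed with all
positions frozen. The next two lemmas serve the cellular fading and the coins likewise. -/
theorem IsNetworkLaw.lintegral_resample_fadeD (hP : IsNetworkLaw p P) {Φ : Config → ℝ≥0∞}
    (hΦ : Measurable Φ) :
    ∫⁻ c, Φ c ∂P = ∫⁻ c, ∫⁻ c', Φ { c with fadeD := c'.fadeD } ∂P ∂P := by
  have h0 : IndepFun (fun c : Config => ((c.bs, c.tx, c.num, c.rx), ()))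
      (fun c => ((c.coin, c.fadeC), c.fadeD)) P :=
    hP.indep_positions.comp (φ := fun z => (z, ()))
      (ψ := fun z : (ℕ → ℝ) × (ℕ → ℕ → ℕ → ℕ → ℝ) × (ℕ → ℕ → ℕ → ℝ) =>
        ((z.1, z.2.2), z.2.1)) (by fun_prop) (by fun_prop)
  have h1 := indepFun_prodMk_prodMk (A₁ := fun c : Config => (c.bs, c.tx, c.num, c.rx))
    (A₂ := fun _ : Config => ()) (B₁ := fun c : Config => (c.coin, c.fadeC)) (B₂ := Config.fadeD)
    (by fun_prop) measurable_const (by fun_prop) measurable_fadeD (indepFun_const_right _ _)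
    hP.indep_fadeD_coin_fadeC.symm h0
  exact lintegral_of_indepFun (by fun_prop) (by fun_prop) h1
    (Φ := fun x y => Φ ⟨x.1.1, x.1.2.1, x.1.2.2.1, x.1.2.2.2, x.2.1, y.2, x.2.2⟩)
    (hΦ.comp (measurable_configMk (by fun_prop) (by fun_prop) (by fun_prop) (by fun_prop)
      (by fun_prop) (by fun_prop) (by fun_prop)))

theorem IsNetworkLaw.lintegral_resample_fadeC (hP : IsNetworkLaw p P) {Φ : Config → ℝ≥0∞}
    (hΦ : Measurable Φ) :
    ∫⁻ c, Φ c ∂P = ∫⁻ c, ∫⁻ c', Φ { c with fadeC := c'.fadeC } ∂P ∂P := by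
  have h0 : IndepFun (fun c : Config => ((c.bs, c.tx, c.num, c.rx), ()))
      (fun c => ((c.coin, c.fadeD), c.fadeC)) P :=
    hP.indep_positions.comp (φ := fun z => (z, ()))
      (ψ := fun z : (ℕ → ℝ) × (ℕ → ℕ → ℕ → ℕ → ℝ) × (ℕ → ℕ → ℕ → ℝ) =>
        ((z.1, z.2.1), z.2.2)) (by fun_prop) (by fun_prop)
  have h1 := indepFun_prodMk_prodMk (A₁ := fun c : Config => (c.bs, c.tx, c.num, c.rx))
    (A₂ := fun _ : Config => ()) (B₁ := fun c : Config => (c.coin, c.fadeD)) (B₂ := Config.fadeC)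
    (by fun_prop) measurable_const (by fun_prop) measurable_fadeC (indepFun_const_right _ _)
    hP.indep_fadeC_coin_fadeD.symm h0
  exact lintegral_of_indepFun (by fun_prop) (by fun_prop) h1
    (Φ := fun x y => Φ ⟨x.1.1, x.1.2.1, x.1.2.2.1, x.1.2.2.2, x.2.1, x.2.2, y.2⟩)
    (hΦ.comp (measurable_configMk (by fun_prop) (by fun_prop) (by fun_prop) (by fun_prop)
      (by fun_prop) (by fun_prop) (by fun_prop)))

theorem IsNetworkLaw.lintegral_resample_coin (hP : IsNetworkLaw p P) {Φ : Config → ℝ≥0∞}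
    (hΦ : Measurable Φ) :
    ∫⁻ c, Φ c ∂P = ∫⁻ c, ∫⁻ c', Φ { c with coin := c'.coin } ∂P ∂P := by
  have h0 : IndepFun (fun c : Config => ((c.bs, c.tx, c.num, c.rx), ()))
      (fun c => ((c.fadeD, c.fadeC), c.coin)) P :=
    hP.indep_positions.comp (φ := fun z => (z, ()))
      (ψ := fun z : (ℕ → ℝ) × (ℕ → ℕ → ℕ → ℕ → ℝ) × (ℕ → ℕ → ℕ → ℝ) =>
        (z.2, z.1)) (by fun_prop) (by fun_prop)
  have h1 := indepFun_prodMk_prodMk (A₁ := fun c : Config => (c.bs, c.tx, c.num, c.rx))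
    (A₂ := fun _ : Config => ()) (B₁ := fun c : Config => (c.fadeD, c.fadeC)) (B₂ := Config.coin)
    (by fun_prop) measurable_const (by fun_prop) measurable_coin (indepFun_const_right _ _)
    hP.indep_coin.symm h0
  exact lintegral_of_indepFun (by fun_prop) (by fun_prop) h1
    (Φ := fun x y => Φ ⟨x.1.1, x.1.2.1, x.1.2.2.1, x.1.2.2.2, y.2, x.2.1, x.2.2⟩)
    (hΦ.comp (measurable_configMk (by fun_prop) (by fun_prop) (by fun_prop) (by fun_prop)
      (by fun_prop) (by fun_prop) (by fun_prop)))

theorem cluster_apply (c : Config) (i : ℕ) {S : Set Plane} (hS : MeasurableSet S) :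
    c.cluster i S = ∑ k ∈ Finset.range (c.num i), S.indicator 1 (c.rx i k) := by
  rw [Config.cluster, Measure.finsetSum_apply]
  exact Finset.sum_congr rfl fun k _ => Measure.dirac_apply' _ hS

theorem measurable_sum_rx (i : ℕ) {Ψ : (ℕ → Plane) × Plane → ℝ≥0∞} (hΨ : Measurable Ψ) :
    Measurable fun c : Config => ∑ k ∈ Finset.range (c.num i), Ψ (c.tx, c.rx i k) :=
  measurable_sum_num (f := fun c k => Ψ (c.tx, c.rx i k)) (fun k => by fun_prop) i

/-- Averaging over the receivers of a transmitter, conditionally on the transmitters. -/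
theorem IsNetworkLaw.lintegral_sum_rx (hP : IsNetworkLaw p P) (i : ℕ)
    {Ψ : (ℕ → Plane) × Plane → ℝ≥0∞} (hΨ : Measurable Ψ) :
    ∫⁻ c, ∑ k ∈ Finset.range (c.num i), Ψ (c.tx, c.rx i k) ∂P =
      ∫⁻ c, ENNReal.ofReal p.lamR *
        (∫⁻ w in Metric.closedBall (0 : Plane) p.R, Ψ (c.tx, c.tx i + w)) ∂P := by
  -- Both sides are integrals of `Ψ` against measures on pairs (transmitters, point). These agree on
  -- rectangles by `cluster_mean`, and `ν` is finite because the cluster disc is bounded, so they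
  -- coincide.
  let μ : Measure ((ℕ → Plane) × Plane) := Measure.sum fun k =>
    (P.restrict {c | k < c.num i}).map fun c => (c.tx, c.rx i k)
  let ν : Measure ((ℕ → Plane) × Plane) := ENNReal.ofReal p.lamR •
    (P.prod (volume.restrict (Metric.closedBall (0 : Plane) p.R))).map
      fun z => (z.1.tx, z.1.tx i + z.2)
  have hset : ∀ k, MeasurableSet {c : Config | k < c.num i} := fun k =>
    measurableSet_lt measurable_const (by fun_prop)
  have hμ : ∀ Ψ : (ℕ → Plane) × Plane → ℝ≥0∞, Measurable Ψ →
      ∫⁻ z, Ψ z ∂μ = ∫⁻ c, ∑ k ∈ Finset.range (c.num i), Ψ (c.tx, c.rx i k) ∂P := by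
    intro Ψ hΨ
    classical
    simp_rw [sum_range_eq_tsum_ite]
    have hm : ∀ k, Measurable fun c : Config => if k < c.num i then Ψ (c.tx, c.rx i k) else 0 :=
      fun k => Measurable.ite (hset k) (by fun_prop) measurable_const
    rw [lintegral_tsum fun k => (hm k).aemeasurable, lintegral_sum_measure]
    refine tsum_congr fun k => ?_
    rw [lintegral_map hΨ (by fun_prop), ← lintegral_indicator (hset k)]
    exact lintegral_congr fun c => by simp [Set.indicator]
  have hν : ∀ Ψ : (ℕ → Plane) × Plane → ℝ≥0∞, Measurable Ψ →
      ∫⁻ z, Ψ z ∂ν = ∫⁻ c, ENNReal.ofReal p.lamR *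
        (∫⁻ w in Metric.closedBall (0 : Plane) p.R, Ψ (c.tx, c.tx i + w)) ∂P := by
    intro Ψ hΨ
    rw [lintegral_smul_measure, lintegral_map hΨ (by fun_prop), lintegral_prod _ (by fun_prop),
      lintegral_const_mul' _ _ ENNReal.ofReal_ne_top, smul_eq_mul]
  have hball : ∀ (x : Plane) {S : Set Plane}, MeasurableSet S →
      ∫⁻ w in Metric.closedBall (0 : Plane) p.R, S.indicator 1 (x + w) =
        volume (S ∩ Metric.closedBall x p.R) := by
    intro x S hS
    rw [← lintegral_indicator_one (hS.inter measurableSet_closedBall),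
      ← lintegral_indicator measurableSet_closedBall,
      ← lintegral_add_left_eq_self (μ := volume) ((S ∩ Metric.closedBall x p.R).indicator 1) x]
    refine lintegral_congr fun w => ?_
    by_cases h1 : w ∈ Metric.closedBall (0 : Plane) p.R <;> by_cases h2 : x + w ∈ S <;>
      simp_all [Set.indicator]
  have hrect : ∀ {E : Set (ℕ → Plane)} {S : Set Plane}, MeasurableSet E → MeasurableSet S →
      μ (E ×ˢ S) = ν (E ×ˢ S) := by
    intro E S hE hS
    have hES := hE.prod hS
    have hpre : MeasurableSet {c : Config | c.tx ∈ E} := measurable_tx hE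
    rw [← lintegral_indicator_one hES, hμ _ (measurable_one.indicator hES),
      ← lintegral_indicator_one hES, hν _ (measurable_one.indicator hES)]
    have h1 := hP.cluster_mean i S E hS hE
    rw [← lintegral_indicator hpre, ← lintegral_indicator hpre] at h1
    have e1 : ∀ (t : ℕ → Plane) (y : Plane),
      (E ×ˢ S).indicator (1 : (ℕ → Plane) × Plane → ℝ≥0∞) (t, y) =
        E.indicator 1 t * S.indicator 1 y := fun t y => by
      by_cases ht : t ∈ E <;> by_cases hy : y ∈ S <;> simp [ht, hy]
    simp_rw [e1]
    convert h1 using 1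
    · refine lintegral_congr fun c => ?_
      rw [← Finset.mul_sum, ← cluster_apply c i hS]
      by_cases hc : c.tx ∈ E <;> simp [hc]
    · refine lintegral_congr fun c => ?_
      by_cases hc : c.tx ∈ E
      · simp [hc, hball _ hS]
      · simp [hc]
  have hfin : IsFiniteMeasure ν := by
    refine ⟨?_⟩
    rw [← lintegral_one, hν _ measurable_const]
    simp only [lintegral_const, Measure.restrict_apply_univ, one_mul, measure_univ, mul_one]
    exact ENNReal.mul_lt_top ENNReal.ofReal_lt_top (measure_closedBall_lt_top (μ := volume))
  have : ν = μ := Measure.ext_prod fun hE hS => (hrect hE hS).symm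
  rw [← hμ Ψ hΨ, ← this, hν Ψ hΨ]

end Network

/-! ### Coverage by the own transmitter -/

section Links

/-- A threshold condition on the SINR over a link of length `r`, as a fading event. -/
theorem le_sinr_iff (p : Params) {r N : ℝ} (hr : 0 < r) (F d : ℕ → ℝ) (i : ℕ)
    (hF : 0 < F i) :
    ENNReal.ofReal p.T ≤ rxPower p (F i) r / (ENNReal.ofReal N +
        ∑' l, if l = i then 0 else rxPower p (F l) (d l)) ↔
      F ∈ fadingEvent (ENNReal.ofReal (p.T * N * p.A * r ^ p.α))
        (fun l => ENNReal.ofReal (p.T * r ^ p.α) / ENNReal.ofReal (d l ^ p.α)) i := by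
  have hA := p.A_pos
  have hT := p.T_pos
  have hrα : 0 < r ^ p.α := Real.rpow_pos_of_pos hr _
  have hℓ : 0 < pathLoss p r := mul_pos hA hrα
  have hℓ0 : ENNReal.ofReal (pathLoss p r) ≠ 0 := (ENNReal.ofReal_pos.2 hℓ).ne'
  -- With a positive finite signal, clearing the denominator is valid even when noise plus
  -- interference is `0` or `∞`; this is where positivity of the fading and of the link length
  -- matters.
  have hx : rxPower p (F i) r ≠ 0 :=
    (ENNReal.div_pos (ENNReal.ofReal_pos.2 hF).ne' ENNReal.ofReal_ne_top).ne'
  have hx' : rxPower p (F i) r ≠ ∞ := ENNReal.div_ne_top ENNReal.ofReal_ne_top hℓ0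
  rw [ENNReal.le_div_iff_mul_le (Or.inr hx) (Or.inr hx'), rxPower,
    ENNReal.le_div_iff_mul_le (Or.inl hℓ0) (Or.inl ENNReal.ofReal_ne_top)]
  have key : ENNReal.ofReal p.T * (ENNReal.ofReal N +
        ∑' l, if l = i then 0 else rxPower p (F l) (d l)) * ENNReal.ofReal (pathLoss p r) =
      ENNReal.ofReal (p.T * N * p.A * r ^ p.α) + ∑' l, (if l = i then 0 else
        ENNReal.ofReal (p.T * r ^ p.α) / ENNReal.ofReal (d l ^ p.α) * ENNReal.ofReal (F l)) := by
    rw [mul_add, add_mul, ← ENNReal.tsum_mul_left, ← ENNReal.tsum_mul_right]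
    congr 1
    · rw [← ENNReal.ofReal_mul hT.le, ← ENNReal.ofReal_mul' hℓ.le, pathLoss]
      congr 1; ring
    · refine tsum_congr fun l => ?_
      split_ifs
      · simp
      · have hA0 : ENNReal.ofReal p.A ≠ 0 := (ENNReal.ofReal_pos.2 hA).ne'
        rw [rxPower, pathLoss, pathLoss, ENNReal.ofReal_mul hA.le, ENNReal.ofReal_mul hA.le,
          ENNReal.ofReal_mul hT.le, div_eq_mul_inv, div_eq_mul_inv,
          ENNReal.mul_inv (Or.inl hA0) (Or.inl ENNReal.ofReal_ne_top)]
        calc ENNReal.ofReal p.T * (ENNReal.ofReal (F l) * ((ENNReal.ofReal p.A)⁻¹ *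
              (ENNReal.ofReal (d l ^ p.α))⁻¹)) * (ENNReal.ofReal p.A * ENNReal.ofReal (r ^ p.α))
            = (ENNReal.ofReal p.A * (ENNReal.ofReal p.A)⁻¹) * (ENNReal.ofReal p.T *
              ENNReal.ofReal (r ^ p.α) * (ENNReal.ofReal (d l ^ p.α))⁻¹ *
              ENNReal.ofReal (F l)) := by ring
          _ = _ := by rw [ENNReal.mul_inv_cancel hA0 ENNReal.ofReal_ne_top, one_mul]
  rw [key]
  rfl

variable {p : Params} {P : Measure Config} [IsProbabilityMeasure P]

/-- The probability that a D2D transmission from `t i` is received at `y`, given the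
transmitters. -/
noncomputable def linkProb (p : Params) (t : ℕ → Plane) (i : ℕ) (y : Plane) : ℝ≥0∞ :=
  expNeg (ENNReal.ofReal (p.T * (p.noise / p.Pm) * p.A * ‖y - t i‖ ^ p.α)) *
    prodOthers (fun z => attenuation p.α (p.T * ‖y - t i‖ ^ p.α) ‖z - y‖) t i

theorem linkProb_le_one (p : Params) (t : ℕ → Plane) (i : ℕ) (y : Plane) : linkProb p t i y ≤ 1 :=
  mul_le_one' (expNeg_le_one _) (prodOthers_le_one _ _ _)

theorem measurable_linkProb (p : Params) (i : ℕ) {Ω : Type*} [MeasurableSpace Ω]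
    {t : Ω → ℕ → Plane} {y : Ω → Plane} (ht : Measurable t) (hy : Measurable y) :
    Measurable fun ω => linkProb p (t ω) i (y ω) := by
  unfold linkProb prodOthers attenuation
  refine Measurable.mul (by fun_prop) (measurable_infProd fun l => ?_)
  split_ifs <;> fun_prop

theorem ae_pos_of_map_eq_expMeasure {Ω : Type*} [MeasurableSpace Ω] {Q : Measure Ω} {F : Ω → ℝ}
    (hF : Measurable F) (hlaw : Q.map F = expMeasure 1) : ∀ᵐ ω ∂Q, 0 < F ω := by
  refine ae_of_ae_map hF.aemeasurable ?_
  rw [hlaw]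
  have hm : Measurable ((Set.Iic (0 : ℝ)).indicator (1 : ℝ → ℝ≥0∞)) :=
    measurable_one.indicator measurableSet_Iic
  have h1 : expMeasure 1 (Set.Iic (0 : ℝ)) = 0 := by
    rw [← lintegral_indicator_one measurableSet_Iic, lintegral_expMeasure hm]
    exact setLIntegral_eq_zero measurableSet_Ioi fun x hx => by
      simp [not_le.2 (Set.mem_Ioi.1 hx)]
  rw [ae_iff]
  convert h1 using 2
  ext x; simp

/-- The positions are frozen, and different transmissions use different rows of the fading array, so
the attempts are independent with common success probability `linkProb`. -/
theorem IsNetworkLaw.measure_coveredD (hP : IsNetworkLaw p P) (c : Config) (i k : ℕ)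
    (hr : c.rx i k ≠ c.tx i) :
    P {c' : Config | CoveredD p { c with fadeD := c'.fadeD } i k} =
      1 - (1 - linkProb p c.tx i (c.rx i k)) ^ p.τ := by
  have hr' : 0 < ‖c.rx i k - c.tx i‖ := norm_pos_iff.2 (sub_ne_zero.2 hr)
  have hpos : ∀ᵐ c' ∂P, ∀ n, 0 < c'.fadeD i k i n := ae_all_iff.2 fun n =>
    ae_pos_of_map_eq_expMeasure (by fun_prop) (hP.fadeD_law i k i n)
  have h1 := measure_exists_fadingEvent (Q := P) (F := fun n l c' => c'.fadeD i k l n)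
    (fun n l => by fun_prop) (fun n l => hP.fadeD_law i k l n)
    (hP.fadeD_indep.precomp (g := fun s : (_ : ℕ) × ℕ => (i, k, s.2, s.1))
      fun a b hab => by
        obtain ⟨a1, a2⟩ := a
        obtain ⟨b1, b2⟩ := b
        simp only [Prod.mk.injEq, true_and] at hab
        rw [hab.1, hab.2])
    (ENNReal.ofReal (p.T * (p.noise / p.Pm) * p.A * ‖c.rx i k - c.tx i‖ ^ p.α))
    (fun l => ENNReal.ofReal (p.T * ‖c.rx i k - c.tx i‖ ^ p.α) /
      ENNReal.ofReal (‖c.tx l - c.rx i k‖ ^ p.α)) i p.τ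
  refine Eq.trans (measure_congr ?_) h1
  filter_upwards [hpos] with c' hc'
  refine propext (exists_congr fun n => and_congr_right fun _ => ?_)
  exact le_sinr_iff p hr' (fun l => c'.fadeD i k l n) (fun l => ‖c.tx l - c.rx i k‖) i (hc' n)

/-- The mean number of receivers sitting on their transmitter is `λ_r` times the area of a point.
This excludes links of length `0`, for which the SINR condition cannot be rewritten as a fading
event. -/
theorem IsNetworkLaw.ae_rx_ne_tx (hP : IsNetworkLaw p P) :
    ∀ᵐ c ∂P, ∀ i, ∀ k < c.num i, c.rx i k ≠ c.tx i := by
  classical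
  refine ae_all_iff.2 fun i => ?_
  have hm : Measurable fun z : (ℕ → Plane) × Plane => if z.2 = z.1 i then (1 : ℝ≥0∞) else 0 :=
    Measurable.ite (measurableSet_eq_fun (by fun_prop) (by fun_prop)) measurable_const
      measurable_const
  have h1 := hP.lintegral_sum_rx i hm
  have h2 : ∀ t : Plane, ∫⁻ w in Metric.closedBall (0 : Plane) p.R,
      (if t + w = t then (1 : ℝ≥0∞) else 0) = 0 := fun t => by
    refine lintegral_eq_zero_of_ae_eq_zero (ae_restrict_of_ae ?_)
    filter_upwards [compl_mem_ae_iff.2 (measure_singleton (μ := volume) (0 : Plane))] with w hw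
    have : w ≠ 0 := hw
    simp [this]
  simp only [h2, mul_zero, lintegral_zero] at h1
  rw [lintegral_eq_zero_iff (measurable_sum_rx i hm)] at h1
  filter_upwards [h1] with c hc k hk heq
  have := (Finset.sum_eq_zero_iff.1 hc) k (Finset.mem_range.2 hk)
  simp [heq] at this

/-- Averaging over the D2D fading and over the receivers of a transmitter. -/
theorem IsNetworkLaw.lintegral_sum_coveredD (hP : IsNetworkLaw p P) (i : ℕ)
    {ψ₁ ψ₂ : (ℕ → Plane) → ℝ≥0∞} (h₁ : Measurable ψ₁) (h₂ : Measurable ψ₂) :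
    ∫⁻ c, ∑ k ∈ Finset.range (c.num i), ({c | CoveredD p c i k}.indicator (fun c => ψ₁ c.tx) c +
        {c | CoveredD p c i k}ᶜ.indicator (fun c => ψ₂ c.tx) c) ∂P =
      ∫⁻ c, ENNReal.ofReal p.lamR * (∫⁻ w in Metric.closedBall (0 : Plane) p.R,
        ψ₁ c.tx * (1 - (1 - linkProb p c.tx i (c.tx i + w)) ^ p.τ) +
          ψ₂ c.tx * (1 - linkProb p c.tx i (c.tx i + w)) ^ p.τ) ∂P := by
  have hm : Measurable fun z : (ℕ → Plane) × Plane => 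
      ψ₁ z.1 * (1 - (1 - linkProb p z.1 i z.2) ^ p.τ) +
          ψ₂ z.1 * (1 - linkProb p z.1 i z.2) ^ p.τ := by
    have := measurable_linkProb p i (t := fun z : (ℕ → Plane) × Plane => z.1) (y := fun z => z.2)
      (by fun_prop) (by fun_prop)
    fun_prop
  rw [← hP.lintegral_sum_rx i hm]
  have hm' : ∀ k, Measurable fun c : Config => {c | CoveredD p c i k}.indicator (fun c => ψ₁ c.tx) c +
        {c | CoveredD p c i k}ᶜ.indicator (fun c => ψ₂ c.tx) c := fun k =>
    ((by fun_prop : Measurable fun c : Config => ψ₁ c.tx).indicator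
      (measurableSet_coveredD p i k)).add ((by fun_prop : Measurable fun c : Config =>
        ψ₂ c.tx).indicator (measurableSet_coveredD p i k).compl)
  rw [hP.lintegral_resample_fadeD (measurable_sum_num hm' i)]
  refine lintegral_congr_ae ?_
  filter_upwards [hP.ae_rx_ne_tx] with c hc
  have hr : ∀ d : Config, Measurable fun c' : Config => ({ d with fadeD := c'.fadeD } : Config) :=
    fun d => measurable_configMk measurable_const measurable_const measurable_const
      measurable_const measurable_const measurable_fadeD measurable_const
  have hm'' : ∀ k, Measurable fun c' : Config =>
      {c | CoveredD p c i k}.indicator (fun c => ψ₁ c.tx) { c with fadeD := c'.fadeD } +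
        {c | CoveredD p c i k}ᶜ.indicator (fun c => ψ₂ c.tx) { c with fadeD := c'.fadeD } :=
    fun k => (hm' k).comp (hr c)
  rw [lintegral_finsetSum _ fun k _ => hm'' k]
  refine Finset.sum_congr rfl fun k hk => ?_
  have hD : MeasurableSet {c' : Config | CoveredD p { c with fadeD := c'.fadeD } i k} :=
    hr c (measurableSet_coveredD p i k)
  have h3 := hP.measure_coveredD c i k (hc i k (Finset.mem_range.1 hk))
  have h4 : P {c' : Config | CoveredD p { c with fadeD := c'.fadeD } i k}ᶜ =
      (1 - linkProb p c.tx i (c.rx i k)) ^ p.τ := by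
    rw [prob_compl_eq_one_sub hD, h3]
    exact ENNReal.sub_sub_cancel ENNReal.one_ne_top (pow_le_one' tsub_le_self _)
  rw [← h3, ← h4, ← lintegral_indicator_const hD, ← lintegral_indicator_const hD.compl,
    ← lintegral_add_left (measurable_const.indicator hD)]
  rfl

end Links

/-! ### Inclusion–exclusion and the mean number of covered receivers -/

/-- The inclusion-exclusion formula for the mean probability of at least one success in `τ`
conditionally independent trials. -/
theorem lintegral_one_sub_one_sub_pow {X : Type*} [MeasurableSpace X] {μ : Measure X}
    {S : X → ℝ≥0∞} (hS : Measurable S) (hS1 : ∀ x, S x ≤ 1) {m : ℕ → ℝ} (hm0 : ∀ n, 0 ≤ m n)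
    (hm : ∀ n, ∫⁻ x, S x ^ n ∂μ = ENNReal.ofReal (m n)) (τ : ℕ) :
    ∫⁻ x, 1 - (1 - S x) ^ τ ∂μ =
        ENNReal.ofReal (∑ n ∈ Finset.Icc 1 τ, (-1 : ℝ) ^ (n + 1) * (τ.choose n : ℝ) * m n) ∧
      ∫⁻ x, (1 - S x) ^ τ ∂μ =
        ENNReal.ofReal (m 0 - ∑ n ∈ Finset.Icc 1 τ, (-1 : ℝ) ^ (n + 1) * (τ.choose n : ℝ) * m n) ∧
      0 ≤ ∑ n ∈ Finset.Icc 1 τ, (-1 : ℝ) ^ (n + 1) * (τ.choose n : ℝ) * m n ∧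
      ∑ n ∈ Finset.Icc 1 τ, (-1 : ℝ) ^ (n + 1) * (τ.choose n : ℝ) * m n ≤ m 0 := by
  have hμ : μ Set.univ = ENNReal.ofReal (m 0) := by simpa using hm 0
  have : IsFiniteMeasure μ := ⟨by rw [hμ]; exact ENNReal.ofReal_lt_top⟩
  have hp1 : ∀ x, (1 - S x) ^ τ ≤ 1 := fun x => pow_le_one' tsub_le_self _
  have hfin : ∫⁻ x, (1 - S x) ^ τ ∂μ ≠ ∞ :=
    ((lintegral_mono hp1).trans_lt (by simp)).ne
  have hs : ∀ n, ∫ x, (S x).toReal ^ n ∂μ = m n := fun n => by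
    simp_rw [← ENNReal.toReal_pow]
    rw [integral_toReal (by fun_prop) (ae_of_all _ fun x =>
      (pow_le_one' (hS1 x) n).trans_lt ENNReal.one_lt_top), hm, ENNReal.toReal_ofReal (hm0 n)]
  have hsi : ∀ n, Integrable (fun x => (S x).toReal ^ n) μ := fun n => by
    refine Integrable.of_bound (hS.ennreal_toReal.pow_const n).aestronglyMeasurable 1
      (ae_of_all _ fun x => ?_)
    rw [Real.norm_of_nonneg (by positivity)]
    exact pow_le_one₀ ENNReal.toReal_nonneg (ENNReal.toReal_le_of_le_ofReal zero_le_one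
      (by simpa using hS1 x))
  have hreal : (∫⁻ x, (1 - S x) ^ τ ∂μ).toReal =
      m 0 - ∑ n ∈ Finset.Icc 1 τ, (-1 : ℝ) ^ (n + 1) * (τ.choose n : ℝ) * m n := by
    rw [← integral_toReal (by fun_prop) (ae_of_all _ fun x => (hp1 x).trans_lt ENNReal.one_lt_top)]
    have e1 : ∀ x, ((1 - S x) ^ τ).toReal =
        ∑ n ∈ Finset.range (τ + 1), ((-1) ^ n * (τ.choose n : ℝ)) * (S x).toReal ^ n := fun x => by
      rw [ENNReal.toReal_pow, ENNReal.toReal_sub_of_le (hS1 x) ENNReal.one_ne_top,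
        ENNReal.toReal_one, sub_eq_neg_add, add_pow]
      refine Finset.sum_congr rfl fun n _ => ?_
      rw [one_pow, neg_pow]; ring
    simp_rw [e1]
    rw [integral_finsetSum _ fun n _ => (hsi n).const_mul _]
    simp_rw [integral_const_mul, hs]
    rw [Finset.range_eq_Ico, Finset.sum_eq_sum_Ico_succ_bot (by omega), sub_eq_add_neg,
      ← Finset.sum_neg_distrib]
    congr 1
    · simp
    · refine Finset.sum_congr rfl fun n _ => ?_
      ring
  have h2 : ∫⁻ x, (1 - S x) ^ τ ∂μ = ENNReal.ofReal (m 0 -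
      ∑ n ∈ Finset.Icc 1 τ, (-1 : ℝ) ^ (n + 1) * (τ.choose n : ℝ) * m n) := by
    rw [← hreal, ENNReal.ofReal_toReal hfin]
  -- The signs of the alternating sum are not visible termwise; both bounds are read off from the
  -- integral of `(1 - S)^τ`, which lies between `0` and the total mass `m 0`.
  have h3 : ∑ n ∈ Finset.Icc 1 τ, (-1 : ℝ) ^ (n + 1) * (τ.choose n : ℝ) * m n ≤ m 0 := by
    rw [← sub_nonneg, ← hreal]; exact ENNReal.toReal_nonneg
  have h4 : 0 ≤ ∑ n ∈ Finset.Icc 1 τ, (-1 : ℝ) ^ (n + 1) * (τ.choose n : ℝ) * m n := by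
    have : (∫⁻ x, (1 - S x) ^ τ ∂μ).toReal ≤ m 0 := by
      rw [← ENNReal.toReal_ofReal (hm0 0), ← hμ]
      exact ENNReal.toReal_mono (measure_ne_top _ _) ((lintegral_mono hp1).trans (by simp))
    rw [hreal] at this
    linarith
  refine ⟨?_, h2, h4, h3⟩
  rw [lintegral_sub (by fun_prop) hfin (ae_of_all _ hp1), h2, lintegral_one, hμ,
    ← ENNReal.ofReal_sub _ (sub_nonneg.2 h3)]
  congr 1; ring

/-- The mean of the `n`-th power of the success probability, integrated over the cluster disc. -/
noncomputable def clusterMoment (p : Params) (n : ℕ) : ℝ :=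
  2 * Real.pi * ∫ r in (0 : ℝ)..p.R, r * Real.exp (-(n * p.T * (p.noise / p.Pm) * p.A * r ^ p.α)) *
      Real.exp (-(p.lamM * Kfun p.α n * p.T ^ (2 / p.α) * r ^ 2))

theorem clusterMoment_nonneg (p : Params) (n : ℕ) : 0 ≤ clusterMoment p n := by
  refine mul_nonneg (by positivity) (intervalIntegral.integral_nonneg p.R_pos.le fun r hr => ?_)
  have := hr.1
  positivity

/-- `K(α, 0) = 0`, since its integrand contains `1 - 1 / (1 + t)^0`; only the area of the disc is
left. -/
theorem clusterMoment_zero (p : Params) : clusterMoment p 0 = Real.pi * p.R ^ 2 := by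
  simp [clusterMoment, Kfun]
  ring

theorem lamR_mul_clusterMoment_zero (p : Params) : p.lamR * clusterMoment p 0 = Nmax p := by
  rw [clusterMoment_zero, Nmax]; ring

theorem Nbar_eq_sum_clusterMoment (p : Params) :
    Nbar p = p.lamR * ∑ n ∈ Finset.Icc 1 p.τ,
      (-1 : ℝ) ^ (n + 1) * (p.τ.choose n : ℝ) * clusterMoment p n := by
  rw [Nbar, Finset.mul_sum, Finset.mul_sum]
  refine Finset.sum_congr rfl fun n _ => ?_
  rw [clusterMoment]; ring

theorem lintegral_ball_clusterMoment (p : Params) (n : ℕ) :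
    ∫⁻ w in Metric.closedBall (0 : Plane) p.R,
      ENNReal.ofReal (Real.exp (-(n * p.T * (p.noise / p.Pm) * p.A * ‖w‖ ^ p.α)) *
        Real.exp (-(p.lamM * Kfun p.α n * p.T ^ (2 / p.α) * ‖w‖ ^ 2))) =
      ENNReal.ofReal (clusterMoment p n) := by
  have hα : 0 ≤ p.α := by linarith [p.two_lt_α]
  let f : ℝ → ℝ := fun r => Real.exp (-(n * p.T * (p.noise / p.Pm) * p.A * r ^ p.α)) *
        Real.exp (-(p.lamM * Kfun p.α n * p.T ^ (2 / p.α) * r ^ 2))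
  have hf : Continuous f := by
    have : Continuous fun r : ℝ => r ^ p.α := Real.continuous_rpow_const hα
    fun_prop
  have h1 : ∫⁻ w in Metric.closedBall (0 : Plane) p.R, ENNReal.ofReal (f ‖w‖) =
      ∫⁻ w : Plane, (Set.Iic p.R).indicator (fun r => ENNReal.ofReal (f r)) ‖w‖ := by
    rw [← lintegral_indicator measurableSet_closedBall]
    refine lintegral_congr fun w => ?_
    by_cases hw : ‖w‖ ≤ p.R <;> simp [hw]
  have hfm : Measurable fun r => ENNReal.ofReal (f r) := hf.measurable.ennreal_ofReal
  refine h1.trans ?_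
  rw [lintegral_plane_norm (hfm.indicator measurableSet_Iic)]
  have h2 : ∀ r, ENNReal.ofReal (2 * Real.pi * r) *
      (Set.Iic p.R).indicator (fun r => ENNReal.ofReal (f r)) r =
      (Set.Iic p.R).indicator (fun r => ENNReal.ofReal (2 * Real.pi * (r * f r))) r := fun r => by
    by_cases hr : r ∈ Set.Iic p.R
    · rw [Set.indicator_of_mem hr, Set.indicator_of_mem hr, ← ENNReal.ofReal_mul' (by positivity)]
      congr 1; ring
    · simp [Set.indicator_of_notMem hr]
  simp_rw [h2]
  rw [lintegral_indicator measurableSet_Iic, Measure.restrict_restrict measurableSet_Iic,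
    Set.inter_comm, Set.Ioi_inter_Iic, ← ofReal_integral_eq_lintegral_ofReal]
  · rw [integral_const_mul, ← intervalIntegral.integral_of_le p.R_pos.le, clusterMoment]
    congr 4 with r
    rw [mul_assoc]
  · exact (by fun_prop : Continuous fun r => 2 * Real.pi * (r * f r)).integrableOn_Ioc
  · refine (ae_restrict_iff' measurableSet_Ioc).2 (ae_of_all _ fun r hr => ?_)
    have : 0 < r := hr.1
    show 0 ≤ 2 * Real.pi * (r * f r)
    positivity

/-! ### Moments of the link probability under the transmitter process -/

section Network

variable {p : Params} {P : Measure Config} [IsProbabilityMeasure P]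

theorem expNeg_pow (t : ℝ≥0∞) (n : ℕ) : expNeg t ^ n = expNeg (n * t) := by
  have := expNeg_sum (Finset.range n) fun _ => t
  simpa using this.symm

/-- For a fixed displacement `w` the receiver sits at `tx i + w`, and the `n`-th power of the
product over interferers is the product of the `n`-th powers. Slivnyak–Mecke gives `exp (-λ_m K
T^(2/α) |w|²)`, and the noise gives the other exponential. -/
theorem IsNetworkLaw.lintegral_linkProb_pow (hP : IsNetworkLaw p P) (n : ℕ) {φ : Plane → ℝ≥0∞}
    (hφ : Measurable φ) (hφi : ∫⁻ x, φ x ≠ ∞) (hφt : ∀ x, φ x ≠ ∞) :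
    ∫⁻ c, ∑' i, φ (c.tx i) * (∫⁻ w in Metric.closedBall (0 : Plane) p.R,
        linkProb p c.tx i (c.tx i + w) ^ n) ∂P =
      ENNReal.ofReal p.lamM * (∫⁻ x, φ x) * ENNReal.ofReal (clusterMoment p n) := by
  have hα : 0 < p.α := by linarith [p.two_lt_α]
  have hM := p.lamM_pos
  have hT := p.T_pos
  have hlp : ∀ i, Measurable fun z : Config × Plane => linkProb p z.1.tx i (z.1.tx i + z.2) :=
    fun i => measurable_linkProb p i (by fun_prop) (by fun_prop)
  have hm : ∀ i, Measurable fun z : Config × Plane =>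
      φ (z.1.tx i) * linkProb p z.1.tx i (z.1.tx i + z.2) ^ n := fun i => by
    have := hlp i
    fun_prop
  have h1 : ∀ c : Config, ∑' i, φ (c.tx i) * (∫⁻ w in Metric.closedBall (0 : Plane) p.R,
        linkProb p c.tx i (c.tx i + w) ^ n) = ∫⁻ w in Metric.closedBall (0 : Plane) p.R,
        ∑' i, φ (c.tx i) * linkProb p c.tx i (c.tx i + w) ^ n := fun c => by
    have hmc : ∀ i, Measurable fun w => φ (c.tx i) * linkProb p c.tx i (c.tx i + w) ^ n :=
      fun i => (hm i).comp measurable_prodMk_left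
    rw [lintegral_tsum fun i => (hmc i).aemeasurable]
    refine tsum_congr fun i => (lintegral_const_mul' _ _ (hφt _)).symm
  simp_rw [h1]
  -- The displacement is integrated last, so that the point-process formula is applied with `w`
  -- constant.
  rw [lintegral_lintegral_swap (Measurable.tsum hm).aemeasurable, ← lintegral_ball_clusterMoment,
    ← lintegral_const_mul' _ _ (ENNReal.mul_ne_top ENNReal.ofReal_ne_top hφi)]
  refine lintegral_congr fun w => ?_
  have h2 := hP.tx_poisson.campbell_translate measurable_tx_apply p.lamM_pos.le w
    (k := fun s => attenuation p.α (p.T * ‖w‖ ^ p.α) s ^ n)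
    ((ENNReal.continuous_pow n).comp (continuous_attenuation hα))
    (fun s => pow_le_one' (attenuation_le_one _ _ _) n)
    (fun s s' hs h => pow_le_pow_left' (attenuation_mono hα hs h) n) hφ hφi hφt
  rw [lintegral_one_sub_attenuation_pow p.two_lt_α (by positivity)] at h2
  let b := ENNReal.ofReal (p.T * (p.noise / p.Pm) * p.A * ‖w‖ ^ p.α)
  have h3 : ∀ c : Config, ∑' i, φ (c.tx i) * linkProb p c.tx i (c.tx i + w) ^ n =
      expNeg b ^ n * ∑' i, φ (c.tx i) * prodOthers (fun y =>
        attenuation p.α (p.T * ‖w‖ ^ p.α) ‖y - (c.tx i + w)‖ ^ n) c.tx i := fun c => by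
    rw [← ENNReal.tsum_mul_left]
    refine tsum_congr fun i => ?_
    rw [linkProb, add_sub_cancel_left, mul_pow, prodOthers_pow fun y => attenuation_le_one _ _ _]
    ring
  simp_rw [h3]
  rw [lintegral_const_mul' _ _ (ENNReal.pow_ne_top (expNeg_ne_top _)), h2, expNeg_pow]
  have hb : (n : ℝ≥0∞) * b =
      ENNReal.ofReal (n * p.T * (p.noise / p.Pm) * p.A * ‖w‖ ^ p.α) := by
    rw [← ENNReal.ofReal_natCast, ← ENNReal.ofReal_mul (by positivity)]
    congr 1; ring
  have hK : ENNReal.ofReal p.lamM * ENNReal.ofReal (Kfun p.α n * (p.T * ‖w‖ ^ p.α) ^ (2 / p.α)) =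
      ENNReal.ofReal (p.lamM * Kfun p.α n * p.T ^ (2 / p.α) * ‖w‖ ^ 2) := by
    rw [← ENNReal.ofReal_mul hM.le, Real.mul_rpow hT.le (by positivity),
      ← Real.rpow_mul (norm_nonneg w), mul_div_cancel₀ _ hα.ne', Real.rpow_two]
    congr 1; ring
  have hK0 := Kfun_nonneg p.α p.two_lt_α n
  have := p.noise_nonneg
  have := p.Pm_pos
  have := p.A_pos
  rw [hb, hK, expNeg_ofReal (by positivity), expNeg_ofReal (by positivity),
    ENNReal.ofReal_mul (by positivity)]
  ring

/-- The transmitters `i`, the network and the positions in the cluster disc, weighted by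
`φ (tx i)`. -/
noncomputable def linkMeasure (p : Params) (P : Measure Config) (φ : Plane → ℝ≥0∞) :
    Measure (ℕ × Config × Plane) :=
  (Measure.count.prod (P.prod (volume.restrict (Metric.closedBall (0 : Plane) p.R)))).withDensity
    fun z => φ (z.2.1.tx z.1)

theorem measurable_of_forall_nat {β γ : Type*} [MeasurableSpace β] [MeasurableSpace γ]
    {f : ℕ × β → γ} (h : ∀ i, Measurable fun x => f (i, x)) : Measurable f :=
  measurable_from_prod_countable_right h

theorem measurable_linkProb_cluster (p : Params) : Measurable fun z : ℕ × Config × Plane =>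
    linkProb p z.2.1.tx z.1 (z.2.1.tx z.1 + z.2.2) :=
  measurable_of_forall_nat fun i =>
    measurable_linkProb (Ω := Config × Plane) (t := fun x => x.1.tx) (y := fun x => x.1.tx i + x.2)
      p i (by fun_prop) (by fun_prop)

theorem lintegral_linkMeasure {φ : Plane → ℝ≥0∞} (hφ : Measurable φ) (hφt : ∀ x, φ x ≠ ∞)
    {f : ℕ × Config × Plane → ℝ≥0∞} (hf : Measurable f) :
    ∫⁻ z, f z ∂linkMeasure p P φ = ∫⁻ c, ∑' i, φ (c.tx i) *
      (∫⁻ w in Metric.closedBall (0 : Plane) p.R, f (i, c, w)) ∂P := by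
  have hd : Measurable fun z : ℕ × Config × Plane => φ (z.2.1.tx z.1) :=
    measurable_of_forall_nat fun i =>
      show Measurable fun x : Config × Plane => φ (x.1.tx i) by fun_prop
  rw [linkMeasure, lintegral_withDensity_eq_lintegral_mul _ hd hf,
    lintegral_prod _ (hd.mul hf).aemeasurable, lintegral_count]
  have h1 : ∀ i, Measurable fun z : Config × Plane => φ (z.1.tx i) * f (i, z) := fun i => by
    fun_prop
  have h2 : ∀ i, Measurable fun c : Config => φ (c.tx i) *
      (∫⁻ w in Metric.closedBall (0 : Plane) p.R, f (i, c, w)) := fun i =>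
    Measurable.mul (by fun_prop) (Measurable.lintegral_prod_right'
      (f := fun z : Config × Plane => f (i, z)) (by fun_prop))
  rw [lintegral_tsum fun i => (h2 i).aemeasurable]
  refine tsum_congr fun i => ?_
  refine (lintegral_prod _ (h1 i).aemeasurable).trans (lintegral_congr fun c => ?_)
  exact lintegral_const_mul' (φ (c.tx i)) (fun w => f (i, c, w)) (hφt _)

/-- Inclusion–exclusion is applied to the moments of the link probability over all transmitters and
displacements at once. The sign statements carry the factor `∫ φ` because the total mass of
`linkMeasure` does. -/
theorem IsNetworkLaw.lintegral_linkMeasure_linkProb (hP : IsNetworkLaw p P) {φ : Plane → ℝ≥0∞}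
    (hφ : Measurable φ) (hφi : ∫⁻ x, φ x ≠ ∞) (hφt : ∀ x, φ x ≠ ∞) :
    (ENNReal.ofReal p.lamR * ∫⁻ z, 1 - (1 - linkProb p z.2.1.tx z.1 (z.2.1.tx z.1 + z.2.2)) ^ p.τ
        ∂linkMeasure p P φ = ENNReal.ofReal p.lamM * (∫⁻ x, φ x) * ENNReal.ofReal (Nbar p)) ∧
      (ENNReal.ofReal p.lamR * ∫⁻ z, (1 - linkProb p z.2.1.tx z.1 (z.2.1.tx z.1 + z.2.2)) ^ p.τ
        ∂linkMeasure p P φ =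
          ENNReal.ofReal p.lamM * (∫⁻ x, φ x) * ENNReal.ofReal (Nmax p - Nbar p)) ∧
      0 ≤ (∫⁻ x, φ x).toReal * Nbar p ∧ 0 ≤ (∫⁻ x, φ x).toReal * (Nmax p - Nbar p) := by
  have hM := p.lamM_pos
  have hR := p.lamR_pos
  let a := p.lamM * (∫⁻ x, φ x).toReal
  have ha : 0 ≤ a := mul_nonneg hM.le ENNReal.toReal_nonneg
  have hao : ENNReal.ofReal p.lamM * (∫⁻ x, φ x) = ENNReal.ofReal a := by
    rw [ENNReal.ofReal_mul hM.le, ENNReal.ofReal_toReal hφi]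
  have hS := measurable_linkProb_cluster p
  have h := lintegral_one_sub_one_sub_pow (μ := linkMeasure p P φ) hS
    (fun z => linkProb_le_one _ _ _ _) (m := fun n => a * clusterMoment p n)
    (fun n => mul_nonneg ha (clusterMoment_nonneg p n))
    (fun n => by
      rw [lintegral_linkMeasure hφ hφt (hS.pow_const n), ENNReal.ofReal_mul ha, ← hao]
      exact hP.lintegral_linkProb_pow n hφ hφi hφt) p.τ
  have hsum : ∑ n ∈ Finset.Icc 1 p.τ, (-1 : ℝ) ^ (n + 1) * (p.τ.choose n : ℝ) *
      (a * clusterMoment p n) = a * ∑ n ∈ Finset.Icc 1 p.τ, (-1 : ℝ) ^ (n + 1) *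
        (p.τ.choose n : ℝ) * clusterMoment p n := by
    rw [Finset.mul_sum]; exact Finset.sum_congr rfl fun n _ => by ring
  have hN := Nbar_eq_sum_clusterMoment p
  have hN0 := lamR_mul_clusterMoment_zero p
  rw [hsum] at h
  set s := ∑ n ∈ Finset.Icc 1 p.τ, (-1 : ℝ) ^ (n + 1) * (p.τ.choose n : ℝ) * clusterMoment p n
  obtain ⟨h1, h2, h3, h4⟩ := h
  have e1 : ∀ x, (∫⁻ x, φ x).toReal * (p.lamR * x) = p.lamR / p.lamM * (a * x) := fun x => by
    simp only [a]; field_simp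
  refine ⟨?_, ?_, ?_, ?_⟩
  · rw [h1, hao, ← ENNReal.ofReal_mul hR.le, ← ENNReal.ofReal_mul ha, hN]
    congr 1; ring
  · rw [h2, hao, ← ENNReal.ofReal_mul hR.le, ← ENNReal.ofReal_mul ha, hN, ← hN0]
    congr 1; ring
  · rw [hN, e1]; positivity
  · rw [hN, ← hN0, ← mul_sub, e1, mul_sub a]
    exact mul_nonneg (by positivity) (sub_nonneg.2 h4)

/-- Choosing for `φ` the indicator of the unit disc, whose area is positive and finite, allows `∫ φ`
to be divided out. The bounds guarantee that `ENNReal.ofReal` truncates neither `N̄` nor `N̄_max -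
N̄`. -/
theorem IsNetworkLaw.Nbar_mem_Icc (hP : IsNetworkLaw p P) : Nbar p ∈ Set.Icc 0 (Nmax p) := by
  have hb : MeasurableSet (Metric.closedBall (0 : Plane) 1) := measurableSet_closedBall
  have h1 : ∫⁻ x : Plane, (Metric.closedBall (0 : Plane) 1).indicator 1 x =
      volume (Metric.closedBall (0 : Plane) 1) := lintegral_indicator_one hb
  have htop : volume (Metric.closedBall (0 : Plane) 1) ≠ ∞ := measure_closedBall_lt_top.ne
  have hpos : 0 < (volume (Metric.closedBall (0 : Plane) 1)).toReal :=
    ENNReal.toReal_pos (Metric.measure_closedBall_pos _ _ one_pos).ne' htop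
  have h := (hP.lintegral_linkMeasure_linkProb (measurable_one.indicator hb) (by rwa [h1])
    (fun x => by by_cases hx : x ∈ Metric.closedBall (0 : Plane) 1 <;> simp [Set.indicator, hx])).2.2
  rw [h1] at h
  exact ⟨nonneg_of_mul_nonneg_right h.1 hpos, sub_nonneg.1 (nonneg_of_mul_nonneg_right h.2 hpos)⟩

/-- The mean total weight of the receivers, where the receivers of transmitter `i` that are covered
by it have weight `φ₁ (tx i)`, and the others have weight `φ₂ (tx i)`. -/
theorem IsNetworkLaw.lintegral_tsum_coveredD (hP : IsNetworkLaw p P) {φ₁ φ₂ : Plane → ℝ≥0∞}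
    (hφ₁ : Measurable φ₁) (hφi₁ : ∫⁻ x, φ₁ x ≠ ∞) (hφt₁ : ∀ x, φ₁ x ≠ ∞)
    (hφ₂ : Measurable φ₂) (hφi₂ : ∫⁻ x, φ₂ x ≠ ∞) (hφt₂ : ∀ x, φ₂ x ≠ ∞) :
    ∫⁻ c, ∑' i, ∑ k ∈ Finset.range (c.num i),
        ({c | CoveredD p c i k}.indicator (fun c => φ₁ (c.tx i)) c +
          {c | CoveredD p c i k}ᶜ.indicator (fun c => φ₂ (c.tx i)) c) ∂P =
      ENNReal.ofReal p.lamM * ((∫⁻ x, φ₁ x) * ENNReal.ofReal (Nbar p) +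
        (∫⁻ x, φ₂ x) * ENNReal.ofReal (Nmax p - Nbar p)) := by
  have hS := measurable_linkProb_cluster p
  have hSi : ∀ i, Measurable fun z : Config × Plane => linkProb p z.1.tx i (z.1.tx i + z.2) :=
    fun i => measurable_linkProb p i (by fun_prop) (by fun_prop)
  have hf₂ : Measurable fun z : ℕ × Config × Plane =>
      (1 - linkProb p z.2.1.tx z.1 (z.2.1.tx z.1 + z.2.2)) ^ p.τ :=
    (measurable_const.sub hS).pow_const _
  have hf₁ : Measurable fun z : ℕ × Config × Plane =>
      1 - (1 - linkProb p z.2.1.tx z.1 (z.2.1.tx z.1 + z.2.2)) ^ p.τ := measurable_const.sub hf₂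
  have h1 := (hP.lintegral_linkMeasure_linkProb hφ₁ hφi₁ hφt₁).1
  have h2 := (hP.lintegral_linkMeasure_linkProb hφ₂ hφi₂ hφt₂).2.1
  rw [mul_add, ← mul_assoc, ← mul_assoc, ← h1, ← h2,
    lintegral_linkMeasure hφ₁ hφt₁ hf₁, lintegral_linkMeasure hφ₂ hφt₂ hf₂,
    ← mul_add]
  have hm : ∀ i, Measurable fun c : Config => ∑ k ∈ Finset.range (c.num i),
      ({c | CoveredD p c i k}.indicator (fun c => φ₁ (c.tx i)) c +
          {c | CoveredD p c i k}ᶜ.indicator (fun c => φ₂ (c.tx i)) c) := fun i =>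
    measurable_sum_num (f := fun c k => {c | CoveredD p c i k}.indicator (fun c => φ₁ (c.tx i)) c +
          {c | CoveredD p c i k}ᶜ.indicator (fun c => φ₂ (c.tx i)) c) (fun k =>
      ((by fun_prop : Measurable fun c : Config => φ₁ (c.tx i)).indicator
        (measurableSet_coveredD p i k)).add ((by fun_prop : Measurable fun c : Config =>
          φ₂ (c.tx i)).indicator (measurableSet_coveredD p i k).compl)) i
  have hm1 : ∀ i, Measurable fun c : Config => φ₁ (c.tx i) *
      (∫⁻ w in Metric.closedBall (0 : Plane) p.R,
        1 - (1 - linkProb p c.tx i (c.tx i + w)) ^ p.τ) := fun i => by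
    have := hSi i
    exact Measurable.mul (by fun_prop) (Measurable.lintegral_prod_right' (f := fun z :
      Config × Plane => 1 - (1 - linkProb p z.1.tx i (z.1.tx i + z.2)) ^ p.τ) (by fun_prop))
  have hm2 : ∀ i, Measurable fun c : Config => φ₂ (c.tx i) *
      (∫⁻ w in Metric.closedBall (0 : Plane) p.R,
        (1 - linkProb p c.tx i (c.tx i + w)) ^ p.τ) := fun i => by
    have := hSi i
    exact Measurable.mul (by fun_prop) (Measurable.lintegral_prod_right' (f := fun z :
      Config × Plane => (1 - linkProb p z.1.tx i (z.1.tx i + z.2)) ^ p.τ) (by fun_prop))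
  rw [lintegral_tsum fun i => (hm i).aemeasurable, lintegral_tsum fun i => (hm1 i).aemeasurable,
    lintegral_tsum fun i => (hm2 i).aemeasurable, ← ENNReal.tsum_add, ← ENNReal.tsum_mul_left]
  refine tsum_congr fun i => ?_
  rw [← lintegral_add_left (hm1 i), ← lintegral_const_mul' _ _ ENNReal.ofReal_ne_top]
  have h0 := hP.lintegral_sum_coveredD i (ψ₁ := fun t => φ₁ (t i)) (ψ₂ := fun t => φ₂ (t i))
    (by fun_prop) (by fun_prop)
  rw [h0]
  refine lintegral_congr fun c => ?_
  have h3 : Measurable fun w => linkProb p c.tx i (c.tx i + w) :=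
    measurable_linkProb p i measurable_const (by fun_prop)
  rw [lintegral_add_left (by fun_prop), lintegral_const_mul' _ _ (hφt₁ _),
    lintegral_const_mul' _ _ (hφt₂ _)]

end Network

/-! ### Encoding the Voronoi cell in a kernel -/

section FarKernel

/-- The Laplace transform of the power received over distance `s`, killed if `s` is smaller than
the distance `r` of the serving point. -/
noncomputable def farKernel (α ϑ r s : ℝ) : ℝ≥0∞ :=
  if r ≤ s then attenuation α (ϑ * r ^ α) s else 0

theorem farKernel_le_one (α ϑ r s : ℝ) : farKernel α ϑ r s ≤ 1 := by
  unfold farKernel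
  split_ifs
  exacts [attenuation_le_one _ _ _, zero_le]

theorem measurable_farKernel (α ϑ r : ℝ) : Measurable (farKernel α ϑ r) :=
  Measurable.ite measurableSet_Ici (measurable_attenuation _ _) measurable_const

theorem farKernel_anti {α ϑ r r' s : ℝ} (hα : 0 ≤ α) (hϑ : 0 ≤ ϑ) (hr : 0 ≤ r) (h : r ≤ r') :
    farKernel α ϑ r' s ≤ farKernel α ϑ r s := by
  unfold farKernel
  split_ifs with h1 h2
  · exact attenuation_anti (mul_le_mul_of_nonneg_left (Real.rpow_le_rpow hr h hα) hϑ)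
  · exact absurd (h.trans h1) h2
  all_goals exact zero_le

/-- Approaching `r` from below, a point with `r ≤ s` is never killed and one with `s < r` is
eventually killed, so the jump of the kernel does not obstruct the limit. -/
theorem tendsto_farKernel {α ϑ : ℝ} (hα : 0 < α) {a : ℕ → ℝ} {r s : ℝ}
    (ha0 : ∀ n, 0 ≤ a n) (har : ∀ n, a n ≤ r) (ha : Tendsto a atTop (𝓝 r)) :
    Tendsto (fun n => farKernel α ϑ (a n) s) atTop (𝓝 (farKernel α ϑ r s)) := by
  rcases le_or_gt r s with hrs | hrs
  · have h1 : ∀ n, farKernel α ϑ (a n) s = attenuation α (ϑ * a n ^ α) s := fun n =>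
      if_pos ((har n).trans hrs)
    simp_rw [h1]
    rw [farKernel, if_pos hrs]
    -- For `r = 0` the distance `s` may be `0`, where the attenuation is discontinuous in its
    -- parameter; but then the sequence is constantly `0`.
    rcases ((ha0 0).trans (har 0)).eq_or_lt with rfl | hr
    · have h2 : ∀ n, a n = 0 := fun n => le_antisymm (har n) (ha0 n)
      simp_rw [h2]
      exact tendsto_const_nhds
    have hs : 0 < s ^ α := Real.rpow_pos_of_pos (hr.trans_le hrs) _
    have hc : Continuous fun c : ℝ => attenuation α c s := by
      unfold attenuation
      simp_rw [div_eq_mul_inv]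
      have h2 : Continuous fun c : ℝ => ENNReal.ofReal c * (ENNReal.ofReal (s ^ α))⁻¹ :=
        (ENNReal.continuous_mul_const
        (ENNReal.inv_ne_top.2 (ENNReal.ofReal_pos.2 hs).ne')).comp ENNReal.continuous_ofReal
      exact (continuous_const.add h2).inv
    exact (hc.tendsto _).comp (((Real.continuous_rpow_const hα.le).tendsto _ |>.comp ha).const_mul _)
  · rw [farKernel, if_neg (not_le.2 hrs)]
    refine tendsto_const_nhds.congr' ?_
    filter_upwards [ha.eventually_const_lt hrs] with n hn
    rw [farKernel, if_neg (not_le.2 hn)]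

theorem lintegral_one_sub_farKernel_zero {α r : ℝ} (hr : 0 ≤ r) :
    ∫⁻ y : Plane, 1 - farKernel α 0 r ‖y‖ = ENNReal.ofReal (Real.pi * r ^ 2) := by
  have h1 : ∀ y : Plane, 1 - farKernel α 0 r ‖y‖ = (Metric.ball (0 : Plane) r).indicator 1 y :=
    fun y => by
      rw [farKernel, zero_mul, attenuation_zero]
      by_cases hy : r ≤ ‖y‖
      · simp [hy]
      · simp [hy, not_le.1 hy]
  simp_rw [h1]
  rw [lintegral_indicator_one measurableSet_ball, EuclideanSpace.volume_ball_fin_two]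
  rw [← ENNReal.ofReal_pow hr, ← ENNReal.ofReal_mul (by positivity), mul_comm]

/-- A point nearer to `x` than `w j` contributes a zero factor. The product thus contains the event
that `w j` is a nearest point, and the event needs no separate treatment in the Slivnyak–Mecke
formula. -/
theorem prodOthers_farKernel (α ϑ : ℝ) (w : ℕ → Plane) (x : Plane) (j : ℕ) :
    prodOthers (fun y => farKernel α ϑ ‖w j - x‖ ‖y - x‖) w j =
      {j | x ∈ voronoiCell w (w j)}.indicator (fun j =>
        prodOthers (fun y => attenuation α (ϑ * ‖w j - x‖ ^ α) ‖y - x‖) w j) j := by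
  by_cases h : x ∈ voronoiCell w (w j)
  · rw [Set.indicator_of_mem (show j ∈ {j | x ∈ voronoiCell w (w j)} from h)]
    unfold prodOthers
    congr 1 with l
    have h1 : ‖w j - x‖ ≤ ‖w l - x‖ := by
      rw [norm_sub_rev, norm_sub_rev (w l)]; exact h l
    simp [farKernel, h1]
  · rw [Set.indicator_of_notMem (show j ∉ {j | x ∈ voronoiCell w (w j)} from h)]
    obtain ⟨l, hl⟩ : ∃ l, ‖w l - x‖ < ‖w j - x‖ := by
      by_contra! hc
      exact h fun l => by rw [norm_sub_rev, norm_sub_rev x]; exact hc l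
    have hlj : l ≠ j := fun e => by rw [e] at hl; exact lt_irrefl _ hl
    refine le_antisymm ((iInf_le _ (l + 1)).trans (le_of_eq ?_)) zero_le
    exact Finset.prod_eq_zero (Finset.self_mem_range_succ l) (by
      simp [hlj, farKernel, hl])

/-- The radial Slivnyak–Mecke formula for `farKernel`, read through `prodOthers_farKernel`;
translation invariance recentres the inner integral. -/
theorem IsPoissonProcess.campbell_voronoi {P : Measure Config} [IsProbabilityMeasure P]
    {p : Config → ℕ → Plane} {lam : ℝ} (h : IsPoissonProcess P p lam)
    (hp : ∀ i, Measurable fun c => p c i) (hl : 0 ≤ lam) (x : Plane) {α ϑ : ℝ} (hα : 0 < α)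
    (hϑ : 0 ≤ ϑ) {φ : Plane → ℝ≥0∞} (hφ : Measurable φ) (hφi : ∫⁻ x, φ x ≠ ∞)
    (hφt : ∀ x, φ x ≠ ∞) :
    ∫⁻ c, ∑' j, φ (p c j) * {j | x ∈ voronoiCell (p c) (p c j)}.indicator (fun j =>
        prodOthers (fun y => attenuation α (ϑ * ‖p c j - x‖ ^ α) ‖y - x‖) (p c) j) j ∂P =
      ENNReal.ofReal lam * ∫⁻ z, φ z * expNeg (ENNReal.ofReal lam *
        ∫⁻ y : Plane, 1 - farKernel α ϑ ‖z - x‖ ‖y‖) := by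
  have h1 := h.campbell_radial hp hl x (k := farKernel α ϑ) (measurable_farKernel α ϑ)
    (farKernel_le_one α ϑ) (fun r r' s hr hrr => farKernel_anti hα.le hϑ hr hrr)
    (fun a r s ha0 har _ ha => tendsto_farKernel hα ha0 har ha) hφ hφi hφt
  simp_rw [prodOthers_farKernel] at h1
  rw [h1]
  congr 1
  refine lintegral_congr fun z => ?_
  rw [lintegral_sub_right_eq_self (μ := volume)
    (fun y : Plane => 1 - farKernel α ϑ ‖z - x‖ ‖y‖) x]

end FarKernel

theorem IsNetworkLaw.measure_coin_lt {p : Params} {P : Measure Config} (hP : IsNetworkLaw p P) (i : ℕ)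
    {γ : ℝ} (hγ : γ ∈ Set.Icc (0 : ℝ) 1) : P {c | c.coin i < γ} = ENNReal.ofReal γ := by
  have h1 : P.map (fun c => c.coin i) (Set.Iio γ) = P {c | c.coin i < γ} :=
    Measure.map_apply (by fun_prop) measurableSet_Iio
  rw [← h1, hP.coin_law, Measure.restrict_apply measurableSet_Iio]
  have : Set.Iio γ ∩ Set.Icc 0 1 = Set.Ico 0 γ := by
    ext t
    simp only [Set.mem_inter_iff, Set.mem_Iio, Set.mem_Icc, Set.mem_Ico]
    exact ⟨fun h => ⟨h.2.1, h.1⟩, fun h => ⟨h.2, h.1, h.2.le.trans hγ.2⟩⟩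
  rw [this, Real.volume_Ico, sub_zero]

/-! ### The serving base station of a fixed transmitter -/

section Served

variable {p : Params} {P : Measure Config} [IsProbabilityMeasure P]

/-- Base station `j` lies in `B` and serves a transmitter at `x`. -/
def servedSet (B : Set Plane) (x : Plane) (j : ℕ) : Set Config :=
  {c | c.bs j ∈ B ∧ x ∈ voronoiCell c.bs (c.bs j)}

theorem measurableSet_servedSet {B : Set Plane} (hB : MeasurableSet B) (x : Plane) (j : ℕ) :
    MeasurableSet (servedSet B x j) := by
  have : servedSet B x j = (fun c : Config => c.bs j) ⁻¹' B ∩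
      ⋂ l, {c : Config | ‖x - c.bs j‖ ≤ ‖x - c.bs l‖} := by
    ext c; simp [servedSet, voronoiCell]
  rw [this]
  exact (measurable_bs_apply j hB).inter (MeasurableSet.iInter fun l =>
    measurableSet_le (by fun_prop) (by fun_prop))

/-- The mean of `f (distance)` over the base station in `B` that serves `x`. -/
noncomputable def servedMass (lam : ℝ) (B : Set Plane) (f : ℝ → ℝ≥0∞) (x : Plane) : ℝ≥0∞ :=
  ENNReal.ofReal lam * ∫⁻ z in B, f ‖z - x‖ *
    expNeg (ENNReal.ofReal lam * ENNReal.ofReal (Real.pi * ‖z - x‖ ^ 2))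

theorem measurable_servedMass (lam : ℝ) (B : Set Plane) {f : ℝ → ℝ≥0∞} (hf : Measurable f) :
    Measurable (servedMass lam B f) := by
  unfold servedMass
  refine Measurable.const_mul (Measurable.lintegral_prod_right' (f := fun z : Plane × Plane =>
    f ‖z.2 - z.1‖ * expNeg (ENNReal.ofReal lam * ENNReal.ofReal (Real.pi * ‖z.2 - z.1‖ ^ 2)))
    (by fun_prop)) _

theorem servedMass_ne_top (lam : ℝ) {B : Set Plane} (hB : volume B ≠ ∞) {f : ℝ → ℝ≥0∞}
    (hf : ∀ r, 0 ≤ r → f r ≤ 1) (x : Plane) : servedMass lam B f x ≠ ∞ := by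
  refine ENNReal.mul_ne_top ENNReal.ofReal_ne_top (ne_top_of_le_ne_top hB ?_)
  refine (lintegral_mono fun z => mul_le_one' (hf _ (norm_nonneg _)) (expNeg_le_one _)).trans ?_
  simp

/-- Exchanging the integrals over `x` and `z`, each `z` in `B` contributes the same amount by
translation and reflection invariance, namely a Rayleigh mean. This produces the factor `|B|` that
cancels the Palm normalization. -/
theorem lintegral_servedMass {lam : ℝ} (hl : 0 < lam) (B : Set Plane) {f : ℝ → ℝ≥0∞}
    (hf : Measurable f) :
    ∫⁻ x, servedMass lam B f x = volume B * ∫⁻ r, f r ∂rayleighLaw lam := by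
  unfold servedMass
  rw [lintegral_const_mul' _ _ ENNReal.ofReal_ne_top,
    lintegral_lintegral_swap (Measurable.aemeasurable (by fun_prop))]
  have h1 : ∀ z : Plane, ∫⁻ x : Plane, f ‖z - x‖ *
      expNeg (ENNReal.ofReal lam * ENNReal.ofReal (Real.pi * ‖z - x‖ ^ 2)) =
      ∫⁻ x : Plane, f ‖x‖ * expNeg (ENNReal.ofReal lam * ENNReal.ofReal (Real.pi * ‖x‖ ^ 2)) :=
    fun z => lintegral_sub_left_eq_self (μ := volume) (fun x : Plane => f ‖x‖ *
      expNeg (ENNReal.ofReal lam * ENNReal.ofReal (Real.pi * ‖x‖ ^ 2))) z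
  simp_rw [h1]
  rw [lintegral_const, Measure.restrict_apply_univ, lintegral_rayleighLaw hl hf]
  ring

theorem lintegral_indicator_comp_norm_ne_top {B : Set Plane} (hB : MeasurableSet B)
    (hBtop : volume B ≠ ∞) {f : ℝ → ℝ≥0∞} (hf1 : ∀ r, 0 ≤ r → f r ≤ 1) (x : Plane) :
    ∫⁻ z, B.indicator (fun z => f ‖z - x‖) z ≠ ∞ := by
  rw [lintegral_indicator hB]
  refine ne_top_of_le_ne_top hBtop ((lintegral_mono fun z => hf1 _ (norm_nonneg _)).trans ?_)
  simp

/-- The case `ϑ = 0` of the Voronoi formula: the attenuation is `1`, and only the emptiness of the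
disc of radius `‖z - x‖` remains. -/
theorem IsNetworkLaw.lintegral_served (hP : IsNetworkLaw p P) {B : Set Plane}
    (hB : MeasurableSet B) (hBtop : volume B ≠ ∞) {f : ℝ → ℝ≥0∞} (hf : Measurable f)
    (hf1 : ∀ r, 0 ≤ r → f r ≤ 1) (x : Plane) :
    ∫⁻ c, ∑' j, (servedSet B x j).indicator (fun c => f ‖c.bs j - x‖) c ∂P =
      servedMass p.lamB B f x := by
  have hα : 0 < p.α := by linarith [p.two_lt_α]
  have h := hP.bs_poisson.campbell_voronoi measurable_bs_apply p.lamB_pos.le x hα le_rfl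
    (φ := B.indicator fun z => f ‖z - x‖) (Measurable.indicator (by fun_prop) hB)
    (lintegral_indicator_comp_norm_ne_top hB hBtop hf1 x) fun z =>
      ne_top_of_le_ne_top ENNReal.one_ne_top (Set.indicator_le' (fun z _ => hf1 _ (norm_nonneg _))
        (fun _ _ => zero_le_one) z)
  simp_rw [lintegral_one_sub_farKernel_zero (norm_nonneg _), zero_mul, attenuation_zero] at h
  rw [servedMass, ← lintegral_indicator hB]
  convert h using 1
  · refine lintegral_congr fun c => tsum_congr fun j => ?_
    by_cases h1 : c.bs j ∈ B <;> by_cases h2 : x ∈ voronoiCell c.bs (c.bs j) <;>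
      simp [servedSet, h1, h2, prodOthers, infProd_one]
  · congr 1
    refine lintegral_congr fun z => ?_
    by_cases h1 : z ∈ B <;> simp [h1]

/-- The SINR of base station `j` at a receiver of a transmitter at `x`. -/
noncomputable def stationSinr (p : Params) (c : Config) (x : Plane) (i k j : ℕ) : ℝ≥0∞ :=
  rxPower p (c.fadeC i k j) ‖c.bs j - x‖ /
    (ENNReal.ofReal (p.noise / p.Pb) +
      ∑' l : ℕ, if l = j then 0 else rxPower p (c.fadeC i k l) ‖c.bs l - x‖)

theorem measurable_stationSinr (p : Params) (x : Plane) (i k j : ℕ) :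
    Measurable fun c => stationSinr p c x i k j := by
  unfold stationSinr rxPower pathLoss
  refine Measurable.div (by fun_prop) (Measurable.const_add (Measurable.tsum fun l => ?_) _)
  split_ifs <;> fun_prop

/-- The probability that base station `j` reaches a receiver of a transmitter at `x`, given the
base stations. -/
noncomputable def stationProb (p : Params) (b : ℕ → Plane) (x : Plane) (j : ℕ) : ℝ≥0∞ :=
  expNeg (ENNReal.ofReal (p.T * (p.noise / p.Pb) * p.A * ‖b j - x‖ ^ p.α)) *
    prodOthers (fun z => attenuation p.α (p.T * ‖b j - x‖ ^ p.α) ‖z - x‖) b j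

theorem measurable_stationProb (p : Params) (x : Plane) (j : ℕ) :
    Measurable fun c : Config => stationProb p c.bs x j := by
  unfold stationProb prodOthers attenuation
  refine Measurable.mul (by fun_prop) (measurable_infProd fun l => ?_)
  split_ifs <;> fun_prop

theorem IsNetworkLaw.measure_le_stationSinr (hP : IsNetworkLaw p P) (c : Config) {x : Plane}
    (i k : ℕ) {j : ℕ} (hj : c.bs j ≠ x) :
    P {c' : Config | ENNReal.ofReal p.T ≤ stationSinr p { c with fadeC := c'.fadeC } x i k j} =
      stationProb p c.bs x j := by
  have hr' : 0 < ‖c.bs j - x‖ := norm_pos_iff.2 (sub_ne_zero.2 hj)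
  have hpos : ∀ᵐ c' ∂P, 0 < c'.fadeC i k j :=
    ae_pos_of_map_eq_expMeasure (by fun_prop) (hP.fadeC_law i k j)
  have h1 := measure_fadingEvent (Q := P) (F := fun l c' => c'.fadeC i k l)
    (fun l => by fun_prop) (fun l => hP.fadeC_law i k l)
    (hP.fadeC_indep.precomp (g := fun l : ℕ => (i, k, l)) fun a b hab => by simpa using hab)
    (ENNReal.ofReal (p.T * (p.noise / p.Pb) * p.A * ‖c.bs j - x‖ ^ p.α))
    (fun l => ENNReal.ofReal (p.T * ‖c.bs j - x‖ ^ p.α) /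
      ENNReal.ofReal (‖c.bs l - x‖ ^ p.α)) j
  refine Eq.trans (measure_congr ?_) h1
  filter_upwards [hpos] with c' hc'
  exact propext (le_sinr_iff p hr' (fun l => c'.fadeC i k l) (fun l => ‖c.bs l - x‖) j hc')

theorem IsPoissonProcess.ae_ne {P : Measure Config} [IsProbabilityMeasure P]
    {p : Config → ℕ → Plane} {lam : ℝ} (h : IsPoissonProcess P p lam)
    (hp : ∀ i, Measurable fun c => p c i) (hl : 0 ≤ lam) (x : Plane) :
    ∀ᵐ c ∂P, ∀ j, p c j ≠ x := by
  have hm : Measurable (({x} : Set Plane).indicator (1 : Plane → ℝ≥0∞)) :=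
    measurable_one.indicator (measurableSet_singleton x)
  have h1 := h.campbell hp hl hm
  have hm' : ∀ i, Measurable fun c => ({x} : Set Plane).indicator (1 : Plane → ℝ≥0∞) (p c i) :=
    fun i => hm.comp (hp i)
  rw [lintegral_indicator_one (measurableSet_singleton x), measure_singleton, mul_zero,
    lintegral_eq_zero_iff (Measurable.tsum hm')] at h1
  filter_upwards [h1] with c hc j hj
  have := (ENNReal.tsum_eq_zero.1 hc) j
  simp [hj] at this

theorem qfun_nonneg (p : Params) (r : ℝ) : 0 ≤ qfun p r := (Real.exp_pos _).le

theorem qfun_le_one (p : Params) {r : ℝ} (hr : 0 ≤ r) : qfun p r ≤ 1 := by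
  have h1 := Hfun_nonneg (α := p.α) p.T_pos
  have := p.noise_nonneg
  have := p.Pb_pos
  have := p.A_pos
  have := p.T_pos
  have := p.lamB_pos
  have h2 : 0 ≤ p.T * (p.noise / p.Pb) * p.A * r ^ p.α := by positivity
  have h3 : 0 ≤ 2 * Real.pi * p.lamB * Hfun p.T p.α * r ^ 2 := by positivity
  exact Real.exp_le_one_iff.2 (by linarith)

theorem measurable_qfun (p : Params) : Measurable (qfun p) := by
  unfold qfun; fun_prop

/-- The mean number of base stations in `B` that serve a transmitter at `x`, assist it and reach
its receiver. -/
theorem IsNetworkLaw.lintegral_served_reached (hP : IsNetworkLaw p P) {B : Set Plane}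
    (hB : MeasurableSet B) (hBtop : volume B ≠ ∞) {g : ℝ → ℝ} (hg : Measurable g)
    (hg01 : ∀ r, 0 ≤ r → g r ∈ Set.Icc (0 : ℝ) 1) (x : Plane) (i k : ℕ) :
    ∫⁻ c, ∑' j, (servedSet B x j ∩ {c | c.coin i < g ‖c.bs j - x‖} ∩
        {c | ENNReal.ofReal p.T ≤ stationSinr p c x i k j}).indicator 1 c ∂P =
      servedMass p.lamB B (fun r => ENNReal.ofReal (g r * qfun p r)) x := by
  have hα : 0 < p.α := by linarith [p.two_lt_α]
  have hg1 : ∀ r, 0 ≤ r → ENNReal.ofReal (g r) ≤ 1 := fun r hr => by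
    simpa using (hg01 r hr).2
  have hS := measurableSet_servedSet hB x
  have hC : ∀ j, MeasurableSet {c : Config | c.coin i < g ‖c.bs j - x‖} := fun j =>
    measurableSet_lt (by fun_prop) (by fun_prop)
  have hF : ∀ j, MeasurableSet {c | ENNReal.ofReal p.T ≤ stationSinr p c x i k j} := fun j =>
    measurableSet_le measurable_const (measurable_stationSinr p x i k j)
  have hC1 : ∀ j, Measurable fun c : Config => (servedSet B x j ∩
      {c | c.coin i < g ‖c.bs j - x‖}).indicator (fun c => stationProb p c.bs x j) c := fun j =>
    (measurable_stationProb p x j).indicator ((hS j).inter (hC j))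
  have hF1 : ∀ j, Measurable fun c : Config => (servedSet B x j ∩ {c | c.coin i < g ‖c.bs j - x‖} ∩
        {c | ENNReal.ofReal p.T ≤ stationSinr p c x i k j}).indicator (1 : Config → ℝ≥0∞) c :=
    fun j => measurable_one.indicator (((hS j).inter (hC j)).inter (hF j))
  -- Averaging over the cellular fading replaces the SINR event by its probability given the
  -- stations; no station lies exactly at `x`, almost surely.
  have step1 : ∫⁻ c, ∑' j, (servedSet B x j ∩ {c | c.coin i < g ‖c.bs j - x‖} ∩
        {c | ENNReal.ofReal p.T ≤ stationSinr p c x i k j}).indicator 1 c ∂P =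
      ∫⁻ c, ∑' j, (servedSet B x j ∩ {c | c.coin i < g ‖c.bs j - x‖}).indicator
        (fun c => stationProb p c.bs x j) c ∂P := by
    rw [hP.lintegral_resample_fadeC (Measurable.tsum hF1)]
    refine lintegral_congr_ae ?_
    filter_upwards [hP.bs_poisson.ae_ne measurable_bs_apply p.lamB_pos.le x] with c hc
    have hr : Measurable fun c' : Config => ({ c with fadeC := c'.fadeC } : Config) :=
      measurable_configMk measurable_const measurable_const measurable_const
        measurable_const measurable_const measurable_const measurable_fadeC
    have hF1' : ∀ j, Measurable fun c' : Config => (servedSet B x j ∩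
        {c | c.coin i < g ‖c.bs j - x‖} ∩ {c | ENNReal.ofReal p.T ≤ stationSinr p c x i k j}).indicator
          (1 : Config → ℝ≥0∞) { c with fadeC := c'.fadeC } := fun j => (hF1 j).comp hr
    rw [lintegral_tsum fun j => (hF1' j).aemeasurable]
    refine tsum_congr fun j => ?_
    by_cases hcj : c ∈ servedSet B x j ∩ {c | c.coin i < g ‖c.bs j - x‖}
    · rw [Set.indicator_of_mem hcj, ← hP.measure_le_stationSinr c i k (hc j),
        ← lintegral_indicator_one (show MeasurableSet {c' : Config | ENNReal.ofReal p.T ≤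
          stationSinr p { c with fadeC := c'.fadeC } x i k j} from hr (hF j))]
      refine lintegral_congr fun c' => ?_
      have hcj' : ({ c with fadeC := c'.fadeC } : Config) ∈
        servedSet B x j ∩ {c | c.coin i < g ‖c.bs j - x‖} := hcj
      by_cases hx : ENNReal.ofReal p.T ≤ stationSinr p { c with fadeC := c'.fadeC } x i k j
      · exact (Set.indicator_of_mem (Set.mem_inter hcj' hx) _).trans
          (Set.indicator_of_mem (show c' ∈ {c' : Config | ENNReal.ofReal p.T ≤
            stationSinr p { c with fadeC := c'.fadeC } x i k j} from hx)
              (1 : Config → ℝ≥0∞)).symm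
      · exact (Set.indicator_of_notMem (fun h => hx h.2) _).trans
          (Set.indicator_of_notMem (show c' ∉ {c' : Config | ENNReal.ofReal p.T ≤
            stationSinr p { c with fadeC := c'.fadeC } x i k j} from hx) _).symm
    · rw [Set.indicator_of_notMem hcj]
      refine (lintegral_congr fun c' => ?_).trans lintegral_zero
      exact Set.indicator_of_notMem (fun h => hcj h.1) _
  -- Averaging over the coin replaces assistance by its probability `g`.
  have step2 : ∫⁻ c, ∑' j, (servedSet B x j ∩ {c | c.coin i < g ‖c.bs j - x‖}).indicator
        (fun c => stationProb p c.bs x j) c ∂P =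
      ∫⁻ c, ∑' j, (servedSet B x j).indicator
        (fun c => ENNReal.ofReal (g ‖c.bs j - x‖) * stationProb p c.bs x j) c ∂P := by
    rw [hP.lintegral_resample_coin (Measurable.tsum hC1)]
    refine lintegral_congr fun c => ?_
    have hr : Measurable fun c' : Config => ({ c with coin := c'.coin } : Config) :=
      measurable_configMk measurable_const measurable_const measurable_const
        measurable_const measurable_coin measurable_const measurable_const
    have hC1' : ∀ j, Measurable fun c' : Config => (servedSet B x j ∩
        {c | c.coin i < g ‖c.bs j - x‖}).indicator (fun c => stationProb p c.bs x j)
          { c with coin := c'.coin } := fun j => (hC1 j).comp hr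
    rw [lintegral_tsum fun j => (hC1' j).aemeasurable]
    refine tsum_congr fun j => ?_
    by_cases hcj : c ∈ servedSet B x j
    · have hlt : MeasurableSet {c' : Config | c'.coin i < g ‖c.bs j - x‖} :=
        measurableSet_lt (by fun_prop) measurable_const
      rw [Set.indicator_of_mem hcj, ← hP.measure_coin_lt i (hg01 _ (norm_nonneg _)), mul_comm,
        ← lintegral_indicator_const hlt]
      refine lintegral_congr fun c' => ?_
      have hcj' : ({ c with coin := c'.coin } : Config) ∈ servedSet B x j := hcj
      by_cases hx : c'.coin i < g ‖c.bs j - x‖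
      · exact (Set.indicator_of_mem (Set.mem_inter hcj' hx) _).trans
          (Set.indicator_of_mem (show c' ∈ {c' : Config | c'.coin i < g ‖c.bs j - x‖}
            from hx) fun _ => stationProb p c.bs x j).symm
      · exact (Set.indicator_of_notMem (fun h => hx h.2) _).trans
          (Set.indicator_of_notMem (show c' ∉ {c' : Config | c'.coin i < g ‖c.bs j - x‖}
            from hx) _).symm
    · rw [Set.indicator_of_notMem hcj]
      refine (lintegral_congr fun c' => ?_).trans lintegral_zero
      exact Set.indicator_of_notMem (fun h => hcj h.1) _
  have hfm : Measurable fun r => ENNReal.ofReal (g r) *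
      expNeg (ENNReal.ofReal (p.T * (p.noise / p.Pb) * p.A * r ^ p.α)) := by fun_prop
  have hf1 : ∀ r, 0 ≤ r → ENNReal.ofReal (g r) *
      expNeg (ENNReal.ofReal (p.T * (p.noise / p.Pb) * p.A * r ^ p.α)) ≤ 1 := fun r hr =>
    mul_le_one' (hg1 r hr) (expNeg_le_one _)
  have h := hP.bs_poisson.campbell_voronoi measurable_bs_apply p.lamB_pos.le x hα p.T_pos.le
    (φ := B.indicator fun z => ENNReal.ofReal (g ‖z - x‖) *
      expNeg (ENNReal.ofReal (p.T * (p.noise / p.Pb) * p.A * ‖z - x‖ ^ p.α)))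
    (Measurable.indicator (by fun_prop) hB)
    (lintegral_indicator_comp_norm_ne_top hB hBtop hf1 x) fun z =>
      ne_top_of_le_ne_top ENNReal.one_ne_top (Set.indicator_le' (fun z _ => hf1 _ (norm_nonneg _))
        (fun _ _ => zero_le_one) z)
  -- The term `π r²` is the empty disc, already part of `servedMass`; the term with `H` is the
  -- interference, which together with the noise makes up `q`.
  have hfar : ∀ r, 0 ≤ r → ∫⁻ y : Plane, 1 - farKernel p.α p.T r ‖y‖ =
      ENNReal.ofReal (Real.pi * r ^ 2 + 2 * Real.pi * Hfun p.T p.α * r ^ 2) := fun r hr =>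
    lintegral_one_sub_attenuation_far p.T_pos p.two_lt_α hr
  rw [step1, step2, servedMass, ← lintegral_indicator hB]
  convert h using 1
  · refine lintegral_congr fun c => tsum_congr fun j => ?_
    by_cases h1 : c.bs j ∈ B <;> by_cases h2 : x ∈ voronoiCell c.bs (c.bs j) <;>
      simp [servedSet, h1, h2, stationProb, mul_assoc]
  · congr 1
    refine lintegral_congr fun z => ?_
    by_cases h1 : z ∈ B
    · have hH := Hfun_nonneg (α := p.α) p.T_pos
      have := p.noise_nonneg
      have := p.Pb_pos
      have := p.A_pos
      have := p.T_pos
      have hl := p.lamB_pos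
      rw [Set.indicator_of_mem h1, Set.indicator_of_mem h1, hfar _ (norm_nonneg _),
        ENNReal.ofReal_add (by positivity) (by positivity), mul_add, expNeg_add,
        ENNReal.ofReal_mul (hg01 _ (norm_nonneg _)).1, ← ENNReal.ofReal_mul hl.le (q := 2 * _ * _ * _),
        expNeg_ofReal (by positivity), expNeg_ofReal (x := p.lamB * _) (by positivity)]
      have hq : ENNReal.ofReal (qfun p ‖z - x‖) = ENNReal.ofReal (Real.exp (-(p.T *
          (p.noise / p.Pb) * p.A * ‖z - x‖ ^ p.α))) * ENNReal.ofReal (Real.exp (-(p.lamB *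
            (2 * Real.pi * Hfun p.T p.α * ‖z - x‖ ^ 2)))) := by
        rw [← ENNReal.ofReal_mul (Real.exp_pos _).le, ← Real.exp_add, qfun]
        congr 2; ring
      rw [hq]; ring
    · simp [h1]

end Served

/-! ### From the Palm measure to sums over transmitters -/

section Palm

theorem lintegral_palm (P : Measure Config) {pts : Config → ℕ → Plane}
    (hpts : ∀ j, Measurable fun c => pts c j) (lam : ℝ) {B : Set Plane} (hB : MeasurableSet B)
    {Φ : Config → ℝ≥0∞} (hΦ : Measurable Φ) :
    ∫⁻ c, Φ c ∂palm P pts lam B = (ENNReal.ofReal lam * volume B)⁻¹ *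
      ∫⁻ c, ∑' j, {c | pts c j ∈ B}.indicator (fun c => Φ (c.shift (pts c j))) c ∂P := by
  have hs : ∀ j, MeasurableSet {c | pts c j ∈ B} := fun j => hpts j hB
  have hsh : ∀ j, Measurable fun c : Config => c.shift (pts c j) := fun j =>
    measurable_shift (hpts j)
  have hm : ∀ j, Measurable ({c | pts c j ∈ B}.indicator fun c => Φ (c.shift (pts c j))) :=
    fun j => (hΦ.comp (hsh j)).indicator (hs j)
  rw [palm, lintegral_smul_measure, lintegral_sum_measure, smul_eq_mul,
    lintegral_tsum fun j => (hm j).aemeasurable]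
  congr 1
  refine tsum_congr fun j => ?_
  rw [lintegral_map hΦ (hsh j), lintegral_indicator (hs j)]

theorem shift_tx_mem_voronoiCell (c : Config) (v : Plane) (i : ℕ) :
    (c.shift v).tx i ∈ voronoiCell (c.shift v).bs 0 ↔ c.tx i ∈ voronoiCell c.bs v := by
  simp [voronoiCell, Config.shift]

theorem coveredD_shift (p : Params) (c : Config) (v : Plane) (i k : ℕ) :
    CoveredD p (c.shift v) i k ↔ CoveredD p c i k := by
  simp [CoveredD, sinrD, Config.shift]

/-- Only differences of positions enter the SINRs, the Voronoi condition and the assistance rule. -/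
theorem covered_shift (p : Params) (g : ℝ → ℝ) (c : Config) (v : Plane) (i k : ℕ) :
    Covered p g (c.shift v) i k ↔ Covered p g c i k := by
  simp only [Covered, coveredD_shift]
  simp [Assists, voronoiCell, sinrC, Config.shift]

/-- The realization `c`, with everything that is attached to the base stations taken from `c'`. -/
def Config.withStations (c c' : Config) : Config :=
  ⟨c'.bs, c.tx, c.num, c.rx, c'.coin, c.fadeD, c'.fadeC⟩

theorem measurable_withStations : Measurable fun z : Config × Config => z.1.withStations z.2 :=
  measurable_configMk (by fun_prop) (by fun_prop) (by fun_prop) (by fun_prop) (by fun_prop)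
    (by fun_prop) (by fun_prop)

variable {p : Params} {P : Measure Config} [IsProbabilityMeasure P]

/-- After the shift, lying in the cell of the origin means lying in the cell of the station shifted
to it. Exchanging the sums over stations and transmitters, and taking everything attached to the
stations from an independent copy, leaves an inner mean in which the transmitter position is
constant. -/
theorem IsNetworkLaw.lintegral_palm_cellSum (hP : IsNetworkLaw p P) {B : Set Plane}
    (hB : MeasurableSet B) {Y : Config → ℕ → ℝ≥0∞} (hY : ∀ i, Measurable fun c => Y c i) :
    ∫⁻ c, cellSum c (Y c) ∂palm P Config.bs p.lamB B = (ENNReal.ofReal p.lamB * volume B)⁻¹ *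
      ∫⁻ c, ∑' i, ∫⁻ c', ∑' j, (servedSet B (c.tx i) j).indicator
        (fun c' => Y ((c.withStations c').shift (c'.bs j)) i) c' ∂P ∂P := by
  classical
  let V : ℕ → ℕ → Set Config := fun i j => {c | c.bs j ∈ B ∧ c.tx i ∈ voronoiCell c.bs (c.bs j)}
  have hV : ∀ i j, MeasurableSet (V i j) := fun i j =>
    (measurable_bs_apply j hB).inter (measurableSet_voronoi (measurable_bs_apply j) i)
  have hm : ∀ i j, Measurable ((V i j).indicator fun c => Y (c.shift (c.bs j)) i) := fun i j =>
    ((hY i).comp (measurable_shift_bs j)).indicator (hV i j)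
  have h1 : ∀ c : Config, ∑' j, {c : Config | c.bs j ∈ B}.indicator
      (fun c => cellSum (c.shift (c.bs j)) (Y (c.shift (c.bs j)))) c =
      ∑' i, ∑' j, (V i j).indicator (fun c => Y (c.shift (c.bs j)) i) c := fun c => by
    rw [ENNReal.tsum_comm]
    refine tsum_congr fun j => ?_
    by_cases hj : c.bs j ∈ B
    · rw [Set.indicator_of_mem (show c ∈ {c : Config | c.bs j ∈ B} from hj)]
      unfold cellSum
      refine tsum_congr fun i => ?_
      simp only [shift_tx_mem_voronoiCell]
      by_cases hi : c.tx i ∈ voronoiCell c.bs (c.bs j)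
      · rw [if_pos hi, Set.indicator_of_mem (show c ∈ V i j from ⟨hj, hi⟩)]
      · rw [if_neg hi, Set.indicator_of_notMem fun h => hi h.2]
    · rw [Set.indicator_of_notMem (show c ∉ {c : Config | c.bs j ∈ B} from hj)]
      exact (ENNReal.tsum_eq_zero.2 fun i => Set.indicator_of_notMem (fun h => hj h.1) _).symm
  rw [lintegral_palm P measurable_bs_apply p.lamB hB (measurable_cellSum hY)]
  simp_rw [h1]
  congr 1
  rw [hP.lintegral_resample_bs (Measurable.tsum fun i => Measurable.tsum (hm i))]
  refine lintegral_congr fun c => ?_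
  have hm' : ∀ i, Measurable fun c' : Config => ∑' j, (V i j).indicator
      (fun c => Y (c.shift (c.bs j)) i) (c.withStations c') := fun i =>
    Measurable.tsum fun j => (hm i j).comp (measurable_withStations.comp measurable_prodMk_left)
  exact lintegral_tsum fun i => (hm' i).aemeasurable

/-- A receiver covered by its transmitter counts whatever the stations do; otherwise it counts only
if the serving station assists and reaches it. The two cases separate the D2D randomness in `c` from
the station randomness in `c'`. -/
theorem tsum_served_covered (g : ℝ → ℝ) (B : Set Plane) (c c' : Config) (i k : ℕ)
    (hties : ∀ j l, l ≠ j → ‖c'.bs l - c.tx i‖ ≠ ‖c'.bs j - c.tx i‖) :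
    ∑' j, (servedSet B (c.tx i) j).indicator (fun c' =>
        {c | Covered p g c i k}.indicator (1 : Config → ℝ≥0∞) (c.withStations c')) c' =
      {c | CoveredD p c i k}.indicator (fun c => ∑' j, (servedSet B (c.tx i) j).indicator 1 c') c +
        {c | CoveredD p c i k}ᶜ.indicator (fun c => ∑' j, (servedSet B (c.tx i) j ∩
          {c' | c'.coin i < g ‖c'.bs j - c.tx i‖} ∩ {c' | ENNReal.ofReal p.T ≤
            stationSinr p c' (c.tx i) i k j}).indicator 1 c') c := by
  by_cases hD : CoveredD p c i k
  · rw [Set.indicator_of_mem (show c ∈ {c | CoveredD p c i k} from hD),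
      Set.indicator_of_notMem (show c ∉ {c | CoveredD p c i k}ᶜ from fun h => h hD), add_zero]
    refine tsum_congr fun j => ?_
    congr 1 with c'
    exact Set.indicator_of_mem (show c.withStations c' ∈ {c | Covered p g c i k} from Or.inl hD) _
  · rw [Set.indicator_of_notMem (show c ∉ {c | CoveredD p c i k} from hD),
      Set.indicator_of_mem (show c ∈ {c | CoveredD p c i k}ᶜ from hD), zero_add]
    refine tsum_congr fun j => ?_
    by_cases hj : c' ∈ servedSet B (c.tx i) j
    · rw [Set.indicator_of_mem hj]
      have hiff : Covered p g (c.withStations c') i k ↔ c'.coin i < g ‖c'.bs j - c.tx i‖ ∧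
          ENNReal.ofReal p.T ≤ stationSinr p c' (c.tx i) i k j := by
        constructor
        · rintro (h | ⟨l, ⟨hl, hc⟩, hs⟩)
          · exact absurd h hD
          -- The assisting station `l` and the station `j` are both nearest to the transmitter,
          -- hence equal by the absence of ties.
          · have hlj : l = j := by
              by_contra hne
              refine hties j l hne ?_
              rw [norm_sub_rev, norm_sub_rev (c'.bs j)]
              exact le_antisymm (hl j) (hj.2 l)
            subst hlj
            rw [norm_sub_rev] at hc
            exact ⟨hc, hs⟩
        · rintro ⟨hc, hs⟩
          rw [norm_sub_rev] at hc
          exact Or.inr ⟨j, ⟨hj.2, hc⟩, hs⟩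
      by_cases hC : Covered p g (c.withStations c') i k
      · have := hiff.1 hC
        rw [Set.indicator_of_mem (show _ ∈ {c | Covered p g c i k} from hC),
          Set.indicator_of_mem (Set.mem_inter (Set.mem_inter hj this.1) this.2)]
        rfl
      · rw [Set.indicator_of_notMem (show _ ∉ {c | Covered p g c i k} from hC),
          Set.indicator_of_notMem fun h => hC (hiff.2 ⟨h.1.2, h.2⟩)]
    · rw [Set.indicator_of_notMem hj, Set.indicator_of_notMem fun h => hj h.1.1]

/-- The pointwise decomposition is integrated over the stations alone: D2D coverage is then
constant, and the two cases acquire the weights with `f = 1` and `f = g q`. -/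
theorem IsNetworkLaw.lintegral_served_countRx (hP : IsNetworkLaw p P) {B : Set Plane}
    (hB : MeasurableSet B) (hBtop : volume B ≠ ∞) {g : ℝ → ℝ} (hg : Measurable g)
    (hg01 : ∀ r, 0 ≤ r → g r ∈ Set.Icc (0 : ℝ) 1) (c : Config) (i : ℕ) :
    ∫⁻ c', ∑' j, (servedSet B (c.tx i) j).indicator (fun c' =>
        countRx ((c.withStations c').shift (c'.bs j)) i
          (fun k => Covered p g ((c.withStations c').shift (c'.bs j)) i k)) c' ∂P =
      ∑ k ∈ Finset.range (c.num i), ({c | CoveredD p c i k}.indicator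
          (fun c => servedMass p.lamB B (fun _ => 1) (c.tx i)) c +
        {c | CoveredD p c i k}ᶜ.indicator
          (fun c => servedMass p.lamB B (fun r => ENNReal.ofReal (g r * qfun p r)) (c.tx i)) c) := by
  classical
  have hS := measurableSet_servedSet hB (c.tx i)
  have hm1 : Measurable fun c' => ∑' j, (servedSet B (c.tx i) j).indicator (1 : Config → ℝ≥0∞) c' :=
    Measurable.tsum fun j => measurable_one.indicator (hS j)
  have hm2 : ∀ k, Measurable fun c' => ∑' j, (servedSet B (c.tx i) j ∩
      {c' | c'.coin i < g ‖c'.bs j - c.tx i‖} ∩ {c' | ENNReal.ofReal p.T ≤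
        stationSinr p c' (c.tx i) i k j}).indicator (1 : Config → ℝ≥0∞) c' := fun k =>
    Measurable.tsum fun j => measurable_one.indicator (((hS j).inter
      (measurableSet_lt (by fun_prop) (by fun_prop))).inter
        (measurableSet_le measurable_const (measurable_stationSinr p (c.tx i) i k j)))
  have h1 : ∫⁻ c', ∑' j, (servedSet B (c.tx i) j).indicator (1 : Config → ℝ≥0∞) c' ∂P =
      servedMass p.lamB B (fun _ => 1) (c.tx i) :=
    hP.lintegral_served hB hBtop measurable_const (fun _ _ => le_rfl) (c.tx i)
  have h2 := fun k => hP.lintegral_served_reached hB hBtop hg hg01 (c.tx i) i k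
  have hsum : ∀ᵐ c' ∂P, ∑' j, (servedSet B (c.tx i) j).indicator (fun c' =>
        countRx ((c.withStations c').shift (c'.bs j)) i
          (fun k => Covered p g ((c.withStations c').shift (c'.bs j)) i k)) c' =
      ∑ k ∈ Finset.range (c.num i), ({c | CoveredD p c i k}.indicator
          (fun c => ∑' j, (servedSet B (c.tx i) j).indicator 1 c') c +
        {c | CoveredD p c i k}ᶜ.indicator (fun c => ∑' j, (servedSet B (c.tx i) j ∩
          {c' | c'.coin i < g ‖c'.bs j - c.tx i‖} ∩ {c' | ENNReal.ofReal p.T ≤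
            stationSinr p c' (c.tx i) i k j}).indicator 1 c') c) := by
    filter_upwards [hP.bs_poisson.ae_norm_sub_ne measurable_bs_apply p.lamB_pos.le (c.tx i)]
      with c' hc'
    rw [← Finset.sum_congr rfl fun k _ => tsum_served_covered g B c c' i k hc',
      ← Summable.tsum_finsetSum fun k _ => ENNReal.summable]
    refine tsum_congr fun j => ?_
    by_cases hj : c' ∈ servedSet B (c.tx i) j
    · rw [Set.indicator_of_mem hj]
      simp only [countRx, covered_shift]
      refine Finset.sum_congr rfl fun k _ => ?_
      rw [Set.indicator_of_mem hj]
      simp [Set.indicator]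
    · simp [Set.indicator_of_notMem hj]
  have hm3 : ∀ k, Measurable fun c' => {c | CoveredD p c i k}.indicator
      (fun c => ∑' j, (servedSet B (c.tx i) j).indicator (1 : Config → ℝ≥0∞) c') c := fun k => by
    by_cases hD : CoveredD p c i k
    · simpa [Set.indicator, hD] using hm1
    · simp [Set.indicator, hD]
  have hm4 : ∀ k, Measurable fun c' => {c | CoveredD p c i k}ᶜ.indicator
      (fun c => ∑' j, (servedSet B (c.tx i) j ∩
          {c' | c'.coin i < g ‖c'.bs j - c.tx i‖} ∩ {c' | ENNReal.ofReal p.T ≤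
            stationSinr p c' (c.tx i) i k j}).indicator (1 : Config → ℝ≥0∞) c') c := fun k => by
    by_cases hD : CoveredD p c i k
    · simp [Set.indicator, hD]
    · simp only [Set.indicator_of_mem (show c ∈ {c | CoveredD p c i k}ᶜ from hD)]
      exact hm2 k
  rw [lintegral_congr_ae hsum]
  refine (lintegral_finsetSum _ fun k _ => (hm3 k).add (hm4 k)).trans ?_
  refine Finset.sum_congr rfl fun k _ => ?_
  refine (lintegral_add_left (hm3 k) _).trans ?_
  by_cases hD : CoveredD p c i k
  · have e1 : c ∈ {c | CoveredD p c i k} := hD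
    have e2 : c ∉ {c | CoveredD p c i k}ᶜ := fun h => h hD
    simp only [Set.indicator_of_mem e1, Set.indicator_of_notMem e2]
    rw [h1, lintegral_zero]
  · have e1 : c ∉ {c | CoveredD p c i k} := hD
    have e2 : c ∈ {c | CoveredD p c i k}ᶜ := hD
    simp only [Set.indicator_of_notMem e1, Set.indicator_of_mem e2]
    rw [h2 k, lintegral_zero]

end Palm

/-! ### The four identities -/

section Main

variable {p : Params} {P : Measure Config} [IsProbabilityMeasure P]

theorem ae_rayleighLaw_nonneg (lam : ℝ) : ∀ᵐ r ∂rayleighLaw lam, 0 ≤ r :=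
  (withDensity_absolutelyContinuous _ _).ae_le (ae_restrict_mem measurableSet_Ici)

theorem integrable_rayleighLaw {lam : ℝ} (hl : 0 < lam) {f : ℝ → ℝ} (hf : Measurable f)
    (hf01 : ∀ r, 0 ≤ r → f r ∈ Set.Icc (0 : ℝ) 1) : Integrable f (rayleighLaw lam) := by
  have := isProbabilityMeasure_rayleighLaw hl
  refine Integrable.of_bound hf.aestronglyMeasurable 1 ?_
  filter_upwards [ae_rayleighLaw_nonneg lam] with r hr
  rw [Real.norm_of_nonneg (hf01 r hr).1]
  exact (hf01 r hr).2

theorem lintegral_ofReal_rayleighLaw {lam : ℝ} (hl : 0 < lam) {f : ℝ → ℝ} (hf : Measurable f)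
    (hf01 : ∀ r, 0 ≤ r → f r ∈ Set.Icc (0 : ℝ) 1) :
    ∫⁻ r, ENNReal.ofReal (f r) ∂rayleighLaw lam = ENNReal.ofReal (∫ r, f r ∂rayleighLaw lam) :=
  (ofReal_integral_eq_lintegral_ofReal (integrable_rayleighLaw hl hf hf01)
    ((ae_rayleighLaw_nonneg lam).mono fun r hr => (hf01 r hr).1)).symm

theorem lintegral_servedMass_ne_top {lam : ℝ} (hl : 0 < lam) {B : Set Plane} (hB : volume B ≠ ∞)
    {f : ℝ → ℝ≥0∞} (hf : Measurable f) (hf1 : ∀ r, 0 ≤ r → f r ≤ 1) :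
    ∫⁻ x, servedMass lam B f x ≠ ∞ := by
  have := isProbabilityMeasure_rayleighLaw hl
  rw [lintegral_servedMass hl B hf]
  refine ENNReal.mul_ne_top hB (ne_top_of_le_ne_top ENNReal.one_ne_top
    ((lintegral_mono_ae ((ae_rayleighLaw_nonneg lam).mono fun r hr => hf1 r hr)).trans ?_))
  simp

theorem palm_normalization {lam mu v : ℝ} {V : ℝ≥0∞} (hl : 0 < lam) (hm : 0 ≤ mu) (hV0 : V ≠ 0)
    (hV : V ≠ ∞) :
    (ENNReal.ofReal lam * V)⁻¹ * (ENNReal.ofReal mu * (V * ENNReal.ofReal v)) =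
      ENNReal.ofReal (mu / lam * v) := by
  rw [ENNReal.mul_inv (Or.inr hV) (Or.inl ENNReal.ofReal_ne_top),
    ENNReal.ofReal_mul (by positivity), ENNReal.ofReal_div_of_pos hl, div_eq_mul_inv]
  calc _ = (V⁻¹ * V) * (ENNReal.ofReal mu * (ENNReal.ofReal lam)⁻¹ * ENNReal.ofReal v) := by ring
    _ = _ := by rw [ENNReal.inv_mul_cancel hV0 hV, one_mul]

/-- No receivers are involved: the station side gives the weight with `f = g`, and Campbell's
formula sums it over the transmitters. -/
theorem IsNetworkLaw.lintegral_palm_cellSum_assisted (hP : IsNetworkLaw p P) {g : ℝ → ℝ}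
    (hg : Measurable g) (hg01 : ∀ r, 0 ≤ r → g r ∈ Set.Icc (0 : ℝ) 1) {B : Set Plane}
    (hB : MeasurableSet B) (hB0 : volume B ≠ 0) (hBtop : volume B ≠ ∞) :
    ∫⁻ c, cellSum c (fun i => ENNReal.ofReal (g ‖c.tx i‖)) ∂palm P Config.bs p.lamB B =
      ENNReal.ofReal (p.lamM / p.lamB * ∫ r, g r ∂rayleighLaw p.lamB) := by
  have hgm : Measurable fun r => ENNReal.ofReal (g r) := by fun_prop
  rw [hP.lintegral_palm_cellSum hB (Y := fun c i => ENNReal.ofReal (g ‖c.tx i‖))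
    fun i => by fun_prop]
  have h1 : ∀ (c : Config) (i : ℕ), ∫⁻ c', ∑' j, (servedSet B (c.tx i) j).indicator
      (fun c' => ENNReal.ofReal (g ‖((c.withStations c').shift (c'.bs j)).tx i‖)) c' ∂P =
      servedMass p.lamB B (fun r => ENNReal.ofReal (g r)) (c.tx i) := fun c i => by
    rw [← hP.lintegral_served hB hBtop hgm (fun r hr => by simpa using (hg01 r hr).2)]
    refine lintegral_congr fun c' => tsum_congr fun j => ?_
    congr 1 with c'
    rw [norm_sub_rev]
    rfl
  simp_rw [h1]
  rw [hP.tx_poisson.campbell measurable_tx_apply p.lamM_pos.le (measurable_servedMass _ _ hgm),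
    lintegral_servedMass p.lamB_pos B hgm, lintegral_ofReal_rayleighLaw p.lamB_pos hg hg01,
    palm_normalization p.lamB_pos p.lamM_pos.le hB0 hBtop]

/-- Covered and uncovered receivers get the same weight, so `N̄` cancels and `N̄_max` remains. -/
theorem IsNetworkLaw.lintegral_palm_cellSum_num (hP : IsNetworkLaw p P) {B : Set Plane}
    (hB : MeasurableSet B) (hB0 : volume B ≠ 0) (hBtop : volume B ≠ ∞) :
    ∫⁻ c, cellSum c (fun i => (c.num i : ℝ≥0∞)) ∂palm P Config.bs p.lamB B =
      ENNReal.ofReal (p.lamM / p.lamB * Nmax p) := by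
  have := isProbabilityMeasure_rayleighLaw p.lamB_pos
  have hN := hP.Nbar_mem_Icc
  have hW := measurable_servedMass p.lamB B (f := fun _ => 1) measurable_const
  have hWi := lintegral_servedMass_ne_top p.lamB_pos hBtop (f := fun _ => 1) measurable_const
    fun _ _ => le_rfl
  have hWt := servedMass_ne_top p.lamB hBtop (f := fun _ => 1) fun _ _ => le_rfl
  rw [hP.lintegral_palm_cellSum hB (Y := fun c i => (c.num i : ℝ≥0∞)) fun i => by fun_prop]
  have h1 : ∀ (c : Config) (i : ℕ), ∫⁻ c', ∑' j, (servedSet B (c.tx i) j).indicator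
      (fun c' => (((c.withStations c').shift (c'.bs j)).num i : ℝ≥0∞)) c' ∂P =
      ∑ k ∈ Finset.range (c.num i), ({c | CoveredD p c i k}.indicator
          (fun c => servedMass p.lamB B (fun _ => 1) (c.tx i)) c +
        {c | CoveredD p c i k}ᶜ.indicator
          (fun c => servedMass p.lamB B (fun _ => 1) (c.tx i)) c) := fun c i => by
    simp_rw [Set.indicator_self_add_compl_apply]
    rw [Finset.sum_const, Finset.card_range, nsmul_eq_mul,
      ← hP.lintegral_served hB hBtop measurable_const (fun _ _ => le_rfl),
      ← lintegral_const_mul' _ _ (ENNReal.natCast_ne_top _)]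
    refine lintegral_congr fun c' => ?_
    rw [← ENNReal.tsum_mul_left]
    refine tsum_congr fun j => ?_
    by_cases hj : c' ∈ servedSet B (c.tx i) j
    · simp [Set.indicator_of_mem hj, Config.shift, Config.withStations]
    · simp [Set.indicator_of_notMem hj]
  simp_rw [h1]
  rw [hP.lintegral_tsum_coveredD hW hWi hWt hW hWi hWt, ← mul_add,
    ← ENNReal.ofReal_add hN.1 (sub_nonneg.2 hN.2), add_sub_cancel,
    lintegral_servedMass p.lamB_pos B measurable_const, lintegral_one, measure_univ, mul_one,
    palm_normalization p.lamB_pos p.lamM_pos.le hB0 hBtop]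

/-- The covered receivers contribute `N̄ · 1` and the others `(N̄_max - N̄) E [g(D) q(D)]`; by
linearity the sum is the mean of `h`. -/
theorem IsNetworkLaw.lintegral_palm_cellSum_covered (hP : IsNetworkLaw p P) {g : ℝ → ℝ}
    (hg : Measurable g) (hg01 : ∀ r, 0 ≤ r → g r ∈ Set.Icc (0 : ℝ) 1) {B : Set Plane}
    (hB : MeasurableSet B) (hB0 : volume B ≠ 0) (hBtop : volume B ≠ ∞) :
    ∫⁻ c, cellSum c (fun i => countRx c i (fun k => Covered p g c i k))
        ∂palm P Config.bs p.lamB B =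
      ENNReal.ofReal (p.lamM / p.lamB * ∫ r, hfun p r (g r) ∂rayleighLaw p.lamB) := by
  have := isProbabilityMeasure_rayleighLaw p.lamB_pos
  have hN := hP.Nbar_mem_Icc
  have hgq : Measurable fun r => g r * qfun p r := hg.mul (measurable_qfun p)
  have hgq01 : ∀ r, 0 ≤ r → g r * qfun p r ∈ Set.Icc (0 : ℝ) 1 := fun r hr =>
    ⟨mul_nonneg (hg01 r hr).1 (qfun_nonneg p r),
      mul_le_one₀ (hg01 r hr).2 (qfun_nonneg p r) (qfun_le_one p hr)⟩
  have hgq1 : ∀ r, 0 ≤ r → ENNReal.ofReal (g r * qfun p r) ≤ 1 := fun r hr => by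
    simpa using (hgq01 r hr).2
  rw [hP.lintegral_palm_cellSum hB (Y := fun c i => countRx c i (fun k => Covered p g c i k))
    fun i => measurable_countRx (measurableSet_covered p hg i) i]
  simp_rw [hP.lintegral_served_countRx hB hBtop hg hg01]
  rw [hP.lintegral_tsum_coveredD (measurable_servedMass p.lamB B measurable_const)
    (lintegral_servedMass_ne_top p.lamB_pos hBtop measurable_const fun _ _ => le_rfl)
    (servedMass_ne_top p.lamB hBtop fun _ _ => le_rfl)
    (measurable_servedMass p.lamB B hgq.ennreal_ofReal)
    (lintegral_servedMass_ne_top p.lamB_pos hBtop hgq.ennreal_ofReal hgq1)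
    (servedMass_ne_top p.lamB hBtop hgq1),
    lintegral_servedMass p.lamB_pos B measurable_const,
    lintegral_servedMass p.lamB_pos B hgq.ennreal_ofReal, lintegral_one, measure_univ,
    lintegral_ofReal_rayleighLaw p.lamB_pos hgq hgq01, mul_assoc, mul_assoc, ← mul_add, one_mul,
    ← ENNReal.ofReal_mul' (sub_nonneg.2 hN.2), ← ENNReal.ofReal_add hN.1
      (mul_nonneg (integral_nonneg_of_ae ((ae_rayleighLaw_nonneg _).mono fun r hr =>
        (hgq01 r hr).1)) (sub_nonneg.2 hN.2)),
    palm_normalization p.lamB_pos p.lamM_pos.le hB0 hBtop]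
  have hi := integrable_rayleighLaw p.lamB_pos hgq hgq01
  unfold hfun
  rw [integral_add (integrable_const _) (hi.mul_const _), integral_mul_const]
  simp

theorem measurableSet_typical_tx (i : ℕ) : MeasurableSet {c : Config | c.tx i = 0} :=
  measurable_tx_apply i (measurableSet_singleton 0)

theorem IsNetworkLaw.lintegral_palm_typicalClusterCovered (hP : IsNetworkLaw p P) {B : Set Plane}
    (hB : MeasurableSet B) (hB0 : volume B ≠ 0) (hBtop : volume B ≠ ∞) :
    ∫⁻ c, typicalClusterCovered p c ∂palm P Config.tx p.lamM B = ENNReal.ofReal (Nbar p) := by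
  classical
  have hm : Measurable (typicalClusterCovered p) := by
    unfold typicalClusterCovered
    exact Measurable.tsum fun i => Measurable.ite (measurableSet_typical_tx i)
      (measurable_countRx (measurableSet_coveredD p i) i) measurable_const
  rw [lintegral_palm P measurable_tx_apply p.lamM hB hm]
  have hφ : Measurable (B.indicator (1 : Plane → ℝ≥0∞)) := measurable_one.indicator hB
  have hφi : ∫⁻ x, B.indicator (1 : Plane → ℝ≥0∞) x = volume B := lintegral_indicator_one hB
  have hφt : ∀ x, B.indicator (1 : Plane → ℝ≥0∞) x ≠ ∞ := fun x => by
    by_cases hx : x ∈ B <;> simp [hx]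
  have h1 : ∫⁻ c, ∑' j, {c : Config | c.tx j ∈ B}.indicator
      (fun c => typicalClusterCovered p (c.shift (c.tx j))) c ∂P =
      ∫⁻ c, ∑' i, ∑ k ∈ Finset.range (c.num i),
        ({c | CoveredD p c i k}.indicator (fun c => B.indicator 1 (c.tx i)) c +
          {c | CoveredD p c i k}ᶜ.indicator (fun _ => 0) c) ∂P := by
    refine lintegral_congr_ae ?_
    filter_upwards [hP.tx_poisson.ae_injective measurable_tx_apply p.lamM_pos.le] with c hc
    refine tsum_congr fun j => ?_
    by_cases hj : c.tx j ∈ B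
    · rw [Set.indicator_of_mem (show c ∈ {c : Config | c.tx j ∈ B} from hj), typicalClusterCovered,
        tsum_eq_single j]
      · rw [if_pos (show (c.shift (c.tx j)).tx j = 0 from sub_self _)]
        -- Transmitters are pairwise distinct almost surely, so after the shift only transmitter `j`
        -- sits at the origin; its covered receivers get the weight `1` on `B` and the others the
        -- weight `0`.
        simp only [countRx, coveredD_shift]
        refine Finset.sum_congr rfl fun k _ => ?_
        simp [Set.indicator, hj]
      · intro i hij
        exact if_neg fun h => hc j i hij (sub_eq_zero.1 h)
    · rw [Set.indicator_of_notMem (show c ∉ {c : Config | c.tx j ∈ B} from hj)]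
      simp [Set.indicator, hj]
  rw [h1, hP.lintegral_tsum_coveredD hφ (by rwa [hφi]) hφt (φ₂ := fun _ => 0) measurable_const
    (by simp) (by simp), hφi, lintegral_zero, zero_mul, add_zero,
    palm_normalization p.lamM_pos p.lamM_pos.le hB0 hBtop, div_self p.lamM_pos.ne', one_mul]

end Main

end MulticastD2D

theorem proposition6 (p : MulticastD2D.Params) (P : Measure MulticastD2D.Config)
    [IsProbabilityMeasure P] (hP : MulticastD2D.IsNetworkLaw p P)
    (g : ℝ → ℝ) (hg : Measurable g) (hg01 : ∀ r, 0 ≤ r → g r ∈ Set.Icc (0 : ℝ) 1)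
    (B : Set MulticastD2D.Plane) (hB : MeasurableSet B) (hB0 : volume B ≠ 0)
    (hBtop : volume B ≠ ∞) :
    (∫⁻ c, MulticastD2D.cellSum c (fun i => ENNReal.ofReal (g ‖c.tx i‖))
        ∂(MulticastD2D.palm P MulticastD2D.Config.bs p.lamB B) =
      ENNReal.ofReal (p.lamM / p.lamB *
        ∫ r, g r ∂(MulticastD2D.rayleighLaw p.lamB))) ∧
    (∫⁻ c, MulticastD2D.cellSum c (fun i => (c.num i : ℝ≥0∞))
        ∂(MulticastD2D.palm P MulticastD2D.Config.bs p.lamB B) =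
      ENNReal.ofReal (p.lamM / p.lamB * MulticastD2D.Nmax p)) ∧
    (∫⁻ c, MulticastD2D.cellSum c
          (fun i => MulticastD2D.countRx c i (fun k => MulticastD2D.Covered p g c i k))
        ∂(MulticastD2D.palm P MulticastD2D.Config.bs p.lamB B) =
      ENNReal.ofReal (p.lamM / p.lamB *
        ∫ r, MulticastD2D.hfun p r (g r) ∂(MulticastD2D.rayleighLaw p.lamB))) ∧
    (∫⁻ c, MulticastD2D.typicalClusterCovered p c
        ∂(MulticastD2D.palm P MulticastD2D.Config.tx p.lamM B) =
      ENNReal.ofReal (MulticastD2D.Nbar p)) :=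
  ⟨hP.lintegral_palm_cellSum_assisted hg hg01 hB hB0 hBtop,
    hP.lintegral_palm_cellSum_num hB hB0 hBtop,
    hP.lintegral_palm_cellSum_covered hg hg01 hB hB0 hBtop,
    hP.lintegral_palm_typicalClusterCovered hB hB0 hBtop⟩
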